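/- Let $n\ge 3$, $p=\frac{n}{n-2}$, and write points of $\mathbb R^n_+=\{(x,t):x\in\mathbb R^{n-1},\,t>0\}$ as $(x,t)$. Let $H^1(\mathbb R^n_+)$ be the closure of the restrictions to $\mathbb R^n_+$ of real-valued functions in $C_c^\infty(\mathbb R^n)$ with respect to the norm $\|f\|_{H^1}=\big(\int_{\mathbb R^n_+}|\nabla f|^2\big)^{1/2}$ (a Hilbert space of functions in $L^{2n/(n-2)}(\mathbb R^n_+)$, with trace in $L^{2(n-1)/(n-2)}(\mathbb R^{n-1})$). For $z\in\mathbb R^{n-1}$ and $\lambda>0$ let $$U[z,\lambda](x,t)=(n-2)^{\frac{n-2}{2}}\left(\frac{\lambda}{(1+\lambda t)^2+\lambda^2|x-z|^2}\right)^{\frac{n-2}{2}},$$ let $U=U[0,1]$, and let $$T_U=\mathrm{span}\{U,\ \partial_\lambda U[z,\lambda]|_{(z,\lambda)=(0,1)},\ \partial_{z_i}U[z,\lambda]|_{(z,\lambda)=(0,1)}\ (1\le i\le n-1)\}.$$ Let $F$ be the conformal map from the unit ball $\mathbb B^n$ onto $\mathbb R^n_+$ given by $$F(y',y_n)=\left(\frac{2y'}{(1+y_n)^2+|y'|^2},\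 \frac{1-|y|^2}{(1+y_n)^2+|y'|^2}\right),$$ and for a function $\varphi$ on $\mathbb R^n_+$ put $\mathcal F[\varphi]=(U^{-1}\varphi)\circ F$ on $\mathbb B^n$. Let $\rho\in H^1(\mathbb R^n_+)$ be orthogonal to $T_U$ with respect to the inner product $\int_{\mathbb R^n_+}\nabla u\cdot\nabla v$. Then, with $\rho$ on $\mathbb R^{n-1}=\partial\mathbb R^n_+$ understood as the trace of $\rho$, the integral on the right-hand side below is finite and $$\|\rho\|^2_{H^1(\mathbb R^n_+)}\ \ge\ \frac{n+2}{n-2}\int_{\mathbb R^{n-1}}U^{p-1}\rho^2\,dx .$$ Moreover, equality holds if and only if $\mathcal F[\rho]$ coincides (almost everywhere in $\mathbb B^n$) with a homogeneous harmonic polynomial of degree $2$ (the zero polynomial included). -/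

import Mathlib

open MeasureTheory Filter Topology

noncomputable section

namespace EscobarGap

/-- `ℝⁿ` with `n = d + 1`; a point is `(x, t)` with `x ∈ ℝᵈ = ℝⁿ⁻¹` and last coordinate `t`. -/
abbrev Rn (d : ℕ) : Type := EuclideanSpace ℝ (Fin (d + 1))

/-- The boundary `ℝⁿ⁻¹` of the half-space. -/
abbrev Bd (d : ℕ) : Type := EuclideanSpace ℝ (Fin d)

/-- The dimension `n = d + 1`, as a real number. -/
def dim (d : ℕ) : ℝ := (d : ℝ) + 1

/-- The point `(x, t)`. -/
def pt {d : ℕ} (x : Bd d) (t : ℝ) : Rn d :=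
  WithLp.toLp 2 (Fin.snoc (α := fun _ => ℝ) (fun i => x i) t)

/-- The component `x` of `(x, t)`. -/
def horiz {d : ℕ} (X : Rn d) : Bd d := WithLp.toLp 2 (fun i => X i.castSucc)

/-- The component `t` of `(x, t)`. -/
def vert {d : ℕ} (X : Rn d) : ℝ := X (Fin.last d)

/-- The open half-space `ℝⁿ₊ = {(x, t) : t > 0}`. -/
def halfSpace (d : ℕ) : Set (Rn d) := {X | 0 < vert X}

/-- Lebesgue measure on the half-space. -/
def halfVol (d : ℕ) : Measure (Rn d) := volume.restrict (halfSpace d)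

/-- The Sobolev exponent `2* = 2n/(n-2)`. -/
def sobExp (d : ℕ) : ENNReal := ENNReal.ofReal (2 * dim d / (dim d - 2))

/-- The trace exponent `2† = 2(n-1)/(n-2)`. -/
def traceExp (d : ℕ) : ENNReal := ENNReal.ofReal (2 * (dim d - 1) / (dim d - 2))

/-- The exponent `p = 2† - 1 = n/(n-2)`. -/
def pExp (d : ℕ) : ℝ := dim d / (dim d - 2)

/-- The functions `φ k ∈ C_c^∞(ℝⁿ)`, restricted to the half-space, converge to `u` in the norm
`‖∇ · ‖_{L²(ℝⁿ₊)}`, and `G` is the limit of their gradients. The limit is realised as a function by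
the convergence in `L^{2*}(ℝⁿ₊)`, which by the Sobolev inequality accompanies the convergence of
the gradients. Only the values on the half-space matter, up to null sets. -/
structure IsApprox {d : ℕ} (φ : ℕ → Rn d → ℝ) (u : Rn d → ℝ) (G : Rn d → Rn d) : Prop where
  smooth : ∀ k, ContDiff ℝ (⊤ : ℕ∞) (φ k)
  compact : ∀ k, HasCompactSupport (φ k)
  memLp_fun : MemLp u (sobExp d) (halfVol d)
  memLp_grad : MemLp G 2 (halfVol d)
  tendsto_fun :
    Tendsto (fun k => eLpNorm (fun X => φ k X - u X) (sobExp d) (halfVol d)) atTop (𝓝 0)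
  tendsto_grad :
    Tendsto (fun k => eLpNorm (fun X => gradient (φ k) X - G X) 2 (halfVol d)) atTop (𝓝 0)

/-- `G` is the gradient of the element `u` of `H¹(ℝⁿ₊)`. -/
def HasGrad {d : ℕ} (u : Rn d → ℝ) (G : Rn d → Rn d) : Prop := ∃ φ, IsApprox φ u G

/-- `u ∈ H¹(ℝⁿ₊)`, the closure of `C_c^∞(ℝⁿ)|_{ℝⁿ₊}` under the norm `‖∇ · ‖_{L²(ℝⁿ₊)}`. -/
def MemH1 {d : ℕ} (u : Rn d → ℝ) : Prop := ∃ G, HasGrad u G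

/-- The gradient of `u ∈ H¹(ℝⁿ₊)` (unique up to a null set of the half-space). -/
def grad {d : ℕ} (u : Rn d → ℝ) : Rn d → Rn d := Classical.epsilon (HasGrad u)

/-- The inner product `∫_{ℝⁿ₊} ∇u · ∇v` of `H¹(ℝⁿ₊)`. -/
def h1Inner {d : ℕ} (u v : Rn d → ℝ) : ℝ := ∫ X, inner ℝ (grad u X) (grad v X) ∂(halfVol d)

/-- The squared norm `∫_{ℝⁿ₊} |∇u|²` of `H¹(ℝⁿ₊)`. -/
def h1NormSq {d : ℕ} (u : Rn d → ℝ) : ℝ := ∫ X, ‖grad u X‖ ^ 2 ∂(halfVol d)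

/-- `τ` is the trace on `ℝⁿ⁻¹` of the element `u` of `H¹(ℝⁿ₊)`: the limit in `L^{2†}(ℝⁿ⁻¹)` of the
restrictions to the boundary of test functions that converge to `u` in `H¹(ℝⁿ₊)`. -/
def HasTrace {d : ℕ} (u : Rn d → ℝ) (τ : Bd d → ℝ) : Prop :=
  MemLp τ (traceExp d) volume ∧ ∃ φ G, IsApprox φ u G ∧
    Tendsto (fun k => eLpNorm (fun x => φ k (pt x 0) - τ x) (traceExp d) volume) atTop (𝓝 0)

/-- The trace of `u ∈ H¹(ℝⁿ₊)` (unique up to a null set of `ℝⁿ⁻¹`). -/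
def trace {d : ℕ} (u : Rn d → ℝ) : Bd d → ℝ := Classical.epsilon (HasTrace u)

/-- The Escobar bubble `U[z, l]`. -/
def bubble {d : ℕ} (z : Bd d) (l : ℝ) (X : Rn d) : ℝ :=
  (dim d - 2) ^ ((dim d - 2) / 2) *
    (l / ((1 + l * vert X) ^ 2 + l ^ 2 * ‖horiz X - z‖ ^ 2)) ^ ((dim d - 2) / 2)

/-- The standard bubble `U = U[0, 1]`. -/
def stdBubble (d : ℕ) : Rn d → ℝ := bubble 0 1

/-- `∂_λ U[0, 1]`. -/
def dScale (d : ℕ) (X : Rn d) : ℝ := deriv (fun l : ℝ => bubble (0 : Bd d) l X) 1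

/-- `∂_{z_i} U[0, 1]`. -/
def dShift {d : ℕ} (i : Fin d) (X : Rn d) : ℝ :=
  deriv (fun s : ℝ => bubble (EuclideanSpace.single i s : Bd d) 1 X) 0

/-- The tangent space `T_U = span {U, ∂_λ U, ∂_{z_i} U}` at `U = U[0, 1]`. -/
def tangentSpace (d : ℕ) : Submodule ℝ (Rn d → ℝ) :=
  Submodule.span ℝ ({stdBubble d, dScale d} ∪ Set.range (fun i : Fin d => dShift i))

/-- The conformal map `F` from the unit ball onto the half-space. -/
def confMap {d : ℕ} (y : Rn d) : Rn d :=
  pt ((2 / ((1 + vert y) ^ 2 + ‖horiz y‖ ^ 2)) • horiz y)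
    ((1 - ‖y‖ ^ 2) / ((1 + vert y) ^ 2 + ‖horiz y‖ ^ 2))

/-- The transplant `ℱ[u] = (U⁻¹ u) ∘ F` of a function on the half-space to the unit ball. -/
def transplant {d : ℕ} (u : Rn d → ℝ) (y : Rn d) : ℝ :=
  (stdBubble d (confMap y))⁻¹ * u (confMap y)

/-- `P` is a harmonic polynomial that is homogeneous of degree `k` (the zero polynomial included). -/
def IsHomHarmonic {d : ℕ} (k : ℕ) (P : MvPolynomial (Fin (d + 1)) ℝ) : Prop :=
  P.IsHomogeneous k ∧ ∑ i, MvPolynomial.pderiv i (MvPolynomial.pderiv i P) = 0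

/-- `u ∈ R_k = ℱ⁻¹(E_k)`: the transplant of `u` is (almost everywhere in the unit ball) a
homogeneous harmonic polynomial of degree `k`. -/
def MemR {d : ℕ} (k : ℕ) (u : Rn d → ℝ) : Prop :=
  ∃ P : MvPolynomial (Fin (d + 1)) ℝ, IsHomHarmonic k P ∧
    ∀ᵐ y ∂(volume.restrict (Metric.ball (0 : Rn d) 1)),
      transplant u y = MvPolynomial.eval (fun i => y i) P

end EscobarGap

end

/-! The map `confMap` is the inversion in the sphere of radius √2 about e = (0, -1), and U is a
constant times |X - e|^{-(n-2)}. Hence P ↦ U · (P ∘ F), called `kel`, is a Kelvin transform and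
takes harmonic polynomials to harmonic functions w on the half-space (`sum_kelD_kelD`). If P is
moreover homogeneous of degree k, the Steklov condition ∂_ν P = kP on the unit sphere turns into
-∂_t w = μ_k U^{p-1} w on t = 0 with μ_k = (2k + n - 2)/(n - 2) (`kel_dK_last_boundary`). Green's
formula then gives ∫ ∇ρ·∇w = μ_k ∫ U^{p-1} ρ w for every ρ in H¹ (`green_trace`, `green_kel`).

On the half-space, T_U consists of the transforms of the polynomials of degree at most one
(`stdBubble_eq_kel`, `dScale_eq`, `dShift_eq`). Orthogonality to T_U therefore removes the
components with eigenvalues μ_0 and μ_1, and the next eigenvalue is μ_2 = (n + 2)/(n - 2).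

The boundary values of the transforms are dense in L²(U^{p-1} dx), by Stone–Weierstrass on the
sphere and the Fischer decomposition (`exists_harmonic_eq_on_sphere`, `exists_bdKel_near`). The
gradients of the transforms are not complete in H¹, since functions with zero trace are orthogonal
to all of them, but this does no harm: on the gradient side Bessel's inequality is enough
(`spectral_gap`). Equality forces the boundary values, and then the gradient, to come from degree 2
(`spectral_gap_eq_iff`).

Since `grad` and `trace` are chosen by `Classical.epsilon`, they need existence or uniqueness
statements. An elementary trace inequality (`lintegral_boundary_le`) yields both the existence of
traces and the fact that the gradient determines the function. -/

noncomputable section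

namespace EscobarGap

/-! ### Harmonic polynomials: Fischer decomposition and the algebra of the Kelvin transform -/

section Polynomial

open MvPolynomial

variable {σ : Type*} [Fintype σ]

/-- The Laplacian on polynomials. -/
def lap (σ : Type*) [Fintype σ] : MvPolynomial σ ℝ →ₗ[ℝ] MvPolynomial σ ℝ :=
  ∑ i, (pderiv i).toLinearMap ∘ₗ (pderiv i).toLinearMap

theorem lap_apply (P : MvPolynomial σ ℝ) : lap σ P = ∑ i, pderiv i (pderiv i P) := by
  simp [lap]

/-- The polynomial `∑ xᵢ²`. -/
def sqNorm (σ : Type*) [Fintype σ] : MvPolynomial σ ℝ := ∑ i, X i ^ 2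

/-- Homogeneous harmonic polynomials of degree `k`. -/
def homHarm (σ : Type*) [Fintype σ] (k : ℕ) : Submodule ℝ (MvPolynomial σ ℝ) :=
  homogeneousSubmodule σ ℝ k ⊓ LinearMap.ker (lap σ)

theorem mem_homHarm {k : ℕ} {P : MvPolynomial σ ℝ} :
    P ∈ homHarm σ k ↔ P.IsHomogeneous k ∧ lap σ P = 0 := by
  simp [homHarm]

theorem isHomHarmonic_iff {d k : ℕ} {P : MvPolynomial (Fin (d + 1)) ℝ} :
    IsHomHarmonic k P ↔ P ∈ homHarm (Fin (d + 1)) k := by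
  rw [mem_homHarm, lap_apply, IsHomHarmonic]

theorem isHomogeneous_sqNorm : (sqNorm σ).IsHomogeneous 2 :=
  IsHomogeneous.sum _ _ _ fun i _ => isHomogeneous_X_pow i 2

theorem pderiv_sqNorm (i : σ) : pderiv i (sqNorm σ) = 2 * X i := by
  classical
  simp only [sqNorm, map_sum, Derivation.leibniz_pow, pderiv_X]
  rw [Finset.sum_eq_single i]
  · simp
  · intro b _ hb; simp [hb]
  · simp

/-- Product rule: the cross term is 4 ∑ xᵢ ∂ᵢf, which Euler's identity turns into 4N f. -/
theorem lap_sqNorm_mul {N : ℕ} {f : MvPolynomial σ ℝ} (hf : f.IsHomogeneous N) :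
    lap σ (sqNorm σ * f) = C (2 * (Fintype.card σ : ℝ) + 4 * N) * f + sqNorm σ * lap σ f := by
  have h : ∀ i : σ, pderiv i (pderiv i (sqNorm σ * f)) =
      2 * f + 4 * (X i * pderiv i f) + sqNorm σ * pderiv i (pderiv i f) := by
    intro i
    have h2 : pderiv i (2 : MvPolynomial σ ℝ) = 0 := by
      simpa using (pderiv i : Derivation ℝ _ _).map_natCast 2
    simp only [Derivation.leibniz, pderiv_sqNorm, smul_eq_mul, map_add, pderiv_X_self, h2]
    ring
  simp only [lap_apply, h, Finset.sum_add_distrib, ← Finset.mul_sum, hf.sum_X_mul_pderiv]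
  simp only [Finset.sum_const, Finset.card_univ, nsmul_eq_mul, map_add, map_mul, map_natCast,
    map_ofNat]
  ring

theorem isHomogeneous_sqNorm_pow_mul {j k : ℕ} {h : MvPolynomial σ ℝ} (hh : h.IsHomogeneous k) :
    (sqNorm σ ^ j * h).IsHomogeneous (2 * j + k) :=
  (isHomogeneous_sqNorm.pow j).mul hh

theorem lap_sqNorm_pow_mul {k : ℕ} {h : MvPolynomial σ ℝ} (hh : h ∈ homHarm σ k) (j : ℕ) :
    lap σ (sqNorm σ ^ (j + 1) * h) =
      C (2 * (j + 1) * (2 * j + 2 * k + Fintype.card σ) : ℝ) * (sqNorm σ ^ j * h) := by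
  rw [mem_homHarm] at hh
  induction j with
  | zero =>
    have := lap_sqNorm_mul hh.1
    rw [zero_add, pow_one, this, hh.2]
    simp only [map_add, map_mul, map_natCast, CharP.cast_eq_zero, pow_zero, map_ofNat, map_one,
      map_zero]
    ring
  | succ j ih =>
    have h1 := lap_sqNorm_mul (isHomogeneous_sqNorm_pow_mul (j := j + 1) hh.1)
    rw [ih] at h1
    rw [show sqNorm σ ^ (j + 1 + 1) * h = sqNorm σ * (sqNorm σ ^ (j + 1) * h) by ring, h1]
    push_cast
    simp only [map_add, map_mul, map_natCast, map_one, map_ofNat]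
    ring

/-- The span of the polynomials `|x|^{2j} h` of degree `N` with `h` harmonic and homogeneous. -/
def fischerSpan (σ : Type*) [Fintype σ] (N : ℕ) : Submodule ℝ (MvPolynomial σ ℝ) :=
  Submodule.span ℝ {p | ∃ j k h, h ∈ homHarm σ k ∧ 2 * j + k = N ∧ p = sqNorm σ ^ j * h}

theorem isHomogeneous_of_mem_fischerSpan {N : ℕ} {p : MvPolynomial σ ℝ}
    (hp : p ∈ fischerSpan σ N) : p.IsHomogeneous N := by
  have : fischerSpan σ N ≤ homogeneousSubmodule σ ℝ N := by
    rw [fischerSpan, Submodule.span_le]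
    rintro _ ⟨j, k, h, hh, rfl, rfl⟩
    exact isHomogeneous_sqNorm_pow_mul (mem_homHarm.1 hh).1
  exact this hp

/-- The Laplacian maps |x|^{2j+2} h to a nonzero multiple of |x|^{2j} h, so it can be inverted on
each generator. -/
theorem exists_lap_eq [Nonempty σ] {N : ℕ} {s : MvPolynomial σ ℝ} (hs : s ∈ fischerSpan σ N) :
    ∃ q ∈ fischerSpan σ (N + 2), lap σ q = s := by
  have : fischerSpan σ N ≤ (fischerSpan σ (N + 2)).map (lap σ) := by
    rw [fischerSpan, Submodule.span_le]
    rintro _ ⟨j, k, h, hh, rfl, rfl⟩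
    have hc : (2 * (j + 1) * (2 * j + 2 * k + Fintype.card σ) : ℝ) ≠ 0 := by
      have : 0 < (Fintype.card σ : ℝ) := by exact_mod_cast Fintype.card_pos
      positivity
    refine ⟨(2 * (j + 1) * (2 * j + 2 * k + Fintype.card σ) : ℝ)⁻¹ • (sqNorm σ ^ (j + 1) * h),
      Submodule.smul_mem _ _ (Submodule.subset_span ⟨j + 1, k, h, hh, by ring, rfl⟩), ?_⟩
    rw [map_smul, lap_sqNorm_pow_mul hh, C_mul', smul_smul, inv_mul_cancel₀ hc, one_smul]
  exact this hs

/-- Every homogeneous polynomial is a combination of products `|x|^{2j} h`, `h` harmonic. -/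
theorem mem_fischerSpan [Nonempty σ] {N : ℕ} {p : MvPolynomial σ ℝ} (hp : p.IsHomogeneous N) :
    p ∈ fischerSpan σ N := by
  induction N using Nat.strong_induction_on generalizing p with
  | _ N ih =>
  -- By induction the Laplacian of `p`, of degree N - 2, is already decomposed, and this lifts to a
  -- `q` in the span; then `p - q` is harmonic. In degrees 0 and 1 the Laplacian vanishes and `q =
  -- 0` serves.
  have key : ∃ q ∈ fischerSpan σ N, lap σ q = lap σ p := by
    match N, ih, hp with
    | 0, _, hp =>
      refine ⟨0, zero_mem _, ?_⟩
      have h0 : p = C (coeff 0 p) := totalDegree_eq_zero_iff_eq_C.1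
        ((totalDegree_zero_iff_isHomogeneous σ).2 hp)
      rw [h0, map_zero, lap_apply]
      simp
    | 1, _, hp =>
      refine ⟨0, zero_mem _, ?_⟩
      rw [map_zero, lap_apply]
      symm
      refine Finset.sum_eq_zero fun i _ => ?_
      have h1 : (pderiv i p).IsHomogeneous 0 := hp.pderiv
      rw [totalDegree_eq_zero_iff_eq_C.1 ((totalDegree_zero_iff_isHomogeneous σ).2 h1), pderiv_C]
    | N + 2, ih, hp =>
      refine exists_lap_eq (ih N (by omega) ?_)
      rw [lap_apply]
      exact IsHomogeneous.sum _ _ _ fun i _ => (hp.pderiv (i := i)).pderiv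
  obtain ⟨q, hq, hqp⟩ := key
  have h1 : p - q ∈ fischerSpan σ N := by
    refine Submodule.subset_span ⟨0, N, p - q, ?_, by ring, by simp⟩
    exact mem_homHarm.2 ⟨hp.sub (isHomogeneous_of_mem_fischerSpan hq), by simp [hqp]⟩
  simpa using add_mem h1 hq

/-- On the unit sphere every polynomial agrees with a sum of homogeneous harmonic ones. -/
theorem exists_harmonic_eq_on_sphere [Nonempty σ] (p : MvPolynomial σ ℝ) :
    ∃ q ∈ ⨆ k, homHarm σ k, ∀ y : σ → ℝ, ∑ i, y i ^ 2 = 1 → eval y p = eval y q := by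
  let S : Submodule ℝ (MvPolynomial σ ℝ) :=
    { carrier := {p | ∃ q ∈ ⨆ k, homHarm σ k, ∀ y : σ → ℝ, ∑ i, y i ^ 2 = 1 → eval y p = eval y q}
      add_mem' := by
        rintro a b ⟨q, hq, h⟩ ⟨q', hq', h'⟩
        exact ⟨q + q', add_mem hq hq', fun y hy => by simp [h y hy, h' y hy]⟩
      zero_mem' := ⟨0, zero_mem _, by simp⟩
      smul_mem' := by
        rintro c a ⟨q, hq, h⟩
        exact ⟨c • q, Submodule.smul_mem _ _ hq, fun y hy => by simp [h y hy]⟩ }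
  have h : ∀ N, fischerSpan σ N ≤ S := by
    intro N
    rw [fischerSpan, Submodule.span_le]
    rintro _ ⟨j, k, h, hh, rfl, rfl⟩
    refine ⟨h, Submodule.mem_iSup_of_mem k hh, fun y hy => ?_⟩
    simp [sqNorm, hy]
  have : p ∈ S := by
    rw [← sum_homogeneousComponent p]
    exact sum_mem fun i _ => h i (mem_fischerSpan (homogeneousComponent_isHomogeneous i p))
  exact this

/-! ### The operators that describe the derivatives of Kelvin transforms -/

section Kelvin

set_option linter.unusedSectionVars false

variable (e : σ → ℝ) (m : ℝ)

/-- The coordinate `yᵢ - eᵢ`. -/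
def shiftX (i : σ) : MvPolynomial σ ℝ := X i - C (e i)

/-- The polynomial `|y - e|²`. -/
def shiftSq : MvPolynomial σ ℝ := ∑ i, shiftX e i * shiftX e i

/-- The Euler field `∑ (yⱼ - eⱼ) ∂ⱼ`. -/
def eulerD : Derivation ℝ (MvPolynomial σ ℝ) (MvPolynomial σ ℝ) := ∑ j, shiftX e j • pderiv j

theorem eulerD_apply (P : MvPolynomial σ ℝ) : eulerD e P = ∑ j, shiftX e j * pderiv j P := by
  simp only [eulerD, ← Derivation.coeFnAddMonoidHom_apply, map_sum, Finset.sum_apply]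
  simp

/-- `½|y-e|² ∂ᵢ - (yᵢ-eᵢ) ∑ (yⱼ-eⱼ) ∂ⱼ`: the action of `∂ᵢ` on functions of the inverted point. -/
def invD (i : σ) : Derivation ℝ (MvPolynomial σ ℝ) (MvPolynomial σ ℝ) :=
  (C (1 / 2) * shiftSq e) • pderiv i - shiftX e i • eulerD e

theorem invD_apply (i : σ) (P : MvPolynomial σ ℝ) :
    invD e i P = C (1 / 2) * shiftSq e * pderiv i P - shiftX e i * eulerD e P := by
  simp [invD]

/-- The action of `∂ᵢ` on Kelvin transforms. -/
def kelD (i : σ) : MvPolynomial σ ℝ →ₗ[ℝ] MvPolynomial σ ℝ :=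
  (invD e i).toLinearMap - m • LinearMap.mulLeft ℝ (shiftX e i)

theorem kelD_apply (i : σ) (P : MvPolynomial σ ℝ) :
    kelD e m i P = C (1 / 2) * shiftSq e * pderiv i P - shiftX e i * (C m * P + eulerD e P) := by
  simp [kelD, invD_apply, ← C_mul']
  ring

theorem pderiv_shiftX_self (i : σ) : pderiv i (shiftX e i) = 1 := by simp [shiftX]

theorem pderiv_shiftX_of_ne {i j : σ} (h : i ≠ j) : pderiv i (shiftX e j) = 0 := by
  simp [shiftX, pderiv_X_of_ne h.symm]

theorem eulerD_shiftX (i : σ) : eulerD e (shiftX e i) = shiftX e i := by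
  rw [eulerD_apply, Finset.sum_eq_single i]
  · simp [pderiv_shiftX_self]
  · intro j _ hj; simp [pderiv_shiftX_of_ne e hj]
  · simp

theorem eulerD_shiftSq : eulerD e (shiftSq e) = 2 * shiftSq e := by
  simp [shiftSq, eulerD_shiftX, Finset.mul_sum, two_mul]

theorem pderiv_shiftSq (i : σ) : pderiv i (shiftSq e) = 2 * shiftX e i := by
  rw [shiftSq, map_sum, Finset.sum_eq_single i]
  · simp [pderiv_shiftX_self, two_mul]
  · intro j _ hj; simp [pderiv_shiftX_of_ne e hj.symm]
  · simp

theorem pderiv_pderiv_comm (i j : σ) (P : MvPolynomial σ ℝ) :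
    pderiv i (pderiv j P) = pderiv j (pderiv i P) := by
  have : ⁅(pderiv i : Derivation ℝ (MvPolynomial σ ℝ) (MvPolynomial σ ℝ)),
      (pderiv j : Derivation ℝ (MvPolynomial σ ℝ) (MvPolynomial σ ℝ))⁆ = 0 := by
    classical
    refine MvPolynomial.derivation_ext fun k => ?_
    simp only [Derivation.commutator_apply, pderiv_X, Derivation.zero_apply]
    simp only [Pi.single_apply]
    split_ifs <;> simp
  have h := DFunLike.congr_fun this P
  rwa [Derivation.commutator_apply, Derivation.zero_apply, sub_eq_zero] at h

/-- This is the commutator [E, ∂ᵢ] = -∂ᵢ of the Euler field, contracted with yᵢ - eᵢ. -/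
theorem sum_shiftX_mul_eulerD_pderiv (P : MvPolynomial σ ℝ) :
    ∑ i, shiftX e i * eulerD e (pderiv i P) = eulerD e (eulerD e P) - eulerD e P := by
  have h : ∀ i, eulerD e (pderiv i P) = pderiv i (eulerD e P) - pderiv i P := by
    intro i
    simp only [eulerD_apply, map_sum, Derivation.leibniz, Finset.sum_add_distrib, smul_eq_mul]
    rw [Finset.sum_eq_single (s := Finset.univ) (f := fun j => pderiv j P * _) i]
    · simp [pderiv_shiftX_self, pderiv_pderiv_comm i]
    · intro j _ hj; simp [pderiv_shiftX_of_ne e hj.symm]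
    · simp
  simp only [h, mul_sub, Finset.sum_sub_distrib, ← eulerD_apply]

/-- The Kelvin transform of a harmonic polynomial is harmonic. -/
theorem sum_kelD_kelD (hm : (Fintype.card σ : ℝ) = 2 * m + 2) {P : MvPolynomial σ ℝ}
    (hP : lap σ P = 0) : ∑ i, kelD e m i (kelD e m i P) = 0 := by
  set E := C m * P + eulerD e P with hE
  set r := shiftSq e with hr
  have hCD : ∀ (a : ℝ) (Q : MvPolynomial σ ℝ), eulerD e (C a * Q) = C a * eulerD e Q := by
    intro a Q; simp [C_mul']
  have hCp : ∀ (i : σ) (a : ℝ) (Q : MvPolynomial σ ℝ), pderiv i (C a * Q) = C a * pderiv i Q := by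
    intro i a Q; simp [C_mul']
  -- `ring` treats `C (1 / 2)` as an atom; this relation is what the `linear_combination` calls
  -- below feed it.
  have hh : (C (1 / 2) : MvPolynomial σ ℝ) * 2 = 1 := by
    rw [← map_ofNat (C : ℝ →+* MvPolynomial σ ℝ) 2, ← C_mul]; simp
  have key : ∀ i, kelD e m i (kelD e m i P) =
      C (1 / 2) * r * (shiftX e i * pderiv i P + C (1 / 2) * r * pderiv i (pderiv i P) - E
        - shiftX e i * pderiv i E)
      - (C m * (C (1 / 2) * r) * (shiftX e i * pderiv i P) - C m * E * (shiftX e i * shiftX e i)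
        + r * (shiftX e i * pderiv i P) + C (1 / 2) * r * (shiftX e i * eulerD e (pderiv i P))
        - (shiftX e i * shiftX e i) * (E + eulerD e E)) := by
    intro i
    rw [kelD_apply, kelD_apply, ← hE, ← hr]
    simp only [map_sub, Derivation.leibniz, mul_assoc, hCD, hCp, smul_eq_mul, hr, pderiv_shiftSq,
      eulerD_shiftSq, pderiv_shiftX_self, eulerD_shiftX]
    linear_combination (C (1 / 2) * shiftSq e * shiftX e i * pderiv i P
      - shiftX e i * shiftSq e * pderiv i P) * hh
  have hlap : ∑ i, pderiv i (pderiv i P) = 0 := by rw [← lap_apply, hP]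
  have hEE : eulerD e E = C m * eulerD e P + eulerD e (eulerD e P) := by rw [hE, map_add, hCD]
  simp only [key, Finset.sum_sub_distrib, Finset.sum_add_distrib, ← Finset.mul_sum,
    ← Finset.sum_mul, ← eulerD_apply, sum_shiftX_mul_eulerD_pderiv, hlap, Finset.sum_const,
    Finset.card_univ, nsmul_eq_mul]
  rw [← shiftSq, ← hr, hEE]
  -- The only place where the dimension matters: m = (n - 2)/2 is the exponent for which the
  -- remaining terms cancel.
  have hcard : (Fintype.card σ : MvPolynomial σ ℝ) = 2 * C m + 2 := by
    rw [← map_natCast (C : ℝ →+* MvPolynomial σ ℝ), hm]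
    simp only [map_add, map_mul, map_ofNat]
  rw [hcard, hE]
  linear_combination (r * (-(C m + 1) * (C m * P + eulerD e P)
    + eulerD e P - C m * eulerD e P - eulerD e (eulerD e P))) * hh

end Kelvin

end Polynomial

/-! ### Abstract spectral gap for two Hilbert spaces linked by a Green identity -/

section Hilbert

open scoped InnerProductSpace

variable {H K V : Type*} [NormedAddCommGroup H] [InnerProductSpace ℝ H]
  [NormedAddCommGroup K] [InnerProductSpace ℝ K] [AddCommGroup V] [Module ℝ V]

/-- Projecting to the lines spanned by the members of an orthogonal system improves the
approximation. -/
theorem norm_sq_sub_le_sum_of_orthogonal (s : Finset ℕ) (v : ℕ → K)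
    (hv : ∀ i ∈ s, ∀ j ∈ s, i ≠ j → ⟪v i, v j⟫_ℝ = 0) (x : K) :
    ‖x‖ ^ 2 - ‖x - ∑ i ∈ s, v i‖ ^ 2 ≤ ∑ i ∈ s, ⟪x, v i⟫_ℝ ^ 2 / ‖v i‖ ^ 2 := by
  have h1 : ‖∑ i ∈ s, v i‖ ^ 2 = ∑ i ∈ s, ‖v i‖ ^ 2 := by
    rw [← real_inner_self_eq_norm_sq, sum_inner]
    refine Finset.sum_congr rfl fun i hi => ?_
    rw [inner_sum, Finset.sum_eq_single i, real_inner_self_eq_norm_sq]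
    · intro j hj hji; exact hv i hi j hj hji.symm
    · exact fun h => absurd hi h
  rw [norm_sub_sq_real, h1, inner_sum]
  have h2 : ∀ i ∈ s, 2 * ⟪x, v i⟫_ℝ - ‖v i‖ ^ 2 ≤ ⟪x, v i⟫_ℝ ^ 2 / ‖v i‖ ^ 2 := by
    intro i _
    rcases eq_or_ne (v i) 0 with h | h
    · simp [h]
    · have : 0 < ‖v i‖ ^ 2 := by positivity
      rw [le_div_iff₀ this]
      nlinarith [sq_nonneg (⟪x, v i⟫_ℝ - ‖v i‖ ^ 2)]
  have := Finset.sum_le_sum h2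
  rw [Finset.sum_sub_distrib, ← Finset.mul_sum] at this
  linarith

/-- Bessel's inequality for an orthogonal system that need not be normalised. -/
theorem sum_inner_sq_div_le (s : Finset ℕ) (v : ℕ → H)
    (hv : ∀ i ∈ s, ∀ j ∈ s, i ≠ j → ⟪v i, v j⟫_ℝ = 0) (x : H) :
    ∑ i ∈ s, ⟪x, v i⟫_ℝ ^ 2 / ‖v i‖ ^ 2 ≤ ‖x‖ ^ 2 := by
  set c : ℕ → ℝ := fun i => ⟪x, v i⟫_ℝ / ‖v i‖ ^ 2
  have h1 : ‖∑ i ∈ s, c i • v i‖ ^ 2 = ∑ i ∈ s, c i ^ 2 * ‖v i‖ ^ 2 := by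
    rw [← real_inner_self_eq_norm_sq, sum_inner]
    refine Finset.sum_congr rfl fun i hi => ?_
    rw [inner_sum, Finset.sum_eq_single i, real_inner_self_eq_norm_sq, norm_smul, mul_pow]
    · simp
    · intro j hj hji; rw [inner_smul_left, inner_smul_right, hv i hi j hj hji.symm]; simp
    · exact fun h => absurd hi h
  have h2 : 0 ≤ ‖x - ∑ i ∈ s, c i • v i‖ ^ 2 := by positivity
  rw [norm_sub_sq_real, h1, inner_sum] at h2
  have h3 : ∀ i ∈ s, 2 * ⟪x, c i • v i⟫_ℝ - c i ^ 2 * ‖v i‖ ^ 2 = ⟪x, v i⟫_ℝ ^ 2 / ‖v i‖ ^ 2 := by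
    intro i _
    rw [inner_smul_right]
    simp only [c]
    rcases eq_or_ne (v i) 0 with h | h
    · simp [h]
    · have : ‖v i‖ ≠ 0 := by simpa using h
      field_simp
      ring
  rw [← Finset.sum_congr rfl h3, Finset.sum_sub_distrib, ← Finset.mul_sum]
  linarith

variable {E : ℕ → Submodule ℝ V} {g : V →ₗ[ℝ] H} {t : V →ₗ[ℝ] K} {lam : ℕ → ℝ}

/-- The inner product of the gradients is symmetric, so it can be evaluated with either eigenvalue;
as these differ, the boundary product vanishes. -/
theorem inner_trace_eq_zero (hlam : StrictMono lam)
    (hgt : ∀ k l, ∀ P ∈ E k, ∀ Q ∈ E l, ⟪g P, g Q⟫_ℝ = lam l * ⟪t P, t Q⟫_ℝ)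
    {k l : ℕ} (hkl : k ≠ l) {P Q : V} (hP : P ∈ E k) (hQ : Q ∈ E l) : ⟪t P, t Q⟫_ℝ = 0 := by
  have h1 := hgt k l P hP Q hQ
  have h2 := hgt l k Q hQ P hP
  rw [real_inner_comm, h1, real_inner_comm (t P) (t Q)] at h2
  have h3 : (lam l - lam k) * ⟪t P, t Q⟫_ℝ = 0 := by
    rw [sub_mul, h2]; ring_nf
  rcases mul_eq_zero.1 h3 with h | h
  · exact absurd (hlam.injective (sub_eq_zero.1 h)) hkl.symm
  · exact h

/-- The spectral gap: an element without components of degree `0` and `1`. -/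
theorem spectral_gap (hlam : StrictMono lam) (hpos : 0 < lam 0)
    (hgt : ∀ k l, ∀ P ∈ E k, ∀ Q ∈ E l, ⟪g P, g Q⟫_ℝ = lam l * ⟪t P, t Q⟫_ℝ)
    (hdense : ∀ x : K, ∀ ε > 0, ∃ P ∈ ⨆ k, E k, ‖x - t P‖ < ε)
    {G : H} {T : K} (hGT : ∀ k, ∀ P ∈ E k, ⟪G, g P⟫_ℝ = lam k * ⟪T, t P⟫_ℝ)
    (h0 : ∀ P ∈ E 0, ⟪G, g P⟫_ℝ = 0) (h1 : ∀ P ∈ E 1, ⟪G, g P⟫_ℝ = 0) :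
    lam 2 * ‖T‖ ^ 2 ≤ ‖G‖ ^ 2 := by
  have hlpos : ∀ k, 0 < lam k := fun k => hpos.trans_le (hlam.monotone (Nat.zero_le k))
  -- Approximate T by a finite orthogonal sum. Its Bessel sum is at least ‖T‖² - ε², and, multiplied
  -- by `lam 2`, it is dominated term by term by the Bessel sum of G.
  have key : ∀ ε > 0, lam 2 * (‖T‖ ^ 2 - ε ^ 2) ≤ ‖G‖ ^ 2 := by
    intro ε hε
    obtain ⟨P, hP, hPε⟩ := hdense T ε hε
    obtain ⟨f, hf, rfl⟩ := (Submodule.mem_iSup_iff_exists_finsupp _ _).1 hP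
    have ho : ∀ i ∈ f.support, ∀ j ∈ f.support, i ≠ j → ⟪t (f i), t (f j)⟫_ℝ = 0 :=
      fun i _ j _ hij => inner_trace_eq_zero hlam hgt hij (hf i) (hf j)
    have hog : ∀ i ∈ f.support, ∀ j ∈ f.support, i ≠ j → ⟪g (f i), g (f j)⟫_ℝ = 0 := by
      intro i hi j hj hij
      rw [hgt i j _ (hf i) _ (hf j), ho i hi j hj hij, mul_zero]
    have a1 := norm_sq_sub_le_sum_of_orthogonal f.support (fun i => t (f i)) ho T
    have a2 := sum_inner_sq_div_le f.support (fun i => g (f i)) hog G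
    have a3 : ∀ i ∈ f.support, lam 2 * (⟪T, t (f i)⟫_ℝ ^ 2 / ‖t (f i)‖ ^ 2) ≤
        ⟪G, g (f i)⟫_ℝ ^ 2 / ‖g (f i)‖ ^ 2 := by
      intro i _
      have hn : ‖g (f i)‖ ^ 2 = lam i * ‖t (f i)‖ ^ 2 := by
        rw [← real_inner_self_eq_norm_sq, ← real_inner_self_eq_norm_sq,
          hgt i i _ (hf i) _ (hf i)]
      have hi := hGT i _ (hf i)
      by_cases h2 : 2 ≤ i
      · rw [hn, hi, mul_pow]
        -- The coefficient of G carries λᵢ² and the norm of `g (f i)` carries λᵢ, so exactly one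
        -- factor λᵢ ≥ λ₂ survives.
        have : (lam i) ^ 2 * ⟪T, t (f i)⟫_ℝ ^ 2 / (lam i * ‖t (f i)‖ ^ 2) =
            lam i * (⟪T, t (f i)⟫_ℝ ^ 2 / ‖t (f i)‖ ^ 2) := by
          have := (hlpos i).ne'
          rw [sq (lam i), mul_assoc, mul_div_mul_left _ _ this, mul_div_assoc]
        rw [this]
        exact mul_le_mul_of_nonneg_right (hlam.monotone h2) (by positivity)
      · have hz : ⟪G, g (f i)⟫_ℝ = 0 := by
          have : i = 0 ∨ i = 1 := by omega
          rcases this with rfl | rfl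
          · exact h0 _ (hf 0)
          · exact h1 _ (hf 1)
        have hz' : ⟪T, t (f i)⟫_ℝ = 0 := by
          rw [hz] at hi
          exact (mul_eq_zero.1 hi.symm).resolve_left (hlpos i).ne'
        simp [hz, hz']
    have a4 := Finset.sum_le_sum a3
    rw [← Finset.mul_sum] at a4
    have a5 : ‖T - ∑ i ∈ f.support, t (f i)‖ ^ 2 ≤ ε ^ 2 := by
      rw [Finsupp.sum, map_sum] at hPε
      exact pow_le_pow_left₀ (norm_nonneg _) hPε.le 2
    calc lam 2 * (‖T‖ ^ 2 - ε ^ 2) ≤ lam 2 * ∑ i ∈ f.support, ⟪T, t (f i)⟫_ℝ ^ 2 / ‖t (f i)‖ ^ 2 :=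
          mul_le_mul_of_nonneg_left (by linarith) (hlpos 2).le
      _ ≤ _ := a4.trans a2
  have hlim : Tendsto (fun ε : ℝ => lam 2 * (‖T‖ ^ 2 - ε ^ 2)) (𝓝[>] 0)
      (𝓝 (lam 2 * (‖T‖ ^ 2 - 0 ^ 2))) := by
    refine Tendsto.mono_left ?_ nhdsWithin_le_nhds
    exact (Continuous.tendsto (by fun_prop) 0)
  rw [zero_pow two_ne_zero, sub_zero] at hlim
  exact le_of_tendsto hlim (eventually_nhdsWithin_of_forall key)

/-- If equality holds and P has degree k ≥ 3, the pair (G - s g P, T - s t P) satisfies the same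
hypotheses for every s, so the gap inequality makes a quadratic in s without constant term
nonnegative. Its linear coefficient must vanish, and T is orthogonal to everything of degree other
than 2. Density and the finite dimension of `E 2` put T into `t (E 2)`. -/
theorem spectral_gap_eq_iff (hlam : StrictMono lam) (hpos : 0 < lam 0)
    (hgt : ∀ k l, ∀ P ∈ E k, ∀ Q ∈ E l, ⟪g P, g Q⟫_ℝ = lam l * ⟪t P, t Q⟫_ℝ)
    (hdense : ∀ x : K, ∀ ε > 0, ∃ P ∈ ⨆ k, E k, ‖x - t P‖ < ε) [FiniteDimensional ℝ (E 2)]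
    {G : H} {T : K} (hGT : ∀ k, ∀ P ∈ E k, ⟪G, g P⟫_ℝ = lam k * ⟪T, t P⟫_ℝ)
    (h0 : ∀ P ∈ E 0, ⟪G, g P⟫_ℝ = 0) (h1 : ∀ P ∈ E 1, ⟪G, g P⟫_ℝ = 0) :
    ‖G‖ ^ 2 = lam 2 * ‖T‖ ^ 2 ↔ ∃ P ∈ E 2, G = g P := by
  have hlpos : ∀ k, 0 < lam k := fun k => hpos.trans_le (hlam.monotone (Nat.zero_le k))
  have hgn : ∀ k, ∀ P ∈ E k, ‖g P‖ ^ 2 = lam k * ‖t P‖ ^ 2 := by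
    intro k P hP
    rw [← real_inner_self_eq_norm_sq, ← real_inner_self_eq_norm_sq, hgt k k P hP P hP]
  have hle := spectral_gap hlam hpos hgt hdense hGT h0 h1
  constructor
  · intro heq
    have hT : ∀ k ≠ 2, ∀ P ∈ E k, ⟪T, t P⟫_ℝ = 0 := by
      intro k hk P hP
      have hcase : k = 0 ∨ k = 1 ∨ 3 ≤ k := by omega
      rcases hcase with rfl | rfl | hk3
      · exact (mul_eq_zero.1 ((hGT 0 P hP).symm.trans (h0 P hP))).resolve_left (hlpos 0).ne'
      · exact (mul_eq_zero.1 ((hGT 1 P hP).symm.trans (h1 P hP))).resolve_left (hlpos 1).ne'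
      · have hvar : ∀ s : ℝ, 0 ≤ (lam k - lam 2) * ‖t P‖ ^ 2 * (s * s)
            + (-2 * (lam k - lam 2) * ⟪T, t P⟫_ℝ) * s + 0 := by
          intro s
          have h := spectral_gap (G := G - s • g P) (T := T - s • t P) hlam hpos hgt hdense
            (by
              intro l Q hQ
              rw [inner_sub_left, inner_sub_left, inner_smul_left, inner_smul_left, hGT l Q hQ,
                hgt k l P hP Q hQ]
              ring)
            (by
              intro Q hQ
              rw [inner_sub_left, inner_smul_left, h0 Q hQ, hgt k 0 P hP Q hQ,
                inner_trace_eq_zero hlam hgt (by omega) hP hQ]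
              simp)
            (by
              intro Q hQ
              rw [inner_sub_left, inner_smul_left, h1 Q hQ, hgt k 1 P hP Q hQ,
                inner_trace_eq_zero hlam hgt (by omega) hP hQ]
              simp)
          rw [norm_sub_sq_real, norm_sub_sq_real, inner_smul_right, inner_smul_right, norm_smul,
            norm_smul, mul_pow, mul_pow, hgn k P hP, hGT k P hP, heq, Real.norm_eq_abs, sq_abs] at h
          linarith
        have hd := discrim_le_zero hvar
        rw [discrim] at hd
        have hgap : 0 < lam k - lam 2 := sub_pos.2 (hlam (by omega))
        have : (-2 * (lam k - lam 2) * ⟪T, t P⟫_ℝ) ^ 2 = 0 :=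
          le_antisymm (by linarith) (sq_nonneg _)
        have := pow_eq_zero_iff two_ne_zero |>.1 this
        have h3 : -2 * (lam k - lam 2) ≠ 0 := ne_of_lt (by linarith)
        exact (mul_eq_zero.1 this).resolve_left h3
    have : FiniteDimensional ℝ ((E 2).map t) := inferInstance
    obtain ⟨P, hP, hPT⟩ : ∃ P ∈ E 2, t P = ((E 2).map t).starProjection T := by
      have := ((E 2).map t).starProjection_apply_mem T
      obtain ⟨P, hP, h⟩ := this
      exact ⟨P, hP, h⟩
    have hTP : T = t P := by
      have horth : ∀ Q ∈ ⨆ k, E k, ⟪T - t P, t Q⟫_ℝ = 0 := by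
        intro Q hQ
        refine Submodule.iSup_induction (p := E) (motive := fun Q => ⟪T - t P, t Q⟫_ℝ = 0) hQ
          ?_ (by simp) ?_
        · intro k Q hQ
          by_cases hk : k = 2
          · subst hk
            rw [hPT]
            exact Submodule.starProjection_inner_eq_zero T (t Q) (Submodule.mem_map_of_mem hQ)
          · rw [inner_sub_left, hT k hk Q hQ, inner_trace_eq_zero hlam hgt (Ne.symm hk) hP hQ,
              sub_zero]
        · intro a b ha hb
          rw [map_add, inner_add_right, ha, hb, add_zero]
      rw [← sub_eq_zero, ← norm_eq_zero]
      refine le_antisymm (le_of_forall_pos_le_add fun ε hε => ?_) (norm_nonneg _)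
      obtain ⟨Q, hQ, hlt⟩ := hdense (T - t P) ε hε
      have : ‖T - t P‖ ^ 2 ≤ ‖T - t P - t Q‖ ^ 2 := by
        rw [norm_sub_sq_real (T - t P), horth Q hQ]
        nlinarith [sq_nonneg ‖t Q‖]
      have := abs_le_of_sq_le_sq' this (norm_nonneg _)
      linarith [this.2]
    refine ⟨P, hP, ?_⟩
    -- With T = t P, all three terms of ‖G - g P‖² are multiples of λ₂‖t P‖², with coefficients 1,
    -- -2, 1.
    rw [← sub_eq_zero, ← norm_eq_zero, ← pow_eq_zero_iff two_ne_zero, norm_sub_sq_real,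
      hgn 2 P hP, hGT 2 P hP, heq, hTP, real_inner_self_eq_norm_sq]
    ring
  · rintro ⟨P, hP, rfl⟩
    have e1 := hgn 2 P hP
    have e2 := hGT 2 P hP
    rw [real_inner_self_eq_norm_sq] at e2
    -- The Green identity gives ⟪T, t P⟫ = ‖t P‖², and the gap inequality `hle` gives ‖T‖ ≤ ‖t P‖;
    -- together they force T = t P.
    have e3 : ‖T - t P‖ ^ 2 ≤ 0 := by
      rw [norm_sub_sq_real]
      refine le_of_mul_le_mul_left ?_ (hlpos 2)
      nlinarith
    have e4 : T = t P := by
      rw [← sub_eq_zero, ← norm_eq_zero, ← pow_eq_zero_iff two_ne_zero]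
      exact le_antisymm e3 (sq_nonneg _)
    rw [e4, e1]

end Hilbert

/-! ### Coordinates on the half-space and the divergence theorem for test functions -/

section HalfSpace

variable {d : ℕ}

/-- The coordinate vectors. -/
abbrev bv (i : Fin (d + 1)) : Rn d := EuclideanSpace.single i (1 : ℝ)

@[simp] theorem pt_castSucc (x : Bd d) (t : ℝ) (i : Fin d) : pt x t i.castSucc = x i := by
  simp [pt]

@[simp] theorem pt_last (x : Bd d) (t : ℝ) : pt x t (Fin.last d) = t := by
  simp [pt]

@[simp] theorem vert_pt (x : Bd d) (t : ℝ) : vert (pt x t) = t := pt_last x t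

@[simp] theorem horiz_pt (x : Bd d) (t : ℝ) : horiz (pt x t) = x := by
  ext i; simp [horiz]

@[simp] theorem pt_horiz_vert (X : Rn d) : pt (horiz X) (vert X) = X := by
  ext i
  refine Fin.lastCases ?_ (fun i => ?_) i <;> simp [horiz, vert]

/-- `(x, t) ↦ pt x t` as a continuous linear map. -/
def ptL (d : ℕ) : (Bd d × ℝ) →L[ℝ] Rn d :=
  LinearMap.toContinuousLinearMap
    { toFun := fun p => pt p.1 p.2
      map_add' := by
        intro p q; ext i
        refine Fin.lastCases ?_ (fun i => ?_) i <;> simp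
      map_smul' := by
        intro c p; ext i
        refine Fin.lastCases ?_ (fun i => ?_) i <;> simp }

@[simp] theorem ptL_apply (p : Bd d × ℝ) : ptL d p = pt p.1 p.2 := rfl

/-- The boundary point `(x, 0)` as a continuous linear map. -/
def bdL (d : ℕ) : Bd d →L[ℝ] Rn d := (ptL d).comp (ContinuousLinearMap.inl ℝ _ _)

@[simp] theorem bdL_apply (x : Bd d) : bdL d x = pt x 0 := rfl

theorem pt_single_zero (i : Fin d) (a : ℝ) :
    pt (EuclideanSpace.single i a) 0 = EuclideanSpace.single i.castSucc a := by
  ext j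
  refine Fin.lastCases ?_ (fun j => ?_) j
  · simp [Fin.castSucc_ne_last, eq_comm]
  · simp

theorem pt_zero_eq (a : ℝ) : pt (0 : Bd d) a = EuclideanSpace.single (Fin.last d) a := by
  ext j
  refine Fin.lastCases ?_ (fun j => ?_) j
  · simp
  · simp [Fin.castSucc_ne_last]

theorem pt_add (x y : Bd d) (s t : ℝ) : pt (x + y) (s + t) = pt x s + pt y t :=
  (ptL d).map_add (x, s) (y, t)

theorem continuous_vert : Continuous (vert : Rn d → ℝ) := by
  unfold vert; fun_prop

theorem isOpen_halfSpace : IsOpen (halfSpace d) := isOpen_lt continuous_const continuous_vert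

theorem measurableSet_halfSpace : MeasurableSet (halfSpace d) := isOpen_halfSpace.measurableSet

theorem norm_sq_pt (x : Bd d) (t : ℝ) : ‖pt x t‖ ^ 2 = ‖x‖ ^ 2 + t ^ 2 := by
  rw [EuclideanSpace.norm_sq_eq, EuclideanSpace.norm_sq_eq, Fin.sum_univ_castSucc]
  simp

theorem measurePreserving_pt :
    MeasurePreserving (fun p : Bd d × ℝ => pt p.1 p.2) (volume.prod volume) volume := by
  have h1 := (volume_preserving_piFinSuccAbove (fun _ : Fin (d + 1) => ℝ) (Fin.last d)).symm
  have h2 : MeasurePreserving (Prod.map (@WithLp.ofLp 2 (Fin d → ℝ)) (id : ℝ → ℝ))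
      (volume.prod volume) (volume.prod volume) :=
    (PiLp.volume_preserving_ofLp (Fin d)).prod (MeasurePreserving.id _)
  have h3 : MeasurePreserving (Prod.swap : (Fin d → ℝ) × ℝ → ℝ × (Fin d → ℝ))
      (volume.prod volume) (volume.prod volume) := Measure.measurePreserving_swap
  have h4 := (PiLp.volume_preserving_toLp (Fin (d + 1))).comp (h1.comp (h3.comp h2))
  suffices hfun : (fun p : Bd d × ℝ => pt p.1 p.2) = WithLp.toLp 2 ∘
      (MeasurableEquiv.piFinSuccAbove (fun _ : Fin (d + 1) => ℝ) (Fin.last d)).symm ∘ Prod.swap ∘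
      Prod.map (@WithLp.ofLp 2 (Fin d → ℝ)) (id : ℝ → ℝ) by
    rw [hfun]; exact h4
  funext p
  ext i
  refine Fin.lastCases ?_ (fun i => ?_) i
  · simp [MeasurableEquiv.piFinSuccAbove, Fin.insertNthEquiv]
  · simp [MeasurableEquiv.piFinSuccAbove, Fin.insertNthEquiv]

theorem measurableEmbedding_pt : MeasurableEmbedding (fun p : Bd d × ℝ => pt p.1 p.2) := by
  refine ((ptL d).continuous.measurableEmbedding ?_)
  intro p q h
  have h' : pt p.1 p.2 = pt q.1 q.2 := h
  refine Prod.ext ?_ ?_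
  · simpa using congrArg horiz h'
  · simpa using congrArg vert h'

theorem measurePreserving_pt_restrict {S : Set ℝ} (hS : MeasurableSet S) :
    MeasurePreserving (fun p : Bd d × ℝ => pt p.1 p.2)
      ((volume : Measure (Bd d)).prod (volume.restrict S)) (volume.restrict (vert ⁻¹' S)) := by
  have h := (measurePreserving_pt (d := d)).restrict_preimage (continuous_vert.measurable hS)
  have h2 : (fun p : Bd d × ℝ => pt p.1 p.2) ⁻¹' (vert ⁻¹' S) = Set.univ ×ˢ S := by
    ext p; simp
  rw [h2, ← Measure.prod_restrict, Measure.restrict_univ] at h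
  exact h

theorem measurePreserving_pt_half :
    MeasurePreserving (fun p : Bd d × ℝ => pt p.1 p.2)
      ((volume : Measure (Bd d)).prod (volume.restrict (Set.Ioi 0))) (halfVol d) :=
  measurePreserving_pt_restrict measurableSet_Ioi

theorem integral_halfVol (f : Rn d → ℝ) :
    ∫ X, f X ∂(halfVol d) =
      ∫ p, f (pt p.1 p.2) ∂((volume : Measure (Bd d)).prod (volume.restrict (Set.Ioi 0))) :=
  (measurePreserving_pt_half.integral_comp measurableEmbedding_pt f).symm

theorem integrable_halfVol_of_hasCompactSupport {f : Rn d → ℝ} (hf : Continuous f)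
    (hc : HasCompactSupport f) : Integrable f (halfVol d) :=
  (hf.integrable_of_hasCompactSupport hc).mono_measure Measure.restrict_le_self

theorem hasCompactSupport_comp_pt {f : Rn d → ℝ} (hc : HasCompactSupport f) (t : ℝ) :
    HasCompactSupport fun x : Bd d => f (pt x t) := by
  refine hc.comp_isClosedEmbedding (g := fun x : Bd d => pt x t) ?_
  refine Isometry.isClosedEmbedding (Isometry.of_dist_eq fun x y => ?_)
  rw [dist_eq_norm, dist_eq_norm]
  have h : pt x t - pt y t = pt (x - y) 0 := by
    have := (ptL d).map_sub (x, t) (y, t)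
    simpa using this.symm
  rw [h, ← sq_eq_sq₀ (norm_nonneg _) (norm_nonneg _), norm_sq_pt]; simp

theorem hasCompactSupport_comp_pt_vert {f : Rn d → ℝ} (hc : HasCompactSupport f) (x : Bd d) :
    HasCompactSupport fun t : ℝ => f (pt x t) := by
  refine hc.comp_isClosedEmbedding (g := fun t : ℝ => pt x t) ?_
  refine Isometry.isClosedEmbedding (Isometry.of_dist_eq fun s t => ?_)
  rw [dist_eq_norm, dist_eq_norm]
  have h : pt x s - pt x t = pt 0 (s - t) := by
    have := (ptL d).map_sub (x, s) (x, t)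
    simpa using this.symm
  rw [h, ← sq_eq_sq₀ (norm_nonneg _) (norm_nonneg _), norm_sq_pt]; simp

variable {f : Rn d → ℝ}

theorem continuous_fderiv_apply (hf : ContDiff ℝ 1 f) (v : Rn d) :
    Continuous fun X => fderiv ℝ f X v :=
  (hf.continuous_fderiv one_ne_zero).clm_apply continuous_const

theorem hasCompactSupport_fderiv_apply (hc : HasCompactSupport f) (v : Rn d) :
    HasCompactSupport fun X => fderiv ℝ f X v :=
  hc.fderiv_apply ℝ v

theorem integral_halfVol_fderiv_castSucc (hf : ContDiff ℝ 1 f) (hc : HasCompactSupport f)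
    (i : Fin d) : ∫ X, fderiv ℝ f X (bv i.castSucc) ∂(halfVol d) = 0 := by
  have hi := integrable_halfVol_of_hasCompactSupport (continuous_fderiv_apply hf (bv i.castSucc))
    (hasCompactSupport_fderiv_apply hc _)
  rw [← measurePreserving_pt_half.integrable_comp_emb measurableEmbedding_pt] at hi
  simp only [Function.comp_def] at hi
  rw [integral_halfVol, integral_prod_symm _ hi]
  refine integral_eq_zero_of_ae (Eventually.of_forall fun t => ?_)
  have hg : ∀ x : Bd d, HasFDerivAt (fun x : Bd d => f (pt x t))
      ((fderiv ℝ f (pt x t)).comp (bdL d)) x := by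
    intro x
    have h1 : HasFDerivAt (fun x : Bd d => pt x t) (bdL d) x := by
      have : (fun x : Bd d => pt x t) = fun x => bdL d x + pt 0 t := by
        funext x; simp [← pt_add]
      rw [this]
      exact (bdL d).hasFDerivAt.add_const _
    exact ((hf.differentiable one_ne_zero _).hasFDerivAt).comp x h1
  have hcont : Continuous fun x : Bd d => pt x t :=
    (ptL d).continuous.comp (Continuous.prodMk_left t)
  -- On each horizontal slice, integrate by parts against the constant 1.
  have h := integral_bilinear_hasFDerivAt_right_eq_neg_left_of_integrable
    (μ := (volume : Measure (Bd d))) (f := fun _ => (1 : ℝ)) (f' := fun _ => 0)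
    (g := fun x : Bd d => f (pt x t)) (g' := fun x => (fderiv ℝ f (pt x t)).comp (bdL d))
    (v := EuclideanSpace.single i 1) (B := ContinuousLinearMap.mul ℝ ℝ)
    (by simp)
    (by
      simp only [ContinuousLinearMap.mul_apply', one_mul, ContinuousLinearMap.comp_apply,
        bdL_apply, pt_single_zero]
      exact ((continuous_fderiv_apply hf _).comp hcont).integrable_of_hasCompactSupport
        (hasCompactSupport_comp_pt (hasCompactSupport_fderiv_apply hc _) t))
    (by
      simp only [ContinuousLinearMap.mul_apply', one_mul]
      exact (hf.continuous.comp hcont).integrable_of_hasCompactSupport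
        (hasCompactSupport_comp_pt hc t))
    (fun x _ => hasFDerivAt_const _ _) (fun x _ => hg x)
  simpa [pt_single_zero] using h

/-- Fubini and the fundamental theorem of calculus on vertical half-lines; the sign reflects the
outward normal -e_n. -/
theorem integral_halfVol_fderiv_last (hf : ContDiff ℝ 1 f) (hc : HasCompactSupport f) :
    ∫ X, fderiv ℝ f X (bv (Fin.last d)) ∂(halfVol d) = -∫ x : Bd d, f (pt x 0) := by
  have hi := integrable_halfVol_of_hasCompactSupport (continuous_fderiv_apply hf (bv (Fin.last d)))
    (hasCompactSupport_fderiv_apply hc _)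
  rw [← measurePreserving_pt_half.integrable_comp_emb measurableEmbedding_pt] at hi
  simp only [Function.comp_def] at hi
  rw [integral_halfVol, integral_prod _ hi, ← integral_neg]
  refine integral_congr_ae (Eventually.of_forall fun x => ?_)
  have hg : ∀ t : ℝ, HasDerivAt (fun t : ℝ => f (pt x t))
      (fderiv ℝ f (pt x t) (bv (Fin.last d))) t := by
    intro t
    have h1 : HasDerivAt (fun t : ℝ => pt x t) (bv (Fin.last d)) t := by
      have : (fun t : ℝ => pt x t) = fun t => pt x 0 + t • bv (Fin.last d) := by
        funext t
        rw [show t • bv (Fin.last d) = pt 0 t by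
            rw [bv, ← pt_zero_eq]; simpa using ((ptL d).map_smul t (0, 1)).symm, ← pt_add,
          add_zero, zero_add]
      rw [this]
      simpa using ((hasDerivAt_id t).smul_const (bv (Fin.last d))).const_add (pt x 0)
    exact ((hf.differentiable one_ne_zero _).hasFDerivAt).comp_hasDerivAt t h1
  have hcont : Continuous fun t : ℝ => pt x t :=
    (ptL d).continuous.comp (Continuous.prodMk_right x)
  have hcs := hasCompactSupport_comp_pt_vert hc x
  have h := integral_Ioi_of_hasDerivAt_of_tendsto (a := (0 : ℝ)) (m := (0 : ℝ))
    (f := fun t : ℝ => f (pt x t)) (hf.continuous.comp hcont).continuousWithinAt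
    (fun t _ => hg t)
    (((continuous_fderiv_apply hf _).comp hcont).integrable_of_hasCompactSupport
        (hasCompactSupport_comp_pt_vert (hasCompactSupport_fderiv_apply hc _) x)).integrableOn
    ((hcs.is_zero_at_infty).mono_left atTop_le_cocompact)
  simpa using h

end HalfSpace

/-! ### Exponents and the trace inequality -/

section Trace

variable {d : ℕ}

theorem three_le_dim (hd : 2 ≤ d) : 3 ≤ dim d := by
  have : (2 : ℝ) ≤ d := by exact_mod_cast hd
  unfold dim; linarith

theorem sobExp_toReal (hd : 2 ≤ d) : (sobExp d).toReal = 2 * pExp d := by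
  have := three_le_dim hd
  rw [sobExp, ENNReal.toReal_ofReal (div_nonneg (by linarith) (by linarith)), pExp]; ring

theorem traceExp_toReal (hd : 2 ≤ d) : (traceExp d).toReal = pExp d + 1 := by
  have := three_le_dim hd
  rw [traceExp, ENNReal.toReal_ofReal (div_nonneg (by linarith) (by linarith)), pExp]
  have : dim d - 2 ≠ 0 := by linarith
  field_simp; ring

theorem one_lt_pExp (hd : 2 ≤ d) : 1 < pExp d := by
  have := three_le_dim hd
  rw [pExp, lt_div_iff₀ (by linarith)]; linarith

theorem sobExp_ne_top : sobExp d ≠ ⊤ := ENNReal.ofReal_ne_top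
theorem traceExp_ne_top : traceExp d ≠ ⊤ := ENNReal.ofReal_ne_top

theorem one_le_sobExp (hd : 2 ≤ d) : 1 ≤ sobExp d := by
  rw [← ENNReal.ofReal_one, ← ENNReal.ofReal_toReal (sobExp_ne_top (d := d)), sobExp_toReal hd]
  exact ENNReal.ofReal_le_ofReal (by linarith [one_lt_pExp hd])

theorem one_le_traceExp (hd : 2 ≤ d) : 1 ≤ traceExp d := by
  rw [← ENNReal.ofReal_one, ← ENNReal.ofReal_toReal (traceExp_ne_top (d := d)), traceExp_toReal hd]
  exact ENNReal.ofReal_le_ofReal (by linarith [one_lt_pExp hd])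

theorem sobExp_ne_zero (hd : 2 ≤ d) : sobExp d ≠ 0 :=
  (zero_lt_one.trans_le (one_le_sobExp hd)).ne'

theorem traceExp_ne_zero (hd : 2 ≤ d) : traceExp d ≠ 0 :=
  (zero_lt_one.trans_le (one_le_traceExp hd)).ne'

theorem gradient_apply (f : Rn d → ℝ) (X : Rn d) (i : Fin (d + 1)) :
    gradient f X i = fderiv ℝ f X (bv i) := by
  rw [← inner_gradient_left, EuclideanSpace.inner_single_right]; simp

theorem continuous_gradient {f : Rn d → ℝ} (hf : ContDiff ℝ 1 f) : Continuous (gradient f) :=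
  (InnerProductSpace.toDual ℝ (Rn d)).symm.continuous.comp (hf.continuous_fderiv one_ne_zero)

theorem hasCompactSupport_gradient {f : Rn d → ℝ} (hc : HasCompactSupport f) :
    HasCompactSupport (gradient f) :=
  (hc.fderiv ℝ).comp_left (map_zero (InnerProductSpace.toDual ℝ (Rn d)).symm)

theorem abs_fderiv_bv_le (f : Rn d → ℝ) (X : Rn d) (i : Fin (d + 1)) :
    |fderiv ℝ f X (bv i)| ≤ ‖gradient f X‖ := by
  rw [← gradient_apply]; exact PiLp.norm_apply_le (gradient f X) i

/-- The trace inequality for test functions. -/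
theorem lintegral_boundary_le (hd : 2 ≤ d) {φ : Rn d → ℝ} (hφ : ContDiff ℝ 1 φ)
    (hc : HasCompactSupport φ) :
    ∫⁻ x : Bd d, ‖φ (pt x 0)‖ₑ ^ (pExp d + 1) ≤ ENNReal.ofReal (pExp d + 1) *
      (eLpNorm φ (sobExp d) (halfVol d) ^ pExp d * eLpNorm (gradient φ) 2 (halfVol d)) := by
  set q := pExp d + 1 with hq
  have hp := one_lt_pExp hd
  have hq0 : 0 < q := by linarith
  -- The boundary integral of |φ|^q is minus the integral of ∂_t |φ|^q, and |∂_t |φ|^q| ≤ q |φ|^p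
  -- |∇φ| because q - 1 = p. Since 2p = 2n/(n-2), Cauchy–Schwarz produces exactly the two norms on
  -- the right.
  set f : Rn d → ℝ := fun X => ‖φ X‖ ^ q with hf
  have hf1 : ContDiff ℝ 1 f := hφ.norm_rpow (by linarith)
  have hfc : HasCompactSupport f := hc.comp_left (g := fun y : ℝ => ‖y‖ ^ q)
    (by simp [hq0.ne'])
  have hder : ∀ X, ‖fderiv ℝ f X (bv (Fin.last d))‖ₑ ≤
      ENNReal.ofReal q * (‖φ X‖ₑ ^ pExp d * ‖gradient φ X‖ₑ) := by
    intro X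
    have h1 := (hasFDerivAt_norm_rpow (φ X) (p := q) (by linarith)).comp X
      (hφ.differentiable one_ne_zero X).hasFDerivAt
    have h2 : fderiv ℝ f X = _ := h1.fderiv
    have h3 : ‖fderiv ℝ f X (bv (Fin.last d))‖ ≤ q * (‖φ X‖ ^ pExp d * ‖gradient φ X‖) := by
      rw [h2]
      simp only [ContinuousLinearMap.comp_apply, smul_apply, innerSL_apply_apply,
        smul_eq_mul, norm_mul, RCLike.inner_apply, conj_trivial]
      rw [Real.norm_of_nonneg hq0.le, Real.norm_of_nonneg (by positivity : 0 ≤ ‖φ X‖ ^ (q - 2)),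
        Real.norm_eq_abs (fderiv ℝ φ X (bv (Fin.last d)))]
      have h4 : ‖φ X‖ ^ (q - 2) * ‖φ X‖ = ‖φ X‖ ^ pExp d := by
        rcases eq_or_ne (φ X) 0 with h | h
        · simp [h, (by linarith : pExp d ≠ 0)]
        · rw [← Real.rpow_add_one (by simpa using h)]; congr 1; rw [hq]; ring
      calc q * ‖φ X‖ ^ (q - 2) * (|fderiv ℝ φ X (bv (Fin.last d))| * ‖φ X‖)
          = q * ((‖φ X‖ ^ (q - 2) * ‖φ X‖) * |fderiv ℝ φ X (bv (Fin.last d))|) := by ring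
        _ ≤ q * (‖φ X‖ ^ pExp d * ‖gradient φ X‖) := by
            rw [h4]
            gcongr
            exact abs_fderiv_bv_le φ X _
    rw [← ofReal_norm, ← ofReal_norm, ← ofReal_norm,
      ENNReal.ofReal_rpow_of_nonneg (norm_nonneg _) (by linarith),
      ← ENNReal.ofReal_mul (by positivity), ← ENNReal.ofReal_mul hq0.le]
    exact ENNReal.ofReal_le_ofReal h3
  have hint : Integrable fun x : Bd d => f (pt x 0) :=
    (hf1.continuous.comp (bdL d).continuous).integrable_of_hasCompactSupport
      (hasCompactSupport_comp_pt hfc 0)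
  have e1 : ∫⁻ x : Bd d, ‖φ (pt x 0)‖ₑ ^ q = ENNReal.ofReal (∫ x : Bd d, f (pt x 0)) := by
    rw [ofReal_integral_eq_lintegral_ofReal hint (Eventually.of_forall fun x => by
      simp only [hf, Pi.zero_apply]; positivity)]
    refine lintegral_congr fun x => ?_
    rw [hf, ← ofReal_norm, ENNReal.ofReal_rpow_of_nonneg (norm_nonneg _) hq0.le]
  have e2 : ENNReal.ofReal (∫ x : Bd d, f (pt x 0)) ≤
      ∫⁻ X, ‖fderiv ℝ f X (bv (Fin.last d))‖ₑ ∂(halfVol d) := by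
    have := integral_halfVol_fderiv_last hf1 hfc
    refine le_trans ?_ (enorm_integral_le_lintegral_enorm _)
    rw [this, enorm_neg]
    exact Real.ofReal_le_enorm _
  have hm1 : AEMeasurable (fun X => ‖φ X‖ₑ ^ pExp d) (halfVol d) :=
    (hφ.continuous.enorm.measurable.pow_const _).aemeasurable
  have hm2 : AEMeasurable (fun X => ‖gradient φ X‖ₑ) (halfVol d) :=
    (continuous_gradient hφ).enorm.measurable.aemeasurable
  rw [e1]
  refine e2.trans ((lintegral_mono hder).trans ?_)
  rw [lintegral_const_mul' _ _ ENNReal.ofReal_ne_top]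
  gcongr
  refine (ENNReal.lintegral_mul_le_Lp_mul_Lq (halfVol d) Real.HolderConjugate.two_two hm1 hm2).trans
    (le_of_eq ?_)
  rw [eLpNorm_eq_lintegral_rpow_enorm_toReal (sobExp_ne_zero hd) sobExp_ne_top,
    eLpNorm_eq_lintegral_rpow_enorm_toReal two_ne_zero ENNReal.ofNat_ne_top, sobExp_toReal hd]
  congr 1
  rw [← ENNReal.rpow_mul]
  congr 1
  · refine lintegral_congr fun X => ?_
    rw [← ENNReal.rpow_mul, mul_comm]
  · have : pExp d ≠ 0 := by linarith
    field_simp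

theorem eLpNorm_boundary_rpow_le (hd : 2 ≤ d) {φ : Rn d → ℝ} (hφ : ContDiff ℝ 1 φ)
    (hc : HasCompactSupport φ) :
    eLpNorm (fun x : Bd d => φ (pt x 0)) (traceExp d) volume ^ (pExp d + 1) ≤
      ENNReal.ofReal (pExp d + 1) *
      (eLpNorm φ (sobExp d) (halfVol d) ^ pExp d * eLpNorm (gradient φ) 2 (halfVol d)) := by
  refine le_trans (le_of_eq ?_) (lintegral_boundary_le hd hφ hc)
  have := one_lt_pExp hd
  rw [eLpNorm_eq_lintegral_rpow_enorm_toReal (traceExp_ne_zero hd) traceExp_ne_top,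
    traceExp_toReal hd, ← ENNReal.rpow_mul, one_div, inv_mul_cancel₀ (by linarith),
    ENNReal.rpow_one]

theorem eLpNorm_comp_shift_le {F : Type*} [NormedAddCommGroup F] {f : Rn d → F}
    (hf : Continuous f) (p : ENNReal) {s : ℝ} (hs : 0 ≤ s) :
    eLpNorm (fun X => f (X + pt 0 s)) p (halfVol d) ≤ eLpNorm f p (halfVol d) := by
  have hS : MeasurableSet {X : Rn d | s < vert X} :=
    (isOpen_lt continuous_const continuous_vert).measurableSet
  have h := (measurePreserving_add_right (volume : Measure (Rn d)) (pt 0 s)).restrict_preimage hS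
  have h2 : (fun X : Rn d => X + pt 0 s) ⁻¹' {X : Rn d | s < vert X} = halfSpace d := by
    ext X
    have : vert (X + pt 0 s) = vert X + s := by simp [vert]
    simp [halfSpace, this]
  rw [h2] at h
  have h3 := eLpNorm_comp_measurePreserving (p := p) (g := f) hf.aestronglyMeasurable h
  refine (le_of_eq h3).trans (eLpNorm_mono_measure _ (Measure.restrict_mono ?_ le_rfl))
  intro X hX
  exact lt_of_le_of_lt hs hX

/-- The trace inequality for the translate of φ by height s: the half-space shifted upwards lies in
itself, so the bound on the right does not depend on s. -/
theorem lintegral_slice_le (hd : 2 ≤ d) {φ : Rn d → ℝ} (hφ : ContDiff ℝ 1 φ)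
    (hc : HasCompactSupport φ) {s : ℝ} (hs : 0 ≤ s) :
    ∫⁻ x : Bd d, ‖φ (pt x s)‖ₑ ^ (pExp d + 1) ≤ ENNReal.ofReal (pExp d + 1) *
      (eLpNorm φ (sobExp d) (halfVol d) ^ pExp d * eLpNorm (gradient φ) 2 (halfVol d)) := by
  have hc' : HasCompactSupport fun X => φ (X + pt 0 s) :=
    hc.comp_homeomorph (Homeomorph.addRight (pt 0 s))
  have hφ' : ContDiff ℝ 1 fun X => φ (X + pt 0 s) := hφ.comp (contDiff_id.add contDiff_const)
  have h := lintegral_boundary_le hd hφ' hc'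
  have hg : gradient (fun X => φ (X + pt 0 s)) = fun X => gradient φ (X + pt 0 s) := by
    funext X
    simp only [gradient, fderiv_comp_add_right]
  simp only [← pt_add, add_zero, zero_add, hg] at h
  refine h.trans ?_
  have := one_lt_pExp hd
  gcongr
  · exact eLpNorm_comp_shift_le hφ.continuous _ hs
  · exact eLpNorm_comp_shift_le (continuous_gradient hφ) _ hs

end Trace

/-! ### Uniqueness of gradients and existence of traces in H¹ -/

section Approx

variable {d : ℕ}

theorem tendsto_integral_mul {α : Type*} [MeasurableSpace α] {μ : Measure α} {p q : ENNReal}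
    [p.HolderConjugate q] {F : ℕ → α → ℝ} {f g : α → ℝ} (hF : ∀ k, MemLp (F k) p μ)
    (hf : MemLp f p μ) (hg : MemLp g q μ)
    (h : Tendsto (fun k => eLpNorm (fun x => F k x - f x) p μ) atTop (𝓝 0)) :
    Tendsto (fun k => ∫ x, F k x * g x ∂μ) atTop (𝓝 (∫ x, f x * g x ∂μ)) := by
  refine tendsto_integral_of_L1' _ (hf.1.mul hg.1)
    (Eventually.of_forall fun k => (hF k).integrable_mul hg) ?_
  have h0 : Tendsto (fun k => eLpNorm (fun x => F k x - f x) p μ * eLpNorm g q μ) atTop (𝓝 0) := by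
    simpa using ENNReal.Tendsto.mul_const h (Or.inr hg.2.ne)
  refine tendsto_of_tendsto_of_tendsto_of_le_of_le tendsto_const_nhds h0 (fun _ => zero_le) ?_
  intro k
  have e : ((fun x => F k x * g x) - f * g) = (fun x => F k x - f x) • g := by
    funext x
    simp only [Pi.sub_apply, Pi.smul_apply', Pi.mul_apply, smul_eq_mul]
    ring
  beta_reduce
  rw [e]
  exact eLpNorm_smul_le_mul_eLpNorm (p := p) (q := q) (r := 1) hg.1 ((hF k).1.sub hf.1)

theorem memLp_halfVol {F : Type*} [NormedAddCommGroup F] {f : Rn d → F}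
    (hf : Continuous f) (hc : HasCompactSupport f) (p : ENNReal) : MemLp f p (halfVol d) :=
  (hf.memLp_of_hasCompactSupport hc).mono_measure Measure.restrict_le_self

variable {φ ψ : ℕ → Rn d → ℝ} {u v : Rn d → ℝ} {G G' : Rn d → Rn d}

theorem IsApprox.contDiff_one (h : IsApprox φ u G) (k : ℕ) : ContDiff ℝ 1 (φ k) :=
  (h.smooth k).of_le (by exact_mod_cast le_top)

theorem gradient_sub {f g : Rn d → ℝ} (hf : Differentiable ℝ f) (hg : Differentiable ℝ g)
    (X : Rn d) : gradient (fun X => f X - g X) X = gradient f X - gradient g X := by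
  simp only [gradient]
  rw [fderiv_fun_sub (hf X) (hg X), map_sub]

theorem IsApprox.sub (hd : 2 ≤ d) (h : IsApprox φ u G) (h' : IsApprox ψ v G') :
    IsApprox (fun k X => φ k X - ψ k X) (fun X => u X - v X) (fun X => G X - G' X) where
  smooth k := (h.smooth k).sub (h'.smooth k)
  compact k := (h.compact k).sub (h'.compact k)
  memLp_fun := h.memLp_fun.sub h'.memLp_fun
  memLp_grad := h.memLp_grad.sub h'.memLp_grad
  tendsto_fun := by
    have h0 := h.tendsto_fun.add h'.tendsto_fun
    rw [add_zero] at h0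
    refine tendsto_of_tendsto_of_tendsto_of_le_of_le tendsto_const_nhds h0 (fun _ => zero_le) ?_
    intro k
    have e : (fun X => φ k X - ψ k X - (u X - v X)) =
        (fun X => φ k X - u X) - fun X => ψ k X - v X := by
      funext X; simp only [Pi.sub_apply]; ring
    simp only [e]
    exact eLpNorm_sub_le ((h.smooth k).continuous.aestronglyMeasurable.sub h.memLp_fun.1)
      ((h'.smooth k).continuous.aestronglyMeasurable.sub h'.memLp_fun.1) (one_le_sobExp hd)
  tendsto_grad := by
    have h0 := h.tendsto_grad.add h'.tendsto_grad
    rw [add_zero] at h0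
    refine tendsto_of_tendsto_of_tendsto_of_le_of_le tendsto_const_nhds h0 (fun _ => zero_le) ?_
    intro k
    have e : (fun X => gradient (fun X => φ k X - ψ k X) X - (G X - G' X)) =
        (fun X => gradient (φ k) X - G X) - fun X => gradient (ψ k) X - G' X := by
      funext X
      rw [gradient_sub ((h.contDiff_one k).differentiable one_ne_zero)
        ((h'.contDiff_one k).differentiable one_ne_zero)]
      simp only [Pi.sub_apply]; abel
    simp only [e]
    exact eLpNorm_sub_le
      ((continuous_gradient (h.contDiff_one k)).aestronglyMeasurable.sub h.memLp_grad.1)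
      ((continuous_gradient (h'.contDiff_one k)).aestronglyMeasurable.sub h'.memLp_grad.1)
      one_le_two

theorem IsApprox.congr (h : IsApprox φ u G) (hu : u =ᵐ[halfVol d] v) (hG : G =ᵐ[halfVol d] G') :
    IsApprox φ v G' where
  smooth := h.smooth
  compact := h.compact
  memLp_fun := (memLp_congr_ae hu).1 h.memLp_fun
  memLp_grad := (memLp_congr_ae hG).1 h.memLp_grad
  tendsto_fun := by
    refine h.tendsto_fun.congr fun k => eLpNorm_congr_ae ?_
    filter_upwards [hu] with X hX
    rw [hX]
  tendsto_grad := by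
    refine h.tendsto_grad.congr fun k => eLpNorm_congr_ae ?_
    filter_upwards [hG] with X hX
    rw [hX]

theorem IsApprox.tendsto_eLpNorm_grad_zero (h : IsApprox φ u G) (hG : G =ᵐ[halfVol d] 0) :
    Tendsto (fun k => eLpNorm (gradient (φ k)) 2 (halfVol d)) atTop (𝓝 0) := by
  refine h.tendsto_grad.congr fun k => eLpNorm_congr_ae ?_
  filter_upwards [hG] with X hX
  simp [hX]

/-- Coordinatewise convergence of the gradients. -/
theorem IsApprox.tendsto_fderiv (h : IsApprox φ u G) (i : Fin (d + 1)) :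
    Tendsto (fun k => eLpNorm (fun X => fderiv ℝ (φ k) X (bv i) - G X i) 2 (halfVol d))
      atTop (𝓝 0) := by
  refine tendsto_of_tendsto_of_tendsto_of_le_of_le tendsto_const_nhds h.tendsto_grad
    (fun _ => zero_le) fun k => eLpNorm_mono fun X => ?_
  rw [← gradient_apply]
  exact PiLp.norm_apply_le (gradient (φ k) X - G X) i

theorem memLp_coord {μ : Measure (Rn d)} (hG : MemLp G 2 μ) (i : Fin (d + 1)) :
    MemLp (fun X => G X i) 2 μ :=
  hG.of_le ((EuclideanSpace.proj (𝕜 := ℝ) i).continuous.comp_aestronglyMeasurable hG.1)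
    (Eventually.of_forall fun X => PiLp.norm_apply_le (G X) i)

theorem IsApprox.memLp_fderiv (h : IsApprox φ u G) (k : ℕ) (i : Fin (d + 1)) (p : ENNReal) :
    MemLp (fun X => fderiv ℝ (φ k) X (bv i)) p (halfVol d) :=
  memLp_halfVol (continuous_fderiv_apply (h.contDiff_one k) _)
    (hasCompactSupport_fderiv_apply (h.compact k) _) p

theorem integral_halfVol_fderiv_eq_zero {f : Rn d → ℝ} (hf : ContDiff ℝ 1 f)
    (hc : HasCompactSupport f) (h0 : ∀ x : Bd d, f (pt x 0) = 0) (i : Fin (d + 1)) :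
    ∫ X, fderiv ℝ f X (bv i) ∂(halfVol d) = 0 := by
  refine Fin.lastCases ?_ (fun i => ?_) i
  · rw [integral_halfVol_fderiv_last hf hc]; simp [h0]
  · exact integral_halfVol_fderiv_castSucc hf hc i

/-- The gradient of the zero function vanishes. -/
theorem IsApprox.grad_ae_zero (hd : 2 ≤ d) (h : IsApprox φ u G) (hu : u =ᵐ[halfVol d] 0) :
    G =ᵐ[halfVol d] 0 := by
  have : Fact (1 ≤ sobExp d) := ⟨one_le_sobExp hd⟩
  have hcoord : ∀ i : Fin (d + 1), ∀ᵐ X : Rn d, X ∈ halfSpace d → G X i = 0 := by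
    intro i
    have hGi : MemLp (fun X => G X i) 2 (volume.restrict (halfSpace d)) :=
      memLp_coord h.memLp_grad i
    -- G is the weak gradient of u, tested against η supported inside the open half-space, so that
    -- integration by parts leaves no boundary term.
    refine isOpen_halfSpace.ae_eq_zero_of_integral_contDiff_smul_eq_zero
      (f := fun X : Rn d => G X i) (μ := volume) ?_ ?_
    · exact (locallyIntegrableOn_of_locallyIntegrable_restrict
        (hGi.locallyIntegrable one_le_two))
    · intro η hη hηc hηs
      have hη1 : ContDiff ℝ 1 η := hη.of_le (by exact_mod_cast le_top)
      have e0 : ∫ X, η X • G X i = ∫ X, G X i * η X ∂(halfVol d) := by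
        rw [halfVol, setIntegral_eq_integral_of_forall_compl_eq_zero]
        · simp only [smul_eq_mul, mul_comm]
        · intro X hX
          rw [image_eq_zero_of_notMem_tsupport fun h => hX (hηs h), mul_zero]
      have hb : ∀ x : Bd d, η (pt x 0) = 0 := by
        intro x
        refine image_eq_zero_of_notMem_tsupport fun h => ?_
        have := hηs h
        simp [halfSpace] at this
      have t1 : Tendsto (fun k => ∫ X, fderiv ℝ (φ k) X (bv i) * η X ∂(halfVol d)) atTop
          (𝓝 (∫ X, G X i * η X ∂(halfVol d))) :=
        tendsto_integral_mul (p := 2) (q := 2) (fun k => h.memLp_fderiv k i 2) hGi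
          (memLp_halfVol hη.continuous hηc 2) (h.tendsto_fderiv i)
      have t2 : Tendsto (fun k => ∫ X, φ k X * fderiv ℝ η X (bv i) ∂(halfVol d)) atTop
          (𝓝 (∫ X, u X * fderiv ℝ η X (bv i) ∂(halfVol d))) :=
        tendsto_integral_mul (p := sobExp d) (q := (sobExp d).conjExponent)
          (fun k => memLp_halfVol (h.smooth k).continuous (h.compact k) _) h.memLp_fun
          (memLp_halfVol (continuous_fderiv_apply hη1 _) (hasCompactSupport_fderiv_apply hηc _) _)
          h.tendsto_fun
      have e2 : ∫ X, u X * fderiv ℝ η X (bv i) ∂(halfVol d) = 0 := by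
        refine integral_eq_zero_of_ae ?_
        filter_upwards [hu] with X hX
        simp [hX]
      have e3 : ∀ k, ∫ X, fderiv ℝ (φ k) X (bv i) * η X ∂(halfVol d) =
          -∫ X, φ k X * fderiv ℝ η X (bv i) ∂(halfVol d) := by
        intro k
        have hz := integral_halfVol_fderiv_eq_zero (f := fun X => φ k X * η X)
          ((h.contDiff_one k).mul hη1) ((h.compact k).mul_right) (fun x => by simp [hb]) i
        have hprod : ∀ X, fderiv ℝ (fun X => φ k X * η X) X (bv i) =
            fderiv ℝ (φ k) X (bv i) * η X + φ k X * fderiv ℝ η X (bv i) := by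
          intro X
          rw [fderiv_fun_mul ((h.contDiff_one k).differentiable one_ne_zero X)
            (hη1.differentiable one_ne_zero X)]
          simp; ring
        simp only [hprod] at hz
        rw [integral_add] at hz
        · linarith
        · exact (h.memLp_fderiv k i 2).integrable_mul (memLp_halfVol hη.continuous hηc 2)
        · exact (memLp_halfVol (h.smooth k).continuous (h.compact k) 2).integrable_mul
            (memLp_halfVol (continuous_fderiv_apply hη1 _) (hasCompactSupport_fderiv_apply hηc _) 2)
      rw [e0]
      simp only [e3] at t1
      rw [e2] at t2
      simpa using tendsto_nhds_unique t1 t2.neg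
  rw [EventuallyEq, halfVol, ae_restrict_iff' measurableSet_halfSpace]
  filter_upwards [ae_all_iff.2 hcoord] with X hX hXh
  ext i
  exact hX i hXh

/-- This makes the chosen `grad` usable: any explicit gradient agrees with it almost everywhere. -/
theorem HasGrad.ae_unique (hd : 2 ≤ d) (h : HasGrad u G) (h' : HasGrad v G')
    (huv : u =ᵐ[halfVol d] v) : G =ᵐ[halfVol d] G' := by
  obtain ⟨φ, hφ⟩ := h
  obtain ⟨ψ, hψ⟩ := h'
  have h0 := (hφ.sub hd hψ).grad_ae_zero hd (by
    filter_upwards [huv] with X hX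
    simp [hX])
  filter_upwards [h0] with X hX
  simpa [sub_eq_zero] using hX

theorem MemH1.hasGrad (h : MemH1 u) : HasGrad u (grad u) := Classical.epsilon_spec h

theorem HasGrad.grad_ae_eq (hd : 2 ≤ d) (h : HasGrad u G) : grad u =ᵐ[halfVol d] G :=
  (MemH1.hasGrad ⟨G, h⟩).ae_unique hd h EventuallyEq.rfl

/-- A function with vanishing gradient vanishes. -/
theorem IsApprox.ae_zero (hd : 2 ≤ d) (h : IsApprox φ u G) (hG : G =ᵐ[halfVol d] 0) :
    u =ᵐ[halfVol d] 0 := by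
  have hp := one_lt_pExp hd
  set B : ℕ → ENNReal := fun k => ENNReal.ofReal (pExp d + 1) *
      (eLpNorm (φ k) (sobExp d) (halfVol d) ^ pExp d * eLpNorm (gradient (φ k)) 2 (halfVol d))
    with hBdef
  -- The L^{2*} norms of `φ k` stay bounded because they converge, while the gradients tend to 0;
  -- the product therefore tends to 0 without any appeal to the Sobolev inequality.
  have hB : Tendsto B atTop (𝓝 0) := by
    have hb : ∀ᶠ k in atTop, eLpNorm (φ k) (sobExp d) (halfVol d) ≤
        1 + eLpNorm u (sobExp d) (halfVol d) := by
      filter_upwards [(h.tendsto_fun.eventually_lt_const (zero_lt_one))] with k hk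
      calc eLpNorm (φ k) (sobExp d) (halfVol d)
          = eLpNorm ((fun X => φ k X - u X) + u) (sobExp d) (halfVol d) := by
            congr 1; funext X; simp
        _ ≤ _ := eLpNorm_add_le ((h.smooth k).continuous.aestronglyMeasurable.sub h.memLp_fun.1)
            h.memLp_fun.1 (one_le_sobExp hd)
        _ ≤ _ := by gcongr
    have hfin : (1 + eLpNorm u (sobExp d) (halfVol d)) ^ pExp d ≠ ⊤ :=
      ENNReal.rpow_ne_top_of_nonneg (by linarith)
        (ENNReal.add_ne_top.2 ⟨ENNReal.one_ne_top, h.memLp_fun.2.ne⟩)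
    have hlim : Tendsto (fun k => ENNReal.ofReal (pExp d + 1) *
        ((1 + eLpNorm u (sobExp d) (halfVol d)) ^ pExp d *
          eLpNorm (gradient (φ k)) 2 (halfVol d))) atTop (𝓝 0) := by
      have := ENNReal.Tendsto.const_mul (ENNReal.Tendsto.const_mul
        (h.tendsto_eLpNorm_grad_zero hG) (Or.inr hfin))
        (Or.inr (ENNReal.ofReal_ne_top (r := pExp d + 1)))
      simpa using this
    refine tendsto_of_tendsto_of_tendsto_of_le_of_le' tendsto_const_nhds hlim
      (Eventually.of_forall fun _ => zero_le) ?_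
    filter_upwards [hb] with k hk
    simp only [hBdef]
    gcongr
  -- `B k` bounds the integral over every horizontal slice, so on a slab of finite height `φ k`
  -- tends to 0 in L^{2†}. It also tends to u in L^{2*}, and limits in measure are unique.
  have hslab : ∀ N : ℕ, u =ᵐ[volume.restrict (vert ⁻¹' Set.Ioo (0 : ℝ) N)] 0 := by
    intro N
    set μ : Measure (Rn d) := volume.restrict (vert ⁻¹' Set.Ioo (0 : ℝ) N)
    have hle : μ ≤ halfVol d := Measure.restrict_mono (fun X hX => hX.1) le_rfl
    have hmeas : ∀ k, AEStronglyMeasurable (φ k) μ :=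
      fun k => (h.smooth k).continuous.aestronglyMeasurable
    have m1 : TendstoInMeasure μ φ atTop u := by
      refine tendstoInMeasure_of_tendsto_eLpNorm (sobExp_ne_zero hd) hmeas
        (h.memLp_fun.1.mono_measure hle) ?_
      exact tendsto_of_tendsto_of_tendsto_of_le_of_le tendsto_const_nhds h.tendsto_fun
        (fun _ => zero_le) fun k => eLpNorm_mono_measure _ hle
    have m2 : TendstoInMeasure μ φ atTop 0 := by
      refine tendstoInMeasure_of_tendsto_eLpNorm (traceExp_ne_zero hd) hmeas
        aestronglyMeasurable_zero ?_
      have hk : ∀ k, eLpNorm (φ k - 0) (traceExp d) μ ≤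
          (B k * ENNReal.ofReal N) ^ (1 / (pExp d + 1)) := by
        intro k
        rw [sub_zero, eLpNorm_eq_lintegral_rpow_enorm_toReal (traceExp_ne_zero hd) traceExp_ne_top,
          traceExp_toReal hd]
        refine ENNReal.rpow_le_rpow ?_ (by positivity)
        have hmk : Measurable fun X => ‖φ k X‖ₑ ^ (pExp d + 1) :=
          (h.smooth k).continuous.enorm.measurable.pow_const _
        rw [← (measurePreserving_pt_restrict measurableSet_Ioo).lintegral_comp hmk,
          lintegral_prod_symm (fun p : Bd d × ℝ => ‖φ k (pt p.1 p.2)‖ₑ ^ (pExp d + 1))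
            (hmk.comp measurableEmbedding_pt.measurable).aemeasurable]
        calc ∫⁻ t in Set.Ioo (0 : ℝ) N, ∫⁻ x : Bd d, ‖φ k (pt x t)‖ₑ ^ (pExp d + 1)
            ≤ ∫⁻ _ in Set.Ioo (0 : ℝ) N, B k := by
              refine setLIntegral_mono measurable_const fun t ht => ?_
              exact lintegral_slice_le hd (h.contDiff_one k) (h.compact k) ht.1.le
          _ = _ := by simp
      have hl : Tendsto (fun k => (B k * ENNReal.ofReal N) ^ (1 / (pExp d + 1))) atTop (𝓝 0) := by
        have := (ENNReal.Tendsto.mul_const hB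
          (Or.inr (ENNReal.ofReal_ne_top (r := (N : ℝ))))).ennrpow_const (1 / (pExp d + 1))
        rwa [zero_mul, ENNReal.zero_rpow_of_pos (by positivity)] at this
      exact tendsto_of_tendsto_of_tendsto_of_le_of_le tendsto_const_nhds hl
        (fun _ => zero_le) hk
    exact tendstoInMeasure_ae_unique m1 m2
  have hU : halfSpace d = ⋃ N : ℕ, vert ⁻¹' Set.Ioo (0 : ℝ) N := by
    ext X
    simp only [halfSpace, Set.mem_ofPred_eq, Set.mem_iUnion, Set.mem_preimage, Set.mem_Ioo]
    constructor
    · intro hX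
      obtain ⟨N, hN⟩ := exists_nat_gt (vert X)
      exact ⟨N, hX, hN⟩
    · rintro ⟨_, hX, _⟩; exact hX
  rw [EventuallyEq, halfVol, hU, ae_restrict_iUnion_iff]
  exact hslab

theorem HasGrad.ae_eq (hd : 2 ≤ d) (h : HasGrad u G) (h' : HasGrad v G')
    (hG : G =ᵐ[halfVol d] G') : u =ᵐ[halfVol d] v := by
  obtain ⟨φ, hφ⟩ := h
  obtain ⟨ψ, hψ⟩ := h'
  have h0 := (hφ.sub hd hψ).ae_zero hd (by
    filter_upwards [hG] with X hX
    simp [hX])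
  filter_upwards [h0] with X hX
  simpa [sub_eq_zero] using hX

/-- The trace inequality applied to `φ k - φ l` shows that the boundary values form a Cauchy
sequence in L^{2†}. -/
theorem MemH1.exists_hasTrace (hd : 2 ≤ d) (h : MemH1 u) : ∃ τ, HasTrace u τ := by
  obtain ⟨G, φ, hφ⟩ := h
  have hp := one_lt_pExp hd
  have : Fact (1 ≤ traceExp d) := ⟨one_le_traceExp hd⟩
  have hmem : ∀ k, MemLp (fun x : Bd d => φ k (pt x 0)) (traceExp d) volume := fun k =>
    ((hφ.smooth k).continuous.comp (bdL d).continuous).memLp_of_hasCompactSupport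
      (hasCompactSupport_comp_pt (hφ.compact k) 0)
  set a : ℕ → ENNReal := fun k => eLpNorm (fun X => φ k X - u X) (sobExp d) (halfVol d)
  set b : ℕ → ENNReal := fun k => eLpNorm (fun X => gradient (φ k) X - G X) 2 (halfVol d)
  have hbound : ∀ k l, edist ((hmem k).toLp _) ((hmem l).toLp _) ^ (pExp d + 1) ≤
      ENNReal.ofReal (pExp d + 1) * ((a k + a l) ^ pExp d * (b k + b l)) := by
    intro k l
    rw [Lp.edist_toLp_toLp]
    have hdk := (hφ.contDiff_one k).differentiable one_ne_zero
    have hdl := (hφ.contDiff_one l).differentiable one_ne_zero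
    refine (eLpNorm_boundary_rpow_le hd (φ := fun X => φ k X - φ l X)
      ((hφ.contDiff_one k).sub (hφ.contDiff_one l)) ((hφ.compact k).sub (hφ.compact l))).trans ?_
    gcongr
    · have e : (fun X => φ k X - φ l X) = (fun X => φ k X - u X) - fun X => φ l X - u X := by
        funext X; simp
      rw [e]
      exact eLpNorm_sub_le ((hφ.smooth k).continuous.aestronglyMeasurable.sub hφ.memLp_fun.1)
        ((hφ.smooth l).continuous.aestronglyMeasurable.sub hφ.memLp_fun.1) (one_le_sobExp hd)
    · have e : gradient (fun X => φ k X - φ l X) =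
          (fun X => gradient (φ k) X - G X) - fun X => gradient (φ l) X - G X := by
        funext X; rw [gradient_sub hdk hdl]; simp
      rw [e]
      exact eLpNorm_sub_le
        ((continuous_gradient (hφ.contDiff_one k)).aestronglyMeasurable.sub hφ.memLp_grad.1)
        ((continuous_gradient (hφ.contDiff_one l)).aestronglyMeasurable.sub hφ.memLp_grad.1)
        one_le_two
  have hlim : Tendsto (fun n : ℕ × ℕ => ENNReal.ofReal (pExp d + 1) *
      ((a n.1 + a n.2) ^ pExp d * (b n.1 + b n.2))) (atTop ×ˢ atTop) (𝓝 0) := by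
    have ta : Tendsto (fun n : ℕ × ℕ => a n.1 + a n.2) (atTop ×ˢ atTop) (𝓝 (0 + 0)) :=
      (hφ.tendsto_fun.comp tendsto_fst).add (hφ.tendsto_fun.comp tendsto_snd)
    have tb : Tendsto (fun n : ℕ × ℕ => b n.1 + b n.2) (atTop ×ˢ atTop) (𝓝 (0 + 0)) :=
      (hφ.tendsto_grad.comp tendsto_fst).add (hφ.tendsto_grad.comp tendsto_snd)
    rw [add_zero] at ta tb
    have ta' := ta.ennrpow_const (pExp d)
    rw [ENNReal.zero_rpow_of_pos (by linarith)] at ta'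
    have := ENNReal.Tendsto.const_mul (a := ENNReal.ofReal (pExp d + 1))
      (ENNReal.Tendsto.mul ta' (Or.inr ENNReal.zero_ne_top) tb (Or.inr ENNReal.zero_ne_top))
      (Or.inr ENNReal.ofReal_ne_top)
    simpa using this
  have hcauchy : CauchySeq fun k => (hmem k).toLp (fun x : Bd d => φ k (pt x 0)) := by
    rw [EMetric.cauchySeq_iff]
    intro ε hε
    have hε' : 0 < ε ^ (pExp d + 1) := ENNReal.rpow_pos_of_nonneg hε (by linarith)
    have hev := hlim.eventually_lt_const hε'
    rw [prod_atTop_atTop_eq, eventually_atTop_prod_self] at hev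
    obtain ⟨N, hN⟩ := hev
    refine ⟨N, fun k hk l hl => ?_⟩
    have := (hbound k l).trans_lt (hN k l hk hl)
    exact (ENNReal.rpow_lt_rpow_iff (by linarith)).1 this
  obtain ⟨τ, hτ⟩ := cauchySeq_tendsto_of_complete hcauchy
  refine ⟨τ, Lp.memLp τ, φ, G, hφ, ?_⟩
  rw [Lp.tendsto_Lp_iff_tendsto_eLpNorm'] at hτ
  refine hτ.congr fun k => eLpNorm_congr_ae ?_
  filter_upwards [(hmem k).coeFn_toLp] with x hx
  simp [hx]

theorem MemH1.hasTrace_trace (hd : 2 ≤ d) (h : MemH1 u) : HasTrace u (trace u) :=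
  Classical.epsilon_spec (h.exists_hasTrace hd)

end Approx

/-! ### The inversion `confMap`, the Kelvin transform and its Steklov boundary condition -/

section Kelvin

open MvPolynomial

variable {d : ℕ}

/-- The pole `(0, -1)` of the inversion `confMap`. -/
def pole (d : ℕ) : Rn d := pt 0 (-1)

/-- The squared distance to the pole. -/
def poleSq (X : Rn d) : ℝ := ‖X - pole d‖ ^ 2

/-- The exponent `(n - 2) / 2`. -/
def kelExp (d : ℕ) : ℝ := (dim d - 2) / 2

theorem kelExp_pos (hd : 2 ≤ d) : 0 < kelExp d := by
  have := three_le_dim hd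
  unfold kelExp; linarith

theorem card_eq_kelExp (d : ℕ) : (Fintype.card (Fin (d + 1)) : ℝ) = 2 * kelExp d + 2 := by
  simp [kelExp, dim]; ring

@[simp] theorem pole_castSucc (i : Fin d) : pole d i.castSucc = 0 := by simp [pole]
@[simp] theorem pole_last : pole d (Fin.last d) = -1 := by simp [pole]

theorem norm_sq_eq (X : Rn d) : ‖X‖ ^ 2 = ‖horiz X‖ ^ 2 + vert X ^ 2 := by
  rw [← norm_sq_pt, pt_horiz_vert]

theorem vert_sub (X Y : Rn d) : vert (X - Y) = vert X - vert Y := rfl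

theorem horiz_sub_pole (X : Rn d) : horiz (X - pole d) = horiz X := by
  ext i; simp [horiz]

theorem poleSq_eq (X : Rn d) : poleSq X = (1 + vert X) ^ 2 + ‖horiz X‖ ^ 2 := by
  rw [poleSq, norm_sq_eq, horiz_sub_pole, vert_sub, pole, vert_pt]; ring

theorem poleSq_eq_norm (X : Rn d) : poleSq X = ‖X‖ ^ 2 + 2 * vert X + 1 := by
  rw [poleSq_eq, norm_sq_eq]; ring

theorem poleSq_eq_sum (X : Rn d) : poleSq X = ∑ i, (X i - pole d i) ^ 2 := by
  rw [poleSq, EuclideanSpace.real_norm_sq_eq]; rfl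

theorem poleSq_pos_of_vert {X : Rn d} (h : -1 < vert X) : 0 < poleSq X := by
  rw [poleSq_eq]
  have : 0 < 1 + vert X := by linarith
  positivity

theorem poleSq_ne_zero_iff {X : Rn d} : poleSq X ≠ 0 ↔ X ≠ pole d := by
  simp [poleSq, sub_eq_zero]

theorem poleSq_nonneg (X : Rn d) : 0 ≤ poleSq X := by unfold poleSq; positivity

theorem contDiff_poleSq {n : WithTop ℕ∞} : ContDiff ℝ n (poleSq : Rn d → ℝ) := by
  unfold poleSq
  exact (contDiff_id.sub contDiff_const).norm_sq ℝ

theorem stdBubble_eq (X : Rn d) :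
    stdBubble d X = (dim d - 2) ^ kelExp d * poleSq X ^ (-kelExp d) := by
  rw [stdBubble, bubble, poleSq_eq]
  congr 1
  rw [Real.rpow_neg (by positivity), ← Real.inv_rpow (by positivity), one_div]
  simp [kelExp]

theorem stdBubble_pos (hd : 2 ≤ d) {X : Rn d} (h : poleSq X ≠ 0) : 0 < stdBubble d X := by
  have := three_le_dim hd
  have h' : 0 < poleSq X := lt_of_le_of_ne (poleSq_nonneg X) h.symm
  rw [stdBubble_eq]
  have : 0 < dim d - 2 := by linarith
  positivity

/-- In this form the map is visibly the inversion about the pole with squared radius 2, hence an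
involution away from the pole. -/
theorem confMap_eq {X : Rn d} (h : poleSq X ≠ 0) :
    confMap X = pole d + (2 / poleSq X) • (X - pole d) := by
  ext i
  refine Fin.lastCases ?_ (fun i => ?_) i
  · simp only [confMap, pt_last, PiLp.add_apply, PiLp.smul_apply, PiLp.sub_apply, pole_last,
      smul_eq_mul, ← poleSq_eq]
    change _ = -1 + 2 / poleSq X * (vert X - -1)
    have := poleSq_eq_norm X
    field_simp
    linarith
  · simp only [confMap, pt_castSucc, PiLp.add_apply, PiLp.smul_apply, PiLp.sub_apply, pole_castSucc,
      smul_eq_mul, ← poleSq_eq, sub_zero, zero_add]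
    rfl

theorem confMap_apply {X : Rn d} (h : poleSq X ≠ 0) (i : Fin (d + 1)) :
    confMap X i = pole d i + 2 * (X i - pole d i) / poleSq X := by
  rw [confMap_eq h]
  simp
  ring

theorem confMap_sub_pole {X : Rn d} (h : poleSq X ≠ 0) :
    confMap X - pole d = (2 / poleSq X) • (X - pole d) := by
  rw [confMap_eq h, add_sub_cancel_left]

theorem poleSq_confMap {X : Rn d} (h : poleSq X ≠ 0) : poleSq (confMap X) = 4 / poleSq X := by
  rw [poleSq, confMap_sub_pole h, norm_smul, mul_pow, ← poleSq, Real.norm_eq_abs, sq_abs]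
  field_simp
  norm_num

theorem poleSq_confMap_ne {X : Rn d} (h : poleSq X ≠ 0) : poleSq (confMap X) ≠ 0 := by
  rw [poleSq_confMap h]; positivity

theorem confMap_confMap {X : Rn d} (h : poleSq X ≠ 0) : confMap (confMap X) = X := by
  rw [confMap_eq (poleSq_confMap_ne h), confMap_sub_pole h, poleSq_confMap h, smul_smul,
    show 2 / (4 / poleSq X) * (2 / poleSq X) = 1 by field_simp; norm_num, one_smul,
    add_sub_cancel]

theorem vert_confMap (X : Rn d) : vert (confMap X) = (1 - ‖X‖ ^ 2) / poleSq X := by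
  rw [confMap, vert_pt, poleSq_eq]

/-- The formula for the height of an image point, read at `confMap X` and solved for its norm. It
shows that the half-space goes to the unit ball and its boundary to the sphere. -/
theorem norm_sq_confMap {X : Rn d} (h : poleSq X ≠ 0) :
    ‖confMap X‖ ^ 2 = 1 - 4 * vert X / poleSq X := by
  have h1 := vert_confMap (confMap X)
  rw [confMap_confMap h, poleSq_confMap h] at h1
  rw [h1]
  field_simp
  ring

theorem norm_confMap_le {X : Rn d} (h : 0 ≤ vert X) : ‖confMap X‖ ≤ 1 := by
  have hs := poleSq_pos_of_vert (X := X) (by linarith)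
  have h1 := norm_sq_confMap hs.ne'
  have : 0 ≤ 4 * vert X / poleSq X := by positivity
  nlinarith [norm_nonneg (confMap X)]

theorem norm_confMap_lt {X : Rn d} (h : X ∈ halfSpace d) : ‖confMap X‖ < 1 := by
  have h' : 0 < vert X := h
  have hs := poleSq_pos_of_vert (X := X) (by linarith)
  have h1 := norm_sq_confMap hs.ne'
  have : 0 < 4 * vert X / poleSq X := by positivity
  nlinarith [norm_nonneg (confMap X)]

theorem norm_confMap_boundary (x : Bd d) : ‖confMap (pt x 0)‖ = 1 := by
  have hs := poleSq_pos_of_vert (X := pt x 0) (by simp)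
  have h1 := norm_sq_confMap hs.ne'
  simp only [vert_pt, mul_zero, zero_div, sub_zero] at h1
  exact (sq_eq_sq₀ (norm_nonneg _) zero_le_one).1 (by rw [h1, one_pow])

theorem norm_pole : ‖pole d‖ = 1 := by
  have := norm_sq_pt (0 : Bd d) (-1)
  rw [← pole] at this
  exact (sq_eq_sq₀ (norm_nonneg _) zero_le_one).1 (by rw [this]; simp)

theorem poleSq_ne_zero_of_norm_lt {y : Rn d} (h : ‖y‖ < 1) : poleSq y ≠ 0 := by
  rw [poleSq_ne_zero_iff]
  rintro rfl
  rw [norm_pole] at h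
  exact lt_irrefl _ h

theorem confMap_mem_halfSpace {y : Rn d} (h : ‖y‖ < 1) : confMap y ∈ halfSpace d := by
  have hs := lt_of_le_of_ne (poleSq_nonneg y) (poleSq_ne_zero_of_norm_lt h).symm
  change 0 < vert (confMap y)
  rw [vert_confMap]
  have : 0 < 1 - ‖y‖ ^ 2 := by nlinarith [norm_nonneg y]
  positivity

/-- The Kelvin transform `U · P ∘ F` of a polynomial. -/
def kel (P : MvPolynomial (Fin (d + 1)) ℝ) (X : Rn d) : ℝ :=
  stdBubble d X * eval (fun i => confMap X i) P

theorem kel_add (P Q : MvPolynomial (Fin (d + 1)) ℝ) (X : Rn d) :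
    kel (P + Q) X = kel P X + kel Q X := by simp [kel, mul_add]

theorem kel_smul (c : ℝ) (P : MvPolynomial (Fin (d + 1)) ℝ) (X : Rn d) :
    kel (c • P) X = c * kel P X := by simp [kel]; ring

/-- The operator on polynomials that corresponds to `∂ᵢ` under the Kelvin transform. -/
abbrev dK (i : Fin (d + 1)) : MvPolynomial (Fin (d + 1)) ℝ →ₗ[ℝ] MvPolynomial (Fin (d + 1)) ℝ :=
  kelD (fun i => pole d i) (kelExp d) i

theorem eval_shiftX {X : Rn d} (h : poleSq X ≠ 0) (i : Fin (d + 1)) :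
    eval (fun i => confMap X i) (shiftX (fun i => pole d i) i) =
      2 * (X i - pole d i) / poleSq X := by
  simp [shiftX, confMap_apply h]

theorem eval_shiftSq {X : Rn d} (h : poleSq X ≠ 0) :
    eval (fun i => confMap X i) (shiftSq (fun i => pole d i)) = 4 / poleSq X := by
  rw [← poleSq_confMap h, poleSq_eq_sum, shiftSq, map_sum]
  refine Finset.sum_congr rfl fun i _ => ?_
  simp [shiftX, sq]

section Line

variable (X : Rn d) (i : Fin (d + 1))

theorem hasDerivAt_line_apply (j : Fin (d + 1)) :
    HasDerivAt (fun t : ℝ => (X + t • bv i) j) (if i = j then 1 else 0) 0 := by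
  have : (fun t : ℝ => (X + t • bv i) j) = fun t => X j + t * (if i = j then 1 else 0) := by
    funext t
    simp [eq_comm]
  rw [this]
  simpa using ((hasDerivAt_id (0 : ℝ)).mul_const (if i = j then (1 : ℝ) else 0)).const_add (X j)

theorem hasDerivAt_poleSq_line :
    HasDerivAt (fun t : ℝ => poleSq (X + t • bv i)) (2 * (X i - pole d i)) 0 := by
  simp only [poleSq_eq_sum]
  have h : ∀ j ∈ Finset.univ, HasDerivAt (fun t : ℝ => ((X + t • bv i) j - pole d j) ^ 2)
      (2 * (X j - pole d j) * (if i = j then 1 else 0)) 0 := by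
    intro j _
    simpa using ((hasDerivAt_line_apply X i j).sub_const (pole d j)).fun_pow 2
  have h2 := HasDerivAt.fun_sum h
  simpa using h2

theorem tendsto_line : Tendsto (fun t : ℝ => X + t • bv i) (𝓝 0) (𝓝 X) := by
  have : Continuous fun t : ℝ => X + t • bv i := by fun_prop
  simpa using this.tendsto 0

variable {X}

theorem eventually_poleSq_ne (h : poleSq X ≠ 0) : ∀ᶠ Y in 𝓝 X, poleSq Y ≠ 0 :=
  (contDiff_poleSq (n := 0)).continuous.continuousAt.eventually_ne h

/-- With y = F(X) one has y - e = 2(X - e)/|X - e|² and |y - e|² = 4/|X - e|², so the derivative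
∂ᵢyⱼ is the polynomial ½|y - e|² δᵢⱼ - (yᵢ - eᵢ)(yⱼ - eⱼ) in y. -/
theorem hasDerivAt_confMap_line (h : poleSq X ≠ 0) (j : Fin (d + 1)) :
    HasDerivAt (fun t : ℝ => confMap (X + t • bv i) j)
      (eval (fun i => confMap X i) (invD (fun i => pole d i) i (MvPolynomial.X j))) 0 := by
  have h1 : HasDerivAt (fun t : ℝ => pole d j + 2 * ((X + t • bv i) j - pole d j) /
      poleSq (X + t • bv i)) ((2 * (if i = j then 1 else 0) * poleSq X -
        2 * (X j - pole d j) * (2 * (X i - pole d i))) / poleSq X ^ 2) 0 := by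
    have := ((((hasDerivAt_line_apply X i j).sub_const (pole d j)).const_mul 2).div
      (hasDerivAt_poleSq_line X i) (by simpa using h)).const_add (pole d j)
    simpa using this
  have h2 : eval (fun i => confMap X i) (invD (fun i => pole d i) i (MvPolynomial.X j)) =
      (2 * (if i = j then 1 else 0) * poleSq X -
        2 * (X j - pole d j) * (2 * (X i - pole d i))) / poleSq X ^ 2 := by
    have e1 : eulerD (fun i => pole d i) (MvPolynomial.X j) = shiftX (fun i => pole d i) j := by
      rw [← eulerD_shiftX]
      conv_rhs => rw [shiftX, map_sub]
      simp
    rw [invD_apply, e1]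
    simp only [map_sub, map_mul, eval_shiftX h, eval_shiftSq h, eval_C, pderiv_X, Pi.single_apply]
    rcases eq_or_ne i j with rfl | hij
    · simp only [if_true, mul_one, map_one]
      field_simp
      ring
    · simp only [hij, hij.symm, if_false, mul_zero]
      simp only [map_zero, mul_zero, zero_mul, zero_sub]
      field_simp
  rw [h2]
  refine h1.congr_of_eventuallyEq ?_
  filter_upwards [(tendsto_line X i).eventually (eventually_poleSq_ne h)] with t ht
  rw [confMap_apply ht]

theorem hasDerivAt_eval_line (h : poleSq X ≠ 0) (P : MvPolynomial (Fin (d + 1)) ℝ) :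
    HasDerivAt (fun t : ℝ => eval (fun j => confMap (X + t • bv i) j) P)
      (eval (fun j => confMap X j) (invD (fun i => pole d i) i P)) 0 := by
  induction P using MvPolynomial.induction_on with
  | C a => simpa using hasDerivAt_const (0 : ℝ) a
  | add P Q hP hQ => simpa using hP.fun_add hQ
  | mul_X P j hP =>
    simp only [map_mul, eval_X, Derivation.leibniz, smul_eq_mul, map_add]
    refine (hP.fun_mul (hasDerivAt_confMap_line i h j)).congr_deriv ?_
    simp only [zero_smul, add_zero]
    ring

theorem hasDerivAt_kel_line (h : poleSq X ≠ 0) (P : MvPolynomial (Fin (d + 1)) ℝ) :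
    HasDerivAt (fun t : ℝ => kel P (X + t • bv i)) (kel (dK i P) X) 0 := by
  have h1 : HasDerivAt (fun t : ℝ => stdBubble d (X + t • bv i))
      (stdBubble d X * (-kelExp d * (2 * (X i - pole d i) / poleSq X))) 0 := by
    simp only [stdBubble_eq]
    have := ((hasDerivAt_poleSq_line X i).rpow_const (p := -kelExp d)
      (Or.inl (by simpa using h))).const_mul ((dim d - 2) ^ kelExp d)
    refine this.congr_deriv ?_
    have hs : 0 < poleSq X := lt_of_le_of_ne (poleSq_nonneg X) h.symm
    simp only [zero_smul, add_zero]
    rw [Real.rpow_sub_one h]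
    ring
  have h2 := h1.mul (hasDerivAt_eval_line i h P)
  refine h2.congr_deriv ?_
  simp only [kel, kelD, LinearMap.sub_apply, LinearMap.smul_apply, Derivation.coeFn_coe,
    LinearMap.mulLeft_apply, map_sub, smul_eval, map_mul, eval_shiftX h, zero_smul, add_zero]
  ring

end Line

variable {X : Rn d}

theorem contDiffAt_eval_confMap {n : WithTop ℕ∞} (h : poleSq X ≠ 0)
    (P : MvPolynomial (Fin (d + 1)) ℝ) :
    ContDiffAt ℝ n (fun Y : Rn d => eval (fun j => confMap Y j) P) X := by
  induction P using MvPolynomial.induction_on with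
  | C a => simpa using contDiffAt_const
  | add P Q hP hQ => simpa using hP.add hQ
  | mul_X P j hP =>
    simp only [map_mul, eval_X]
    refine hP.mul ?_
    have h1 : ContDiffAt ℝ n (fun Y : Rn d => pole d j + 2 * (Y j - pole d j) / poleSq Y) X := by
      refine contDiffAt_const.add (ContDiffAt.div ?_ contDiff_poleSq.contDiffAt h)
      exact contDiffAt_const.mul
        (((EuclideanSpace.proj (𝕜 := ℝ) j).contDiff.contDiffAt).sub contDiffAt_const)
    refine h1.congr_of_eventuallyEq ?_
    filter_upwards [eventually_poleSq_ne h] with Y hY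
    rw [confMap_apply hY]

theorem contDiffAt_kel {n : WithTop ℕ∞} (h : poleSq X ≠ 0) (P : MvPolynomial (Fin (d + 1)) ℝ) :
    ContDiffAt ℝ n (kel P) X := by
  unfold kel
  refine ContDiffAt.mul ?_ (contDiffAt_eval_confMap h P)
  simp only [funext stdBubble_eq]
  exact contDiffAt_const.mul (contDiff_poleSq.contDiffAt.rpow_const_of_ne h)

theorem fderiv_kel (h : poleSq X ≠ 0) (P : MvPolynomial (Fin (d + 1)) ℝ) (i : Fin (d + 1)) :
    fderiv ℝ (kel P) X (bv i) = kel (dK i P) X := by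
  have hd := (contDiffAt_kel (n := 1) h P).differentiableAt one_ne_zero
  rw [← hd.lineDeriv_eq_fderiv]
  exact (hasDerivAt_kel_line i h P).deriv

theorem sum_kel_dK_dK {P : MvPolynomial (Fin (d + 1)) ℝ} (hP : lap _ P = 0) (X : Rn d) :
    ∑ i, kel (dK i (dK i P)) X = 0 := by
  have h := sum_kelD_kelD (fun i => pole d i) (kelExp d) (card_eq_kelExp d) hP
  simp only [kel]
  rw [← Finset.mul_sum, ← map_sum, h]
  simp

/-- The boundary weight `U^{p-1}`. -/
theorem stdBubble_rpow (hd : 2 ≤ d) (X : Rn d) :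
    stdBubble d X ^ (pExp d - 1) = (dim d - 2) / poleSq X := by
  have h3 := three_le_dim hd
  have h0 : 0 < dim d - 2 := by linarith
  have e : kelExp d * (pExp d - 1) = 1 := by
    rw [kelExp, pExp]; field_simp; ring
  rw [stdBubble_eq, Real.mul_rpow (by positivity) (Real.rpow_nonneg (poleSq_nonneg X) _),
    ← Real.rpow_mul h0.le, ← Real.rpow_mul (poleSq_nonneg X), neg_mul, e, Real.rpow_one,
    Real.rpow_neg_one]
  rfl

/-- The Steklov eigenvalues `(2k + n - 2) / (n - 2)`. -/
def eig (d k : ℕ) : ℝ := (2 * k + dim d - 2) / (dim d - 2)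

/-- Since e = (0, -1), the Euler field centred at e acts on P as k + ∂_n. On t = 0 both ½|y - e|²
and y_n + 1 equal 2/|X - e|², so the ∂_n P terms cancel and -(2/|X - e|²)(m + k) P remains, with m =
(n - 2)/2. Only homogeneity is used here. -/
theorem kel_dK_last_boundary (hd : 2 ≤ d) {k : ℕ} {P : MvPolynomial (Fin (d + 1)) ℝ}
    (hP : P.IsHomogeneous k) (x : Bd d) :
    kel (dK (Fin.last d) P) (pt x 0) =
      -(eig d k * (stdBubble d (pt x 0) ^ (pExp d - 1) * kel P (pt x 0))) := by
  have h3 := three_le_dim hd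
  have h0 : dim d - 2 ≠ 0 := by linarith
  have hs := (poleSq_pos_of_vert (X := pt x 0) (by simp)).ne'
  have heul := congrArg (eval fun i => confMap (pt x 0) i) hP.sum_X_mul_pderiv
  have hE : eulerD (fun i => pole d i) P = (k : MvPolynomial (Fin (d + 1)) ℝ) * P +
      pderiv (Fin.last d) P := by
    rw [eulerD_apply]
    have : ∀ j : Fin (d + 1), shiftX (fun i => pole d i) j * pderiv j P =
        MvPolynomial.X j * pderiv j P - C (pole d j) * pderiv j P := by
      intro j; rw [shiftX]; ring
    simp only [this, Finset.sum_sub_distrib, hP.sum_X_mul_pderiv]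
    rw [Fin.sum_univ_castSucc (f := fun j => C (pole d j) * pderiv j P)]
    simp
  rw [stdBubble_rpow hd, kel, kel, kelD_apply, hE]
  simp only [map_sub, map_mul, map_add, eval_C, eval_shiftX hs, eval_shiftSq hs, map_natCast,
    pt_last, pole_last, eig, kelExp]
  field_simp
  ring

end Kelvin

/-! ### Decay of Kelvin transforms and of their derivatives -/

section Decay

theorem tendsto_eLpNorm_zero_of_dominated {α F : Type*} [MeasurableSpace α] [NormedAddCommGroup F]
    {μ : Measure α} {p : ENNReal} (hp0 : p ≠ 0) (hp : p ≠ ⊤) {f : ℕ → α → F} {g : α → ℝ}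
    (hf : ∀ k, AEStronglyMeasurable (f k) μ) (hg : MemLp g p μ)
    (hfg : ∀ k, ∀ᵐ x ∂μ, ‖f k x‖ ≤ g x) (hlim : ∀ᵐ x ∂μ, Tendsto (fun k => f k x) atTop (𝓝 0)) :
    Tendsto (fun k => eLpNorm (f k) p μ) atTop (𝓝 0) := by
  have hpos : 0 < p.toReal := ENNReal.toReal_pos hp0 hp
  have h : Tendsto (fun k => ∫⁻ x, ‖f k x‖ₑ ^ p.toReal ∂μ) atTop (𝓝 (∫⁻ _, 0 ∂μ)) := by
    refine tendsto_lintegral_of_dominated_convergence' (fun x => ‖g x‖ₑ ^ p.toReal)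
      (fun k => (hf k).enorm.pow_const _) ?_ ?_ ?_
    · intro k
      filter_upwards [hfg k] with x hx
      refine ENNReal.rpow_le_rpow ?_ hpos.le
      exact enorm_le_iff_norm_le.2 (hx.trans (le_abs_self _))
    · have := (eLpNorm_lt_top_iff_lintegral_rpow_enorm_lt_top hp0 hp).1 hg.2
      exact this.ne
    · filter_upwards [hlim] with x hx
      have := hx.enorm.ennrpow_const p.toReal
      rwa [enorm_zero, ENNReal.zero_rpow_of_pos hpos] at this
  rw [lintegral_zero] at h
  have := h.ennrpow_const (1 / p.toReal)
  rw [ENNReal.zero_rpow_of_pos (by positivity)] at this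
  refine this.congr fun k => ?_
  rw [eLpNorm_eq_lintegral_rpow_enorm_toReal hp0 hp]

theorem memLp_one_add_norm_sq_rpow {E : Type*} [NormedAddCommGroup E] [NormedSpace ℝ E]
    [FiniteDimensional ℝ E] [MeasurableSpace E] [BorelSpace E] (μ : Measure E)
    [μ.IsAddHaarMeasure] {p : ENNReal} (hp0 : p ≠ 0) (hp : p ≠ ⊤) {a : ℝ}
    (ha : (Module.finrank ℝ E : ℝ) < 2 * a * p.toReal) :
    MemLp (fun x : E => (1 + ‖x‖ ^ 2) ^ (-a)) p μ := by
  have hm : Continuous fun x : E => (1 + ‖x‖ ^ 2) ^ (-a) :=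
    Continuous.rpow_const (by fun_prop) fun x => Or.inl (by positivity)
  rw [← integrable_norm_rpow_iff hm.aestronglyMeasurable hp0 hp]
  refine (integrable_rpow_neg_one_add_norm_sq (μ := μ) ha).congr (Eventually.of_forall fun x => ?_)
  simp only
  rw [Real.norm_of_nonneg (by positivity), ← Real.rpow_mul (by positivity)]
  congr 1; ring

open MvPolynomial

variable {d : ℕ}

theorem one_add_norm_sq_le_poleSq {X : Rn d} (h : 0 ≤ vert X) : 1 + ‖X‖ ^ 2 ≤ poleSq X := by
  rw [poleSq_eq_norm]; linarith

theorem exists_bound_eval (P : MvPolynomial (Fin (d + 1)) ℝ) :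
    ∃ C, 0 ≤ C ∧ ∀ y : Rn d, ‖y‖ ≤ 1 → |eval (fun i => y i) P| ≤ C := by
  have hc : Continuous fun y : Rn d => eval (fun i => y i) P :=
    (MvPolynomial.continuous_eval P).comp (by fun_prop)
  obtain ⟨C, hC⟩ := (isCompact_closedBall (0 : Rn d) 1).exists_bound_of_continuousOn hc.continuousOn
  refine ⟨C, (norm_nonneg _).trans (hC 0 (by simp)), fun y hy => hC y (by simpa using hy)⟩

theorem rpow_neg_poleSq_le {X : Rn d} (h : 0 ≤ vert X) {a : ℝ} (ha : 0 ≤ a) :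
    poleSq X ^ (-a) ≤ (1 + ‖X‖ ^ 2) ^ (-a) :=
  Real.rpow_le_rpow_of_nonpos (by positivity) (one_add_norm_sq_le_poleSq h) (by linarith)

/-- F takes the closed half-space into the closed unit ball, where P is bounded, so the decay is
that of U. -/
theorem exists_bound_kel (hd : 2 ≤ d) (P : MvPolynomial (Fin (d + 1)) ℝ) :
    ∃ C, 0 ≤ C ∧ ∀ X : Rn d, 0 ≤ vert X → |kel P X| ≤ C * (1 + ‖X‖ ^ 2) ^ (-kelExp d) := by
  obtain ⟨C, hC0, hC⟩ := exists_bound_eval P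
  have h3 : 0 ≤ dim d - 2 := by linarith [three_le_dim hd]
  refine ⟨(dim d - 2) ^ kelExp d * C, by positivity, fun X hX => ?_⟩
  rw [kel, abs_mul, stdBubble_eq, abs_mul, abs_of_nonneg (by positivity),
    abs_of_nonneg (Real.rpow_nonneg (poleSq_nonneg X) _)]
  have h1 := hC _ (norm_confMap_le hX)
  have h2 := rpow_neg_poleSq_le hX (kelExp_pos hd).le
  calc (dim d - 2) ^ kelExp d * poleSq X ^ (-kelExp d) * |eval (fun i => confMap X i) P|
      ≤ (dim d - 2) ^ kelExp d * (1 + ‖X‖ ^ 2) ^ (-kelExp d) * C := by gcongr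
    _ = _ := by ring

/-- One power of 1/|X| is gained over `exists_bound_kel`: every term of `kelD` has a factor |y - e|²
or yᵢ - eᵢ, and |y - e| = 2/|X - e|. -/
theorem exists_bound_kel_dK (hd : 2 ≤ d) (P : MvPolynomial (Fin (d + 1)) ℝ) (i : Fin (d + 1)) :
    ∃ C, 0 ≤ C ∧ ∀ X : Rn d, 0 ≤ vert X →
      |kel (dK i P) X| ≤ C * (1 + ‖X‖ ^ 2) ^ (-(kelExp d + 1 / 2)) := by
  obtain ⟨A, hA0, hA⟩ := exists_bound_eval (pderiv i P)
  obtain ⟨B, hB0, hB⟩ := exists_bound_eval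
    (C (kelExp d) * P + eulerD (fun i => pole d i) P)
  have h3 : 0 ≤ dim d - 2 := by linarith [three_le_dim hd]
  have hm := kelExp_pos hd
  refine ⟨(dim d - 2) ^ kelExp d * (2 * A + 2 * B), by positivity, fun X hX => ?_⟩
  have hs1 : 1 ≤ poleSq X := le_trans (by nlinarith [norm_nonneg X]) (one_add_norm_sq_le_poleSq hX)
  have hs0 : 0 < poleSq X := by linarith
  set s := poleSq X with hs
  have hhalf : s ^ (-(1 / 2) : ℝ) = 1 / √s := by
    rw [Real.rpow_neg hs0.le, Real.sqrt_eq_rpow, one_div]; simp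
  have hsq : √s * √s = s := Real.mul_self_sqrt hs0.le
  have hsq1 : 1 ≤ √s := Real.one_le_sqrt.2 hs1
  have hZ : |X i - pole d i| ≤ √s := by
    rw [hs, poleSq, Real.sqrt_sq (norm_nonneg _)]
    exact PiLp.norm_apply_le (X - pole d) i
  have hE : |eval (fun i => confMap X i) (dK i P)| ≤ (2 * A + 2 * B) * s ^ (-(1 / 2) : ℝ) := by
    rw [kelD_apply]
    simp only [map_sub, map_mul, eval_shiftX hs0.ne', eval_shiftSq hs0.ne', eval_C]
    have a1 : |1 / 2 * (4 / s) * eval (fun i => confMap X i) (pderiv i P)| ≤ 2 * A * (1 / √s) := by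
      rw [abs_mul, abs_of_nonneg (by positivity)]
      have : 1 / 2 * (4 / s) ≤ 2 * (1 / √s) := by
        have hinv : 1 / s = 1 / √s * (1 / √s) := by rw [div_mul_div_comm, one_mul, hsq]
        rw [show 1 / 2 * (4 / s) = 2 * (1 / s) by ring, hinv]
        have : 1 / √s ≤ 1 := by rw [div_le_one (by positivity)]; exact hsq1
        have h0 : 0 ≤ 2 * (1 / √s) := by positivity
        nlinarith
      calc _ ≤ 2 * (1 / √s) * A := by
            gcongr
            exact hA _ (norm_confMap_le hX)
        _ = _ := by ring
    have a2 : |2 * (X i - pole d i) / s * eval (fun i => confMap X i)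
        (MvPolynomial.C (kelExp d) * P + eulerD (fun i => pole d i) P)| ≤ 2 * B * (1 / √s) := by
      rw [abs_mul, abs_div, abs_mul, abs_of_pos hs0, abs_two]
      have : 2 * |X i - pole d i| / s ≤ 2 * (1 / √s) := by
        have hdiv : 1 / √s * s = √s := by
          rw [one_div, inv_mul_eq_div, div_eq_iff (by positivity), hsq]
        rw [div_le_iff₀ hs0, mul_assoc, hdiv]
        linarith
      calc _ ≤ 2 * (1 / √s) * B := by
            gcongr
            exact hB _ (norm_confMap_le hX)
        _ = _ := by ring
    rw [hhalf]
    refine (abs_sub _ _).trans ?_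
    simp only [map_add, map_mul, eval_C] at a2 ⊢
    linarith
  rw [kel, abs_mul, stdBubble_eq, abs_mul, abs_of_nonneg (by positivity),
    abs_of_nonneg (by positivity)]
  calc (dim d - 2) ^ kelExp d * s ^ (-kelExp d) * |eval (fun i => confMap X i) (dK i P)|
      ≤ (dim d - 2) ^ kelExp d * s ^ (-kelExp d) * ((2 * A + 2 * B) * s ^ (-(1 / 2) : ℝ)) := by
        gcongr
    _ = (dim d - 2) ^ kelExp d * (2 * A + 2 * B) * s ^ (-(kelExp d + 1 / 2)) := by
        rw [neg_add, Real.rpow_add hs0]; ring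
    _ ≤ _ := by
        exact mul_le_mul_of_nonneg_left (rpow_neg_poleSq_le hX (by positivity)) (by positivity)

/-! ### Cutoff functions -/

theorem deriv_smoothTransition_eq_zero {x : ℝ} (hx : x < 0 ∨ 1 < x) :
    deriv Real.smoothTransition x = 0 := by
  rcases hx with hx | hx
  · have : Real.smoothTransition =ᶠ[𝓝 x] fun _ => 0 := by
      filter_upwards [Iio_mem_nhds hx] with y hy
      exact Real.smoothTransition.zero_of_nonpos (le_of_lt hy)
    rw [this.deriv_eq]; simp
  · have : Real.smoothTransition =ᶠ[𝓝 x] fun _ => 1 := by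
      filter_upwards [Ioi_mem_nhds hx] with y hy
      exact Real.smoothTransition.one_of_one_le (le_of_lt hy)
    rw [this.deriv_eq]; simp

theorem exists_bound_deriv_smoothTransition :
    ∃ C, 0 ≤ C ∧ ∀ x, |deriv Real.smoothTransition x| ≤ C := by
  have hc : Continuous (deriv Real.smoothTransition) :=
    (Real.smoothTransition.contDiff (n := 1)).continuous_deriv le_rfl
  obtain ⟨C, hC⟩ := (isCompact_Icc (a := (0 : ℝ)) (b := 1)).exists_bound_of_continuousOn
    hc.continuousOn
  have hC0 : 0 ≤ C := (norm_nonneg _).trans (hC 0 (by simp))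
  refine ⟨C, hC0, fun x => ?_⟩
  by_cases hx : x ∈ Set.Icc (0 : ℝ) 1
  · exact hC x hx
  · have : x < 0 ∨ 1 < x := by
      by_contra! h
      exact hx ⟨h.1, h.2⟩
    rw [deriv_smoothTransition_eq_zero this]; simpa using hC0

/-- Cutoff functions exhausting the space. -/
def cutoff (k : ℕ) (X : Rn d) : ℝ := Real.smoothTransition (2 - (1 + ‖X‖ ^ 2) / ((k : ℝ) + 1) ^ 2)

theorem contDiff_cutoff (k : ℕ) : ContDiff ℝ (⊤ : ℕ∞) (cutoff k : Rn d → ℝ) := by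
  unfold cutoff
  refine Real.smoothTransition.contDiff.comp (contDiff_const.sub (ContDiff.div_const ?_ _))
  exact contDiff_const.add (contDiff_norm_sq ℝ)

theorem hasCompactSupport_cutoff (k : ℕ) : HasCompactSupport (cutoff k : Rn d → ℝ) := by
  refine HasCompactSupport.intro (isCompact_closedBall (0 : Rn d) (2 * ((k : ℝ) + 1))) ?_
  intro X hX
  have hX' : 2 * ((k : ℝ) + 1) < ‖X‖ := by simpa using hX
  refine Real.smoothTransition.zero_of_nonpos ?_
  have hk : 0 < (k : ℝ) + 1 := by positivity
  have : 2 ≤ (1 + ‖X‖ ^ 2) / ((k : ℝ) + 1) ^ 2 := by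
    rw [le_div_iff₀ (by positivity)]; nlinarith
  linarith

theorem abs_cutoff_le (k : ℕ) (X : Rn d) : |cutoff k X| ≤ 1 := by
  unfold cutoff
  rw [abs_of_nonneg (Real.smoothTransition.nonneg _)]; exact Real.smoothTransition.le_one _

theorem eventually_cutoff_eq_one (X : Rn d) :
    ∀ᶠ k : ℕ in atTop, (cutoff k : Rn d → ℝ) =ᶠ[𝓝 X] fun _ => 1 := by
  have h : Tendsto (fun k : ℕ => ((k : ℝ) + 1) ^ 2) atTop atTop :=
    (tendsto_pow_atTop two_ne_zero).comp
      (tendsto_atTop_add_const_right _ _ tendsto_natCast_atTop_atTop)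
  filter_upwards [h.eventually_gt_atTop (1 + ‖X‖ ^ 2)] with k hk
  have hc : Continuous fun Y : Rn d => 1 + ‖Y‖ ^ 2 := by fun_prop
  filter_upwards [hc.continuousAt.eventually_lt_const hk] with Y hY
  refine Real.smoothTransition.one_of_one_le ?_
  have hk : 0 < (k : ℝ) + 1 := by positivity
  have : (1 + ‖Y‖ ^ 2) / ((k : ℝ) + 1) ^ 2 ≤ 1 := by
    rw [div_le_one (by positivity)]; exact hY.le
  linarith

/-- The bound must be uniform in k and decay like 1/|X|: then ∇(cutoff) · w is dominated by the same
L² function as ∇w. Where the derivative is nonzero, 1 + |X|² ≤ 2(k + 1)², so the factor 1/(k + 1)²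
pays for this decay. -/
theorem exists_bound_fderiv_cutoff (d : ℕ) : ∃ C, 0 ≤ C ∧ ∀ (k : ℕ) (X : Rn d) (i : Fin (d + 1)),
    |fderiv ℝ (cutoff k) X (bv i)| ≤ C * (1 + ‖X‖ ^ 2) ^ (-(1 / 2) : ℝ) := by
  obtain ⟨C, hC0, hC⟩ := exists_bound_deriv_smoothTransition
  refine ⟨4 * C, by positivity, fun k X i => ?_⟩
  set b := 1 + ‖X‖ ^ 2 with hb
  have hb0 : 0 < b := by positivity
  have hk : 0 < ((k : ℝ) + 1) ^ 2 := by positivity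
  have h1 : HasFDerivAt (fun X : Rn d => 2 - (1 + ‖X‖ ^ 2) / ((k : ℝ) + 1) ^ 2)
      (-((((k : ℝ) + 1) ^ 2)⁻¹ • (2 • innerSL ℝ X))) X := by
    have := ((((hasStrictFDerivAt_norm_sq X).hasFDerivAt).const_add 1).mul_const
      (((k : ℝ) + 1) ^ 2)⁻¹).const_sub 2
    simpa [div_eq_mul_inv] using this
  have h2 : fderiv ℝ (cutoff k) X = _ :=
    ((Real.smoothTransition.contDiff (n := 1)).differentiable one_ne_zero _).hasDerivAt
      |>.comp_hasFDerivAt X h1 |>.fderiv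
  have h3 : fderiv ℝ (cutoff k) X (bv i) = deriv Real.smoothTransition (2 - b / ((k : ℝ) + 1) ^ 2) *
      (-(2 * X i / ((k : ℝ) + 1) ^ 2)) := by
    have hin : inner ℝ X (bv i) = X i := by rw [EuclideanSpace.inner_single_right]; simp
    rw [h2]
    simp [hb, hin]
    left
    ring
  rw [h3]
  by_cases hlt : b ≤ 2 * ((k : ℝ) + 1) ^ 2
  · rw [abs_mul, abs_neg, abs_div, abs_mul, abs_two, abs_of_pos hk]
    have hsq : √b * √b = b := Real.mul_self_sqrt hb0.le
    have hhalf : b ^ (-(1 / 2) : ℝ) = 1 / √b := by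
      rw [Real.rpow_neg hb0.le, Real.sqrt_eq_rpow, one_div]; simp
    have hX : |X i| ≤ √b := by
      refine (PiLp.norm_apply_le X i).trans (Real.le_sqrt_of_sq_le ?_)
      rw [hb]; linarith
    have hs0 : 0 < √b := Real.sqrt_pos.2 hb0
    have : 2 * |X i| / ((k : ℝ) + 1) ^ 2 ≤ 4 * (1 / √b) := by
      rw [div_le_iff₀ hk]
      calc 2 * |X i| ≤ 2 * √b := by linarith
        _ = 2 * (1 / √b) * b := by
            rw [mul_assoc, one_div, inv_mul_eq_div, (div_eq_iff hs0.ne').2 hsq.symm]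
        _ ≤ 2 * (1 / √b) * (2 * ((k : ℝ) + 1) ^ 2) := by gcongr
        _ = _ := by ring
    rw [hhalf]
    calc _ ≤ C * (4 * (1 / √b)) := mul_le_mul (hC _) this (by positivity) hC0
      _ = _ := by ring
  · have : 2 - b / ((k : ℝ) + 1) ^ 2 < 0 := by
      have : 2 < b / ((k : ℝ) + 1) ^ 2 := by
        rw [lt_div_iff₀ hk]; exact not_le.1 hlt
      linarith
    rw [deriv_smoothTransition_eq_zero (Or.inl this)]
    simp
    positivity

end Decay

/-! ### Kelvin transforms belong to H¹ -/

section Approximation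

open MvPolynomial

variable {d : ℕ}

/-- A smooth function that is `1` near the closed half-space and `0` near the pole. -/
def vertCut (X : Rn d) : ℝ := Real.smoothTransition (4 * vert X + 3)

theorem contDiff_vert {n : WithTop ℕ∞} : ContDiff ℝ n (vert : Rn d → ℝ) :=
  (EuclideanSpace.proj (𝕜 := ℝ) (Fin.last d)).contDiff

theorem contDiff_vertCut : ContDiff ℝ (⊤ : ℕ∞) (vertCut : Rn d → ℝ) := by
  unfold vertCut
  exact Real.smoothTransition.contDiff.comp ((contDiff_const.mul contDiff_vert).add contDiff_const)

theorem vertCut_eq_one {X : Rn d} (h : -(1 / 2) ≤ vert X) : vertCut X = 1 :=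
  Real.smoothTransition.one_of_one_le (by linarith)

/-- The Kelvin transform, smoothly modified away from the half-space. -/
def kelS (P : MvPolynomial (Fin (d + 1)) ℝ) (X : Rn d) : ℝ := vertCut X * kel P X

theorem kelS_eq {X : Rn d} (h : -(1 / 2) ≤ vert X) (P : MvPolynomial (Fin (d + 1)) ℝ) :
    kelS P X = kel P X := by
  rw [kelS, vertCut_eq_one h, one_mul]

theorem contDiff_kelS (P : MvPolynomial (Fin (d + 1)) ℝ) :
    ContDiff ℝ (⊤ : ℕ∞) (kelS P : Rn d → ℝ) := by
  rw [contDiff_iff_contDiffAt]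
  intro X
  by_cases h : -1 < vert X
  · exact contDiff_vertCut.contDiffAt.mul (contDiffAt_kel (poleSq_pos_of_vert h).ne' P)
  -- The argument 4t + 3 of the cutoff is negative for t < -3/4, so the pole and everything below it
  -- have a neighbourhood where the product vanishes.
  · have hX : vert X < -(3 / 4) := by linarith
    have : kelS P =ᶠ[𝓝 X] fun _ => (0 : ℝ) := by
      filter_upwards [continuous_vert.continuousAt.eventually_lt_const hX] with Y hY
      rw [kelS, vertCut, Real.smoothTransition.zero_of_nonpos (by linarith), zero_mul]
    exact contDiffAt_const.congr_of_eventuallyEq this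

theorem fderiv_kelS {X : Rn d} (h : 0 ≤ vert X) (P : MvPolynomial (Fin (d + 1)) ℝ)
    (i : Fin (d + 1)) : fderiv ℝ (kelS P) X (bv i) = kel (dK i P) X := by
  rw [← fderiv_kel (poleSq_pos_of_vert (by linarith)).ne']
  congr 1
  refine Filter.EventuallyEq.fderiv_eq ?_
  have hX : -(1 / 2) < vert X := by linarith
  filter_upwards [continuous_vert.continuousAt.eventually_const_lt hX] with Y hY
  exact kelS_eq hY.le P

/-- The gradient of the Kelvin transform. -/
def gradKel (P : MvPolynomial (Fin (d + 1)) ℝ) (X : Rn d) : Rn d :=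
  WithLp.toLp 2 fun i => kel (dK i P) X

@[simp] theorem gradKel_apply (P : MvPolynomial (Fin (d + 1)) ℝ) (X : Rn d) (i : Fin (d + 1)) :
    gradKel P X i = kel (dK i P) X := rfl

theorem norm_le_sum_abs (v : Rn d) : ‖v‖ ≤ ∑ i, |v i| := by
  have h : v = ∑ i, v i • bv i := by
    simpa using ((EuclideanSpace.basisFun (Fin (d + 1)) ℝ).sum_repr v).symm
  conv_lhs => rw [h]
  refine (norm_sum_le _ _).trans (Finset.sum_le_sum fun i _ => ?_)
  rw [norm_smul]
  simp

theorem ae_halfVol_vert : ∀ᵐ X ∂(halfVol d), 0 < vert X :=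
  ae_restrict_mem measurableSet_halfSpace

theorem aestronglyMeasurable_kel (P : MvPolynomial (Fin (d + 1)) ℝ) :
    AEStronglyMeasurable (kel P) (halfVol d) := by
  refine (contDiff_kelS P).continuous.aestronglyMeasurable.congr ?_
  filter_upwards [ae_halfVol_vert] with X hX
  exact kelS_eq (by linarith) P

theorem aestronglyMeasurable_gradKel (P : MvPolynomial (Fin (d + 1)) ℝ) :
    AEStronglyMeasurable (gradKel P) (halfVol d) := by
  have hc : Continuous fun X : Rn d => (WithLp.toLp 2 fun i => kelS (dK i P) X : Rn d) :=
    (PiLp.continuous_toLp 2 _).comp (continuous_pi fun i => (contDiff_kelS (dK i P)).continuous)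
  refine hc.aestronglyMeasurable.congr ?_
  filter_upwards [ae_halfVol_vert] with X hX
  ext i
  exact kelS_eq (by linarith) _

theorem exists_bound_gradKel (hd : 2 ≤ d) (P : MvPolynomial (Fin (d + 1)) ℝ) :
    ∃ C, 0 ≤ C ∧ ∀ X : Rn d, 0 ≤ vert X →
      ‖gradKel P X‖ ≤ C * (1 + ‖X‖ ^ 2) ^ (-(kelExp d + 1 / 2)) := by
  choose C hC0 hC using exists_bound_kel_dK hd P
  refine ⟨∑ i, C i, Finset.sum_nonneg fun i _ => hC0 i, fun X hX => ?_⟩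
  refine (norm_le_sum_abs _).trans ?_
  rw [Finset.sum_mul]
  exact Finset.sum_le_sum fun i _ => hC i X hX

/-- Exponent count: 2 · (n-2)/2 · 2n/(n-2) = 2n > n. -/
theorem memLp_decay_sob (hd : 2 ≤ d) :
    MemLp (fun X : Rn d => (1 + ‖X‖ ^ 2) ^ (-kelExp d)) (sobExp d) (halfVol d) := by
  refine (memLp_one_add_norm_sq_rpow volume (sobExp_ne_zero hd) sobExp_ne_top ?_).mono_measure
    Measure.restrict_le_self
  have := three_le_dim hd
  rw [sobExp_toReal hd, finrank_euclideanSpace, Fintype.card_fin, kelExp, pExp]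
  have h0 : dim d - 2 ≠ 0 := by linarith
  have : 2 * ((dim d - 2) / 2) * (2 * (dim d / (dim d - 2))) = 2 * dim d := by field_simp
  rw [this]
  have : ((d + 1 : ℕ) : ℝ) = dim d := by simp [dim]
  rw [this]; linarith

/-- Exponent count: 2 · (n-1)/2 · 2 = 2(n - 1) > n, because n ≥ 3. -/
theorem memLp_decay_two (hd : 2 ≤ d) :
    MemLp (fun X : Rn d => (1 + ‖X‖ ^ 2) ^ (-(kelExp d + 1 / 2))) 2 (halfVol d) := by
  refine (memLp_one_add_norm_sq_rpow volume two_ne_zero ENNReal.ofNat_ne_top ?_).mono_measure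
    Measure.restrict_le_self
  have := three_le_dim hd
  rw [finrank_euclideanSpace, Fintype.card_fin, kelExp, ENNReal.toReal_ofNat]
  have : ((d + 1 : ℕ) : ℝ) = dim d := by simp [dim]
  rw [this]; linarith

theorem memLp_kel (hd : 2 ≤ d) (P : MvPolynomial (Fin (d + 1)) ℝ) :
    MemLp (kel P) (sobExp d) (halfVol d) := by
  obtain ⟨C, _, hC⟩ := exists_bound_kel hd P
  refine (memLp_decay_sob hd).of_le_mul (c := C) (aestronglyMeasurable_kel P) ?_
  filter_upwards [ae_halfVol_vert] with X hX
  rw [Real.norm_of_nonneg (by positivity : 0 ≤ (1 + ‖X‖ ^ 2) ^ (-kelExp d))]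
  exact hC X hX.le

theorem memLp_gradKel (hd : 2 ≤ d) (P : MvPolynomial (Fin (d + 1)) ℝ) :
    MemLp (gradKel P) 2 (halfVol d) := by
  obtain ⟨C, _, hC⟩ := exists_bound_gradKel hd P
  refine (memLp_decay_two hd).of_le_mul (c := C) (aestronglyMeasurable_gradKel P) ?_
  filter_upwards [ae_halfVol_vert] with X hX
  rw [Real.norm_of_nonneg (by positivity : 0 ≤ (1 + ‖X‖ ^ 2) ^ (-(kelExp d + 1 / 2)))]
  exact hC X hX.le

/-- Test functions that converge to the Kelvin transform. -/
def kelApprox (P : MvPolynomial (Fin (d + 1)) ℝ) (k : ℕ) (X : Rn d) : ℝ := cutoff k X * kelS P X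

theorem fderiv_kelApprox {X : Rn d} (h : 0 ≤ vert X) (P : MvPolynomial (Fin (d + 1)) ℝ) (k : ℕ)
    (i : Fin (d + 1)) : fderiv ℝ (kelApprox P k) X (bv i) =
      fderiv ℝ (cutoff k) X (bv i) * kel P X + cutoff k X * kel (dK i P) X := by
  have h1 : DifferentiableAt ℝ (cutoff k : Rn d → ℝ) X :=
    (contDiff_cutoff k).contDiffAt.differentiableAt (by simp)
  have h2 : DifferentiableAt ℝ (kelS P : Rn d → ℝ) X :=
    (contDiff_kelS P).contDiffAt.differentiableAt (by simp)
  have h3 : fderiv ℝ (kelApprox P k) X = _ := fderiv_fun_mul h1 h2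
  rw [h3]
  simp only [add_apply, smul_apply, smul_eq_mul, fderiv_kelS h,
    kelS_eq (by linarith : -(1 / 2) ≤ vert X) P]
  ring

theorem isApprox_kelApprox (hd : 2 ≤ d) (P : MvPolynomial (Fin (d + 1)) ℝ) :
    IsApprox (kelApprox P) (kel P) (gradKel P) where
  smooth k := (contDiff_cutoff k).mul (contDiff_kelS P)
  compact k := (hasCompactSupport_cutoff k).mul_right
  memLp_fun := memLp_kel hd P
  memLp_grad := memLp_gradKel hd P
  tendsto_fun := by
    obtain ⟨C, _, hC⟩ := exists_bound_kel hd P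
    refine tendsto_eLpNorm_zero_of_dominated (sobExp_ne_zero hd) sobExp_ne_top
      (g := fun X => 2 * C * (1 + ‖X‖ ^ 2) ^ (-kelExp d)) ?_
      ((memLp_decay_sob hd).const_mul _) ?_ ?_
    · intro k
      exact ((contDiff_cutoff k).mul (contDiff_kelS P)).continuous.aestronglyMeasurable.sub
        (aestronglyMeasurable_kel P)
    · intro k
      filter_upwards [ae_halfVol_vert] with X hX
      rw [kelApprox, kelS_eq (by linarith)]
      have h1 := abs_cutoff_le k X
      have h2 := hC X hX.le
      calc ‖cutoff k X * kel P X - kel P X‖ ≤ |cutoff k X * kel P X| + |kel P X| := abs_sub _ _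
        _ ≤ 1 * |kel P X| + |kel P X| := by rw [abs_mul]; gcongr
        _ ≤ _ := by linarith
    · filter_upwards [ae_halfVol_vert] with X hX
      refine tendsto_const_nhds.congr' ?_
      filter_upwards [eventually_cutoff_eq_one X] with k hk
      rw [kelApprox, kelS_eq (by linarith), hk.eq_of_nhds]
      ring
  tendsto_grad := by
    obtain ⟨C, hC0, hC⟩ := exists_bound_kel hd P
    choose D hD0 hD using exists_bound_kel_dK hd P
    obtain ⟨A, hA0, hA⟩ := exists_bound_fderiv_cutoff d
    refine tendsto_eLpNorm_zero_of_dominated two_ne_zero ENNReal.ofNat_ne_top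
      (g := fun X => (∑ i, (A * C + 2 * D i)) * (1 + ‖X‖ ^ 2) ^ (-(kelExp d + 1 / 2))) ?_
      ((memLp_decay_two hd).const_mul _) ?_ ?_
    · intro k
      refine (continuous_gradient ?_).aestronglyMeasurable.sub (aestronglyMeasurable_gradKel P)
      exact ((contDiff_cutoff k).mul (contDiff_kelS P)).of_le (by exact_mod_cast le_top)
    · intro k
      filter_upwards [ae_halfVol_vert] with X hX
      refine (norm_le_sum_abs _).trans ?_
      rw [Finset.sum_mul]
      refine Finset.sum_le_sum fun i _ => ?_
      rw [PiLp.sub_apply, gradient_apply, gradKel_apply, fderiv_kelApprox hX.le]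
      have h1 := abs_cutoff_le k X
      have h2 := hC X hX.le
      have h3 := hD i X hX.le
      have h4 := hA k X i
      set b := 1 + ‖X‖ ^ 2
      have hb : 0 < b := by positivity
      have hsplit : b ^ (-(kelExp d + 1 / 2)) = b ^ (-(1 / 2) : ℝ) * b ^ (-kelExp d) := by
        rw [← Real.rpow_add hb]; congr 1; ring
      calc |fderiv ℝ (cutoff k) X (bv i) * kel P X + cutoff k X * kel (dK i P) X
            - kel (dK i P) X|
          ≤ |fderiv ℝ (cutoff k) X (bv i) * kel P X| + |cutoff k X * kel (dK i P) X|
            + |kel (dK i P) X| := (abs_sub _ _).trans (by gcongr; exact abs_add_le _ _)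
        _ ≤ (A * b ^ (-(1 / 2) : ℝ)) * (C * b ^ (-kelExp d)) + 1 * |kel (dK i P) X|
            + |kel (dK i P) X| := by
            rw [abs_mul, abs_mul]
            gcongr
        _ ≤ (A * b ^ (-(1 / 2) : ℝ)) * (C * b ^ (-kelExp d))
            + 2 * (D i * b ^ (-(kelExp d + 1 / 2))) := by linarith
        _ = _ := by rw [hsplit]; ring
    · filter_upwards [ae_halfVol_vert] with X hX
      refine tendsto_const_nhds.congr' ?_
      filter_upwards [eventually_cutoff_eq_one X] with k hk
      symm
      ext i
      rw [PiLp.sub_apply, gradient_apply, gradKel_apply, fderiv_kelApprox hX.le, hk.eq_of_nhds,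
        hk.fderiv_eq]
      simp

theorem hasGrad_kel (hd : 2 ≤ d) (P : MvPolynomial (Fin (d + 1)) ℝ) :
    HasGrad (kel P) (gradKel P) := ⟨_, isApprox_kelApprox hd P⟩

/-! ### Green's formula -/

theorem inner_eq_sum (v w : Rn d) : inner ℝ v w = ∑ i, v i * w i := by
  rw [PiLp.inner_apply]
  refine Finset.sum_congr rfl fun i _ => ?_
  simp [mul_comm]

/-- Apply the divergence theorem to φ∇w, w = `kel P`. Its divergence is ∇φ·∇w as w is harmonic, and
the Steklov condition evaluates the boundary flux. `kelS` replaces w to make the field smooth on the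
whole space. -/
theorem green_test (hd : 2 ≤ d) {k : ℕ} {P : MvPolynomial (Fin (d + 1)) ℝ}
    (hP : P ∈ homHarm _ k) {φ : Rn d → ℝ} (hφ : ContDiff ℝ 1 φ) (hc : HasCompactSupport φ) :
    ∫ X, inner ℝ (gradient φ X) (gradKel P X) ∂(halfVol d) = eig d k *
      ∫ x : Bd d, φ (pt x 0) * (stdBubble d (pt x 0) ^ (pExp d - 1) * kel P (pt x 0)) := by
  obtain ⟨hhom, hlap⟩ := mem_homHarm.1 hP
  set f : Fin (d + 1) → Rn d → ℝ := fun i X => φ X * kelS (dK i P) X with hf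
  have hk1 : ∀ Q : MvPolynomial (Fin (d + 1)) ℝ, ContDiff ℝ 1 (kelS Q : Rn d → ℝ) :=
    fun Q => (contDiff_kelS Q).of_le (by exact_mod_cast le_top)
  have hf1 : ∀ i, ContDiff ℝ 1 (f i) := fun i => hφ.mul (hk1 _)
  have hfc : ∀ i, HasCompactSupport (f i) := fun i => hc.mul_right
  have hpt : ∀ᵐ X ∂(halfVol d), inner ℝ (gradient φ X) (gradKel P X) =
      ∑ i, fderiv ℝ (f i) X (bv i) := by
    filter_upwards [ae_halfVol_vert] with X hX
    have hder : ∀ i, fderiv ℝ (f i) X (bv i) =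
        fderiv ℝ φ X (bv i) * kel (dK i P) X + φ X * kel (dK i (dK i P)) X := by
      intro i
      have h3 : fderiv ℝ (f i) X = _ := fderiv_fun_mul (hφ.differentiable one_ne_zero X)
        ((hk1 (dK i P)).differentiable one_ne_zero X)
      rw [h3]
      simp only [add_apply, smul_apply, smul_eq_mul, fderiv_kelS hX.le,
        kelS_eq (by linarith : -(1 / 2) ≤ vert X)]
      ring
    simp only [hder, Finset.sum_add_distrib, ← Finset.mul_sum, sum_kel_dK_dK hlap, mul_zero,
      add_zero, inner_eq_sum, gradient_apply, gradKel_apply]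
  rw [integral_congr_ae hpt, integral_finsetSum _ fun i _ =>
    integrable_halfVol_of_hasCompactSupport (continuous_fderiv_apply (hf1 i) _)
      (hasCompactSupport_fderiv_apply (hfc i) _), Fin.sum_univ_castSucc]
  simp only [integral_halfVol_fderiv_castSucc (hf1 _) (hfc _),
    integral_halfVol_fderiv_last (hf1 _) (hfc _), Finset.sum_const_zero, zero_add]
  rw [← integral_const_mul, ← integral_neg]
  refine integral_congr_ae (Eventually.of_forall fun x => ?_)
  simp only [hf]
  rw [kelS_eq (by simp), kel_dK_last_boundary hd hhom]
  ring

end Approximation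

/-! ### The weighted boundary space and Green's formula in H¹ -/

section Boundary

open MvPolynomial

variable {d : ℕ}

theorem norm_pt_zero (x : Bd d) : ‖pt x 0‖ = ‖x‖ := by
  have := norm_sq_pt x 0
  exact (sq_eq_sq₀ (norm_nonneg _) (norm_nonneg _)).1 (by rw [this]; simp)

theorem poleSq_boundary (x : Bd d) : poleSq (pt x 0) = 1 + ‖x‖ ^ 2 := by
  rw [poleSq_eq_norm, norm_pt_zero, vert_pt]; ring

theorem poleSq_boundary_ne (x : Bd d) : poleSq (pt x 0) ≠ 0 := by
  rw [poleSq_boundary]; positivity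

/-- The square root of the boundary weight `U^{p-1}`. -/
def bdWeight (d : ℕ) (x : Bd d) : ℝ := √(dim d - 2) * (1 + ‖x‖ ^ 2) ^ (-(1 / 2) : ℝ)

theorem bdWeight_pos (hd : 2 ≤ d) (x : Bd d) : 0 < bdWeight d x := by
  have h3 : 0 < dim d - 2 := by linarith [three_le_dim hd]
  unfold bdWeight; positivity

theorem continuous_bdWeight : Continuous (bdWeight d) := by
  unfold bdWeight
  exact continuous_const.mul (Continuous.rpow_const (by fun_prop) fun x => Or.inl (by positivity))

theorem bdWeight_mul_self (hd : 2 ≤ d) (x : Bd d) :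
    bdWeight d x * bdWeight d x = stdBubble d (pt x 0) ^ (pExp d - 1) := by
  have h3 : 0 ≤ dim d - 2 := by linarith [three_le_dim hd]
  rw [stdBubble_rpow hd, poleSq_boundary, bdWeight, mul_mul_mul_comm, Real.mul_self_sqrt h3,
    ← Real.rpow_add (by positivity), show (-(1 / 2) : ℝ) + -(1 / 2) = -1 by norm_num,
    Real.rpow_neg_one]
  exact (div_eq_mul_inv _ _).symm

theorem continuous_kel_boundary (P : MvPolynomial (Fin (d + 1)) ℝ) :
    Continuous fun x : Bd d => kel P (pt x 0) := by
  have h : (fun x : Bd d => kel P (pt x 0)) = fun x => kelS P (bdL d x) := by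
    funext x
    rw [bdL_apply, kelS_eq (by simp)]
  rw [h]
  exact (contDiff_kelS P).continuous.comp (bdL d).continuous

/-- The weighted boundary values of a Kelvin transform. -/
def bdKel (P : MvPolynomial (Fin (d + 1)) ℝ) (x : Bd d) : ℝ := bdWeight d x * kel P (pt x 0)

theorem continuous_bdKel (P : MvPolynomial (Fin (d + 1)) ℝ) : Continuous (bdKel P : Bd d → ℝ) :=
  continuous_bdWeight.mul (continuous_kel_boundary P)

theorem memLp_bdKel (hd : 2 ≤ d) (P : MvPolynomial (Fin (d + 1)) ℝ) :
    MemLp (bdKel P : Bd d → ℝ) 2 volume := by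
  obtain ⟨C, _, hC⟩ := exists_bound_kel hd P
  have hdec : MemLp (fun x : Bd d => (1 + ‖x‖ ^ 2) ^ (-(kelExp d + 1 / 2))) 2 volume := by
    refine memLp_one_add_norm_sq_rpow volume two_ne_zero ENNReal.ofNat_ne_top ?_
    rw [finrank_euclideanSpace, Fintype.card_fin, kelExp, ENNReal.toReal_ofNat]
    have : (2 : ℝ) ≤ d := by exact_mod_cast hd
    unfold dim; linarith
  refine hdec.of_le_mul (c := √(dim d - 2) * C) (continuous_bdKel P).aestronglyMeasurable
    (Eventually.of_forall fun x => ?_)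
  have h1 := hC (pt x 0) (by simp)
  rw [norm_pt_zero] at h1
  have hb : 0 < 1 + ‖x‖ ^ 2 := by positivity
  rw [bdKel, norm_mul, Real.norm_of_nonneg (bdWeight_pos hd x).le, bdWeight,
    Real.norm_of_nonneg (Real.rpow_nonneg hb.le _), neg_add, Real.rpow_add hb, Real.norm_eq_abs]
  calc _ ≤ √(dim d - 2) * (1 + ‖x‖ ^ 2) ^ (-(1 / 2) : ℝ) * (C * (1 + ‖x‖ ^ 2) ^ (-kelExp d)) := by
        gcongr
    _ = _ := by ring

/-- With d = n - 1: 1/(2d) + (d - 1)/(2d) = 1/2. Thus a weight in L^{2d} times a trace in L^{2†} is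
square integrable, which is why the right-hand integral of the theorem is finite. -/
theorem holderTriple_weight (hd : 2 ≤ d) :
    ENNReal.HolderTriple (ENNReal.ofReal (2 * d)) (traceExp d) 2 := by
  have h2 : (2 : ℝ) ≤ d := by exact_mod_cast hd
  refine ⟨?_⟩
  have hq : 0 < 2 * (dim d - 1) / (dim d - 2) := by
    unfold dim; exact div_pos (by linarith) (by linarith)
  rw [traceExp, ← ENNReal.ofReal_inv_of_pos (by linarith), ← ENNReal.ofReal_inv_of_pos hq,
    ← ENNReal.ofReal_add (by positivity) (by positivity), ← ENNReal.ofReal_ofNat 2,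
    ← ENNReal.ofReal_inv_of_pos (by norm_num)]
  congr 1
  unfold dim
  have : (d : ℝ) - 1 ≠ 0 := by linarith
  have h' : (d : ℝ) + 1 - 2 = d - 1 := by ring
  rw [h', add_sub_cancel_right]
  field_simp
  ring

theorem memLp_bdWeight (hd : 2 ≤ d) : MemLp (bdWeight d) (ENNReal.ofReal (2 * d)) volume := by
  have h2 : (2 : ℝ) ≤ d := by exact_mod_cast hd
  have hdec : MemLp (fun x : Bd d => (1 + ‖x‖ ^ 2) ^ (-(1 / 2) : ℝ)) (ENNReal.ofReal (2 * d))
      volume := by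
    refine memLp_one_add_norm_sq_rpow volume ?_ ENNReal.ofReal_ne_top ?_
    · rw [Ne, ENNReal.ofReal_eq_zero]; linarith
    · rw [finrank_euclideanSpace, Fintype.card_fin, ENNReal.toReal_ofReal (by linarith)]; linarith
  exact hdec.const_mul _

theorem memLp_bdWeight_mul (hd : 2 ≤ d) {τ : Bd d → ℝ} (hτ : MemLp τ (traceExp d) volume) :
    MemLp (fun x => bdWeight d x * τ x) 2 volume := by
  have := holderTriple_weight hd
  exact hτ.mul (memLp_bdWeight hd)

theorem holderConjugate_trace (hd : 2 ≤ d) :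
    (traceExp d).HolderConjugate (ENNReal.ofReal (2 * d / (d + 1))) := by
  have h2 : (2 : ℝ) ≤ d := by exact_mod_cast hd
  refine ⟨?_⟩
  have hq : 0 < 2 * (dim d - 1) / (dim d - 2) := by
    unfold dim; exact div_pos (by linarith) (by linarith)
  rw [traceExp, ← ENNReal.ofReal_inv_of_pos hq, ← ENNReal.ofReal_inv_of_pos (by positivity),
    ← ENNReal.ofReal_add (by positivity) (by positivity), inv_one, ← ENNReal.ofReal_one]
  congr 1
  unfold dim
  have : (d : ℝ) - 1 ≠ 0 := by linarith
  have h' : (d : ℝ) + 1 - 2 = d - 1 := by ring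
  rw [h', add_sub_cancel_right]
  field_simp
  ring

/-- The exponent is conjugate to 2†, so integrals against this function pass to the limit along the
boundary values that define a trace. -/
theorem memLp_weight_kel (hd : 2 ≤ d) (P : MvPolynomial (Fin (d + 1)) ℝ) :
    MemLp (fun x : Bd d => stdBubble d (pt x 0) ^ (pExp d - 1) * kel P (pt x 0))
      (ENNReal.ofReal (2 * d / (d + 1))) volume := by
  have h2 : (2 : ℝ) ≤ d := by exact_mod_cast hd
  obtain ⟨C, _, hC⟩ := exists_bound_kel hd P
  have hdec : MemLp (fun x : Bd d => (1 + ‖x‖ ^ 2) ^ (-(kelExp d + 1)))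
      (ENNReal.ofReal (2 * d / (d + 1))) volume := by
    refine memLp_one_add_norm_sq_rpow volume ?_ ENNReal.ofReal_ne_top ?_
    · rw [Ne, ENNReal.ofReal_eq_zero, not_le]; positivity
    · rw [finrank_euclideanSpace, Fintype.card_fin, ENNReal.toReal_ofReal (by positivity), kelExp,
        dim]
      have : 2 * (((d : ℝ) + 1 - 2) / 2 + 1) * (2 * d / (d + 1)) = 2 * d := by field_simp; ring
      rw [this]; linarith
  have hw : (fun x : Bd d => stdBubble d (pt x 0) ^ (pExp d - 1) * kel P (pt x 0)) =
      fun x => bdWeight d x * bdKel P x := by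
    funext x
    rw [← bdWeight_mul_self hd, bdKel, mul_assoc]
  refine hdec.of_le_mul (c := (dim d - 2) * C) ?_ (Eventually.of_forall fun x => ?_)
  · rw [hw]
    exact (continuous_bdWeight.mul (continuous_bdKel P)).aestronglyMeasurable
  · have h1 := hC (pt x 0) (by simp)
    rw [norm_pt_zero] at h1
    have h3 : 0 ≤ dim d - 2 := by linarith [three_le_dim hd]
    have hb : 0 < 1 + ‖x‖ ^ 2 := by positivity
    rw [stdBubble_rpow hd, poleSq_boundary, norm_mul,
      Real.norm_of_nonneg (show 0 ≤ (dim d - 2) / (1 + ‖x‖ ^ 2) by positivity),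
      Real.norm_of_nonneg (Real.rpow_nonneg hb.le _), neg_add, Real.rpow_add hb, Real.rpow_neg_one,
      Real.norm_eq_abs]
    calc _ ≤ (dim d - 2) / (1 + ‖x‖ ^ 2) * (C * (1 + ‖x‖ ^ 2) ^ (-kelExp d)) := by
          gcongr
      _ = _ := by ring

variable {φ : ℕ → Rn d → ℝ} {u : Rn d → ℝ} {G : Rn d → Rn d}

theorem integrable_coord_mul {μ : Measure (Rn d)} {G' : Rn d → Rn d} (hG : MemLp G 2 μ)
    (hG' : MemLp G' 2 μ) (i : Fin (d + 1)) : Integrable (fun X => G X i * G' X i) μ :=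
  (memLp_coord hG i).integrable_mul (memLp_coord hG' i)

theorem integral_inner_eq_sum {μ : Measure (Rn d)} {G' : Rn d → Rn d} (hG : MemLp G 2 μ)
    (hG' : MemLp G' 2 μ) : ∫ X, inner ℝ (G X) (G' X) ∂μ = ∑ i, ∫ X, G X i * G' X i ∂μ := by
  simp only [inner_eq_sum]
  exact integral_finsetSum _ fun i _ => integrable_coord_mul hG hG' i

theorem IsApprox.tendsto_inner (h : IsApprox φ u G) {G' : Rn d → Rn d}
    (hG' : MemLp G' 2 (halfVol d)) :
    Tendsto (fun k => ∫ X, inner ℝ (gradient (φ k) X) (G' X) ∂(halfVol d)) atTop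
      (𝓝 (∫ X, inner ℝ (G X) (G' X) ∂(halfVol d))) := by
  have hg : ∀ k, MemLp (gradient (φ k)) 2 (halfVol d) := fun k =>
    memLp_halfVol (continuous_gradient (h.contDiff_one k))
      (hasCompactSupport_gradient (h.compact k)) 2
  simp only [integral_inner_eq_sum (hg _) hG', integral_inner_eq_sum h.memLp_grad hG']
  refine tendsto_finsetSum _ fun i _ => ?_
  refine tendsto_integral_mul (p := 2) (q := 2) (fun k => memLp_coord (hg k) i)
    (memLp_coord h.memLp_grad i) (memLp_coord hG' i) ?_
  simpa only [gradient_apply] using h.tendsto_fderiv i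

theorem IsApprox.green (hd : 2 ≤ d) (h : IsApprox φ u G) {k : ℕ}
    {P : MvPolynomial (Fin (d + 1)) ℝ} (hP : P ∈ homHarm _ k) {L : ℝ}
    (hL : Tendsto (fun j => ∫ x : Bd d, φ j (pt x 0) *
      (stdBubble d (pt x 0) ^ (pExp d - 1) * kel P (pt x 0))) atTop (𝓝 L)) :
    ∫ X, inner ℝ (G X) (gradKel P X) ∂(halfVol d) = eig d k * L := by
  have h1 := h.tendsto_inner (memLp_gradKel hd P)
  simp only [green_test hd hP (h.contDiff_one _) (h.compact _)] at h1
  exact tendsto_nhds_unique h1 (hL.const_mul _)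

theorem green_trace (hd : 2 ≤ d) {τ : Bd d → ℝ} (hτ : HasTrace u τ) (hG : HasGrad u G) {k : ℕ}
    {P : MvPolynomial (Fin (d + 1)) ℝ} (hP : P ∈ homHarm _ k) :
    ∫ X, inner ℝ (G X) (gradKel P X) ∂(halfVol d) =
      eig d k * ∫ x : Bd d, (bdWeight d x * τ x) * bdKel P x := by
  obtain ⟨hτp, φ, G', hφ, hlim⟩ := hτ
  have hGG : G =ᵐ[halfVol d] G' := hG.ae_unique hd ⟨φ, hφ⟩ EventuallyEq.rfl
  have hconj := holderConjugate_trace hd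
  have e1 : ∫ X, inner ℝ (G X) (gradKel P X) ∂(halfVol d) =
      ∫ X, inner ℝ (G' X) (gradKel P X) ∂(halfVol d) := by
    refine integral_congr_ae ?_
    filter_upwards [hGG] with X hX
    rw [hX]
  rw [e1]
  have hL := tendsto_integral_mul (p := traceExp d) (q := ENNReal.ofReal (2 * d / (d + 1)))
    (fun k => ((hφ.smooth k).continuous.comp (bdL d).continuous).memLp_of_hasCompactSupport
      (hasCompactSupport_comp_pt (hφ.compact k) 0)) hτp (memLp_weight_kel hd P) hlim
  rw [hφ.green hd hP hL]
  congr 1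
  refine integral_congr_ae (Eventually.of_forall fun x => ?_)
  simp only [bdKel]
  rw [← bdWeight_mul_self hd]
  ring

/-- The boundary values of the approximating functions are explicit here, so dominated convergence
replaces the trace and `trace (kel Q)` need not be identified. Q is arbitrary; only P has to be
harmonic and homogeneous. -/
theorem green_kel (hd : 2 ≤ d) (Q : MvPolynomial (Fin (d + 1)) ℝ) {k : ℕ}
    {P : MvPolynomial (Fin (d + 1)) ℝ} (hP : P ∈ homHarm _ k) :
    ∫ X, inner ℝ (gradKel Q X) (gradKel P X) ∂(halfVol d) =
      eig d k * ∫ x : Bd d, bdKel Q x * bdKel P x := by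
  refine (isApprox_kelApprox hd Q).green hd hP ?_
  have e : ∀ j (x : Bd d), kelApprox Q j (pt x 0) *
      (stdBubble d (pt x 0) ^ (pExp d - 1) * kel P (pt x 0)) =
      cutoff j (pt x 0) * (bdKel Q x * bdKel P x) := by
    intro j x
    rw [kelApprox, kelS_eq (by simp), bdKel, bdKel, ← bdWeight_mul_self hd]
    ring
  simp only [e]
  have hint : Integrable (fun x : Bd d => bdKel Q x * bdKel P x) volume :=
    (memLp_bdKel hd Q).integrable_mul (memLp_bdKel hd P)
  refine tendsto_integral_of_dominated_convergence (fun x => ‖bdKel Q x * bdKel P x‖) ?_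
    hint.norm ?_ ?_
  · intro j
    exact (((contDiff_cutoff j).continuous.comp (bdL d).continuous).mul
      ((continuous_bdKel Q).mul (continuous_bdKel P))).aestronglyMeasurable
  · intro j
    refine Eventually.of_forall fun x => ?_
    rw [norm_mul]
    exact mul_le_of_le_one_left (norm_nonneg _) (abs_cutoff_le j _)
  · refine Eventually.of_forall fun x => tendsto_const_nhds.congr' ?_
    filter_upwards [eventually_cutoff_eq_one (pt x 0)] with j hj
    rw [hj.eq_of_nhds, one_mul]

end Boundary

/-! ### Density of the boundary values -/

section Density

open MvPolynomial

variable {d : ℕ}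

/-- Stone–Weierstrass: the coordinate functions separate the points of the sphere. -/
theorem exists_polynomial_near_on_sphere {H : Rn d → ℝ}
    (hH : ContinuousOn H (Metric.sphere (0 : Rn d) 1)) {ε : ℝ} (hε : 0 < ε) :
    ∃ P : MvPolynomial (Fin (d + 1)) ℝ, ∀ y : Rn d, ‖y‖ = 1 →
      |eval (fun i => y i) P - H y| < ε := by
  let S := Metric.sphere (0 : Rn d) 1
  let c : Fin (d + 1) → C(S, ℝ) := fun i => ⟨fun y => y.1 i, by fun_prop⟩
  let A : Subalgebra ℝ C(S, ℝ) := (aeval c).range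
  have hA : A.SeparatesPoints := by
    intro y z hyz
    have : ∃ i, y.1 i ≠ z.1 i := by
      by_contra! h
      exact hyz (Subtype.ext (by ext i; exact h i))
    obtain ⟨i, hi⟩ := this
    exact ⟨c i, ⟨c i, ⟨X i, by simp⟩, rfl⟩, hi⟩
  obtain ⟨⟨_, P, rfl⟩, hg⟩ :=
    ContinuousMap.exists_mem_subalgebra_near_continuous_of_separatesPoints A hA
      (S.domRestrict H) hH.domRestrict ε hε
  refine ⟨P, fun y hy => ?_⟩
  have hyS : y ∈ S := mem_sphere_zero_iff_norm.2 hy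
  have h := hg ⟨y, hyS⟩
  have e : ∀ (Q : MvPolynomial (Fin (d + 1)) ℝ) (z : S),
      (aeval c Q) z = eval (fun i => z.1 i) Q := by
    intro Q z
    induction Q using MvPolynomial.induction_on with
    | C a => simp
    | add p q hp hq => simp [hp, hq]
    | mul_X p i hp => simp [hp, c]
  rw [← e P ⟨y, hyS⟩]
  exact h

theorem continuousAt_confMap {y : Rn d} (h : poleSq y ≠ 0) : ContinuousAt confMap y := by
  have h1 : ContinuousAt (fun X : Rn d => pole d + (2 / poleSq X) • (X - pole d)) y := by
    have : ContinuousAt (poleSq : Rn d → ℝ) y := (contDiff_poleSq (n := 0)).continuous.continuousAt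
    exact continuousAt_const.add ((continuousAt_const.div this h).smul
      (continuousAt_id.sub continuousAt_const))
  refine h1.congr ?_
  filter_upwards [eventually_poleSq_ne h] with Y hY
  rw [confMap_eq hY]

theorem continuous_horiz : Continuous (horiz : Rn d → Bd d) := by
  unfold horiz
  exact (PiLp.continuous_toLp 2 _).comp (by fun_prop)

theorem confMap_of_norm_eq_one {y : Rn d} (hy : ‖y‖ = 1) :
    confMap y = pt (horiz (confMap y)) 0 := by
  conv_lhs => rw [← pt_horiz_vert (confMap y), vert_confMap, hy]
  simp

/-- A compactly supported function of the boundary point, transplanted to the sphere. -/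
theorem exists_continuousOn_sphere {h : Bd d → ℝ} (hc : Continuous h) (hs : HasCompactSupport h) :
    ∃ H : Rn d → ℝ, ContinuousOn H (Metric.sphere (0 : Rn d) 1) ∧
      ∀ x, H (confMap (pt x 0)) = h x := by
  classical
  refine ⟨fun y => if y = pole d then 0 else h (horiz (confMap y)), ?_, ?_⟩
  · obtain ⟨R, hR⟩ := hs.isCompact.isBounded.subset_closedBall 0
    have hzero : ∀ x : Bd d, R < ‖x‖ → h x = 0 := by
      intro x hx
      refine image_eq_zero_of_notMem_tsupport fun hmem => ?_
      have := hR hmem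
      simp only [Metric.mem_closedBall, dist_zero_right] at this
      linarith
    intro y hy
    by_cases hyp : y = pole d
    · subst hyp
      have hps : Tendsto (poleSq : Rn d → ℝ) (𝓝 (pole d)) (𝓝 0) := by
        have := (contDiff_poleSq (n := 0) (d := d)).continuous.tendsto (pole d)
        simpa [poleSq] using this
      -- Points of the sphere near the pole have images far out in the boundary plane, beyond the
      -- support of `h`.
      have hev : ∀ᶠ z in 𝓝[Metric.sphere (0 : Rn d) 1] (pole d),
          (if z = pole d then 0 else h (horiz (confMap z))) = 0 := by
        have hpos : (0 : ℝ) < 4 / (1 + R ^ 2) := by positivity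
        filter_upwards [self_mem_nhdsWithin,
          nhdsWithin_le_nhds (hps.eventually_lt_const hpos)] with z hz hlt
        split_ifs with hzp
        · rfl
        · refine hzero _ ?_
          have hz1 : ‖z‖ = 1 := by simpa using hz
          have hz0 := poleSq_ne_zero_iff.2 hzp
          have hz0' : 0 < poleSq z := lt_of_le_of_ne (poleSq_nonneg z) hz0.symm
          have h1 := poleSq_confMap hz0
          rw [confMap_of_norm_eq_one hz1, poleSq_boundary] at h1
          have h2 : 1 + R ^ 2 < 4 / poleSq z := by
            rw [lt_div_iff₀ (by positivity)] at hlt ⊢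
            linarith
          rw [← h1] at h2
          have h3 := norm_nonneg (horiz (confMap z))
          nlinarith
      refine ContinuousWithinAt.congr_of_eventuallyEq (f := fun _ => (0 : ℝ))
        continuousWithinAt_const hev (by simp)
    · have hy0 := poleSq_ne_zero_iff.2 hyp
      refine ContinuousAt.continuousWithinAt ?_
      have h1 : ContinuousAt (fun y : Rn d => h (horiz (confMap y))) y :=
        hc.continuousAt.comp (continuous_horiz.continuousAt.comp (continuousAt_confMap hy0))
      refine h1.congr ?_
      filter_upwards [isOpen_ne.mem_nhds hyp] with z hz
      rw [if_neg hz]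
  · intro x
    have h0 := poleSq_boundary_ne x
    have hne := poleSq_ne_zero_iff.1 (poleSq_confMap_ne h0)
    simp only [if_neg hne, confMap_confMap h0, horiz_pt]

/-- The weighted boundary values of Kelvin transforms of harmonic polynomials are dense. -/
theorem exists_bdKel_near (hd : 2 ≤ d) {f : Bd d → ℝ} (hf : MemLp f 2 volume) {ε : ℝ}
    (hε : 0 < ε) : ∃ P ∈ ⨆ k, homHarm (Fin (d + 1)) k,
      eLpNorm (fun x => f x - bdKel P x) 2 volume < ENNReal.ofReal ε := by
  have hε4 : ENNReal.ofReal (ε / 4) ≠ 0 := by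
    rw [Ne, ENNReal.ofReal_eq_zero]; linarith
  obtain ⟨g, hgs, hfg, hgc, hg⟩ :=
    hf.exists_hasCompactSupport_eLpNorm_sub_le ENNReal.ofNat_ne_top hε4
  -- The weighted boundary values are κ · (P ∘ F) with κ positive and in L². It therefore suffices
  -- to approximate g/κ uniformly on the sphere, with an error that ‖κ‖ turns into at most ε/4; the
  -- M + 1 below avoids dividing by 0.
  set κ : Bd d → ℝ := bdKel 1 with hκ
  have hκ1 : ∀ (P : MvPolynomial (Fin (d + 1)) ℝ) (x : Bd d),
      bdKel P x = κ x * eval (fun i => confMap (pt x 0) i) P := by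
    intro P x; simp [hκ, bdKel, kel]; ring
  have hκpos : ∀ x, 0 < κ x := by
    intro x
    have h1 := bdWeight_pos hd x
    have h2 := stdBubble_pos hd (poleSq_boundary_ne x)
    simp only [hκ, bdKel, kel, map_one, mul_one]
    positivity
  have hκ2 : MemLp κ 2 volume := memLp_bdKel hd 1
  have hκc : Continuous κ := continuous_bdKel 1
  obtain ⟨H, hHc, hH⟩ := exists_continuousOn_sphere (h := fun x => g x / κ x)
    (hgc.div hκc fun x => (hκpos x).ne') (by
      simp only [div_eq_mul_inv]
      exact hgs.mul_right)
  set M := (eLpNorm κ 2 volume).toReal with hM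
  have hM0 : 0 ≤ M := ENNReal.toReal_nonneg
  have hδ : 0 < ε / (4 * (M + 1)) := by positivity
  obtain ⟨P, hP⟩ := exists_polynomial_near_on_sphere hHc hδ
  -- Only values on the sphere count, so P may be exchanged for a sum of homogeneous harmonic
  -- polynomials.
  obtain ⟨Q, hQ, hPQ⟩ := exists_harmonic_eq_on_sphere P
  refine ⟨Q, hQ, ?_⟩
  have hgQ : eLpNorm (fun x => g x - bdKel Q x) 2 volume ≤ ENNReal.ofReal (ε / 4) := by
    have h1 : ∀ᵐ x : Bd d, ‖g x - bdKel Q x‖ ≤ ε / (4 * (M + 1)) * ‖κ x‖ := by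
      refine Eventually.of_forall fun x => ?_
      have hy := norm_confMap_boundary x
      have h2 := hP _ hy
      have hsum : ∑ i, confMap (pt x 0) i ^ 2 = 1 := by
        rw [← EuclideanSpace.real_norm_sq_eq, hy, one_pow]
      rw [hPQ _ hsum, hH] at h2
      rw [hκ1, Real.norm_of_nonneg (hκpos x).le]
      have e : g x - κ x * eval (fun i => confMap (pt x 0) i) Q =
          -(κ x * (eval (fun i => confMap (pt x 0) i) Q - g x / κ x)) := by
        have := (hκpos x).ne'
        field_simp
        ring
      rw [e, norm_neg, norm_mul, Real.norm_of_nonneg (hκpos x).le, mul_comm]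
      exact mul_le_mul_of_nonneg_right h2.le (hκpos x).le
    refine (eLpNorm_le_mul_eLpNorm_of_ae_le_mul h1 2).trans ?_
    rw [← ENNReal.ofReal_toReal hκ2.2.ne, ← hM, ← ENNReal.ofReal_mul hδ.le]
    refine ENNReal.ofReal_le_ofReal ?_
    have : ε / (4 * (M + 1)) * M = ε / 4 * (M / (M + 1)) := by field_simp
    rw [this]
    have : M / (M + 1) ≤ 1 := by rw [div_le_one (by positivity)]; linarith
    nlinarith
  calc eLpNorm (fun x => f x - bdKel Q x) 2 volume
      = eLpNorm ((f - g) + fun x => g x - bdKel Q x) 2 volume := by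
        congr 1; funext x; simp
    _ ≤ eLpNorm (f - g) 2 volume + eLpNorm (fun x => g x - bdKel Q x) 2 volume :=
        eLpNorm_add_le (hf.1.sub hg.1) (hg.1.sub (memLp_bdKel hd Q).1) one_le_two
    _ ≤ ENNReal.ofReal (ε / 4) + ENNReal.ofReal (ε / 4) := add_le_add hfg hgQ
    _ = ENNReal.ofReal (ε / 2) := by
        rw [← ENNReal.ofReal_add (by positivity) (by positivity)]; congr 1; ring
    _ < ENNReal.ofReal ε := (ENNReal.ofReal_lt_ofReal_iff hε).2 (by linarith)

end Density

/-! ### The tangent space as Kelvin transforms of degree 0 and 1 -/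

section Tangent

open MvPolynomial

variable {d : ℕ}

theorem stdBubble_eq_kel : stdBubble d = kel 1 := by
  funext X; simp [kel]

theorem hasDerivAt_bubble_aux {f : ℝ → ℝ} {f' a m s : ℝ} (c : ℝ) (hs : 0 < s)
    (hf : HasDerivAt f f' a) (hfa : f a = 1 / s) :
    HasDerivAt (fun l => c * f l ^ m) (c * (1 / s) ^ m * (m * (s * f'))) a := by
  have h0 : f a ≠ 0 := by rw [hfa]; positivity
  refine ((hf.rpow_const (p := m) (Or.inl h0)).const_mul c).congr_deriv ?_
  rw [hfa, Real.rpow_sub_one (by positivity)]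
  field_simp

theorem stdBubble_eq_one_div_rpow (X : Rn d) :
    stdBubble d X = (dim d - 2) ^ kelExp d * (1 / poleSq X) ^ kelExp d := by
  rw [stdBubble_eq, Real.rpow_neg (poleSq_nonneg X), one_div, Real.inv_rpow (poleSq_nonneg X)]

/-- The logarithmic derivative in λ is m(1 - |X|²)/|X - e|², and the fraction is the last coordinate
of F(X). -/
theorem dScale_eq {X : Rn d} (h : -1 < vert X) :
    dScale d X = kel (kelExp d • MvPolynomial.X (Fin.last d)) X := by
  have hs := poleSq_pos_of_vert h
  have hD : HasDerivAt (fun l : ℝ => (1 + l * vert X) ^ 2 + l ^ 2 * ‖horiz X - 0‖ ^ 2)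
      (2 * (1 + vert X) * vert X + 2 * ‖horiz X‖ ^ 2) 1 := by
    have h1 := (((hasDerivAt_id (1 : ℝ)).mul_const (vert X)).const_add 1).fun_pow 2
    have h2 := ((hasDerivAt_id (1 : ℝ)).fun_pow 2).mul_const (‖horiz X - 0‖ ^ 2)
    refine (h1.fun_add h2).congr_deriv ?_
    simp
  have hD1 : (1 + 1 * vert X) ^ 2 + 1 ^ 2 * ‖horiz X - 0‖ ^ 2 = poleSq X := by
    rw [poleSq_eq]; simp
  have hq := (hasDerivAt_id (1 : ℝ)).fun_div hD (by rw [hD1]; exact hs.ne')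
  have hb := hasDerivAt_bubble_aux (m := kelExp d) ((dim d - 2) ^ kelExp d) hs hq
    (by simp only [id]; rw [hD1])
  have : dScale d X = _ := hb.deriv
  rw [this, ← stdBubble_eq_one_div_rpow, kel_smul, kel, eval_X]
  change _ = kelExp d * (stdBubble d X * vert (confMap X))
  rw [vert_confMap, hD1]
  have e := poleSq_eq X
  have e' := norm_sq_eq X
  simp only [id]
  field_simp
  rw [e', e]
  ring

/-- The logarithmic derivative in zᵢ is m · 2xᵢ/|X - e|², that is, m times the i-th coordinate of
F(X). -/
theorem dShift_eq (i : Fin d) {X : Rn d} (h : -1 < vert X) :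
    dShift i X = kel (kelExp d • MvPolynomial.X i.castSucc) X := by
  have hs := poleSq_pos_of_vert h
  have hN : ∀ s : ℝ, ‖horiz X - EuclideanSpace.single i s‖ ^ 2 =
      ‖horiz X‖ ^ 2 - 2 * (s * X i.castSucc) + s ^ 2 := by
    intro s
    rw [norm_sub_sq_real, EuclideanSpace.inner_single_right]
    simp [horiz]
  have hD : HasDerivAt (fun s : ℝ => (1 + 1 * vert X) ^ 2 +
      1 ^ 2 * ‖horiz X - EuclideanSpace.single i s‖ ^ 2) (-(2 * X i.castSucc)) 0 := by
    simp only [hN]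
    have h1 := (((((hasDerivAt_id (0 : ℝ)).mul_const (X i.castSucc)).const_mul 2).const_sub
      (‖horiz X‖ ^ 2)).fun_add ((hasDerivAt_id (0 : ℝ)).fun_pow 2)).const_mul (1 ^ 2)
    refine (h1.const_add ((1 + 1 * vert X) ^ 2)).congr_deriv ?_
    simp
  have hD1 : (1 + 1 * vert X) ^ 2 + 1 ^ 2 * ‖horiz X - EuclideanSpace.single i (0 : ℝ)‖ ^ 2 =
      poleSq X := by
    rw [hN, poleSq_eq]; simp
  have hq := (hasDerivAt_const (0 : ℝ) (1 : ℝ)).fun_div hD (by rw [hD1]; exact hs.ne')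
  have hb := hasDerivAt_bubble_aux (m := kelExp d) ((dim d - 2) ^ kelExp d) hs hq
    (by rw [hD1])
  have : dShift i X = _ := hb.deriv
  rw [this, ← stdBubble_eq_one_div_rpow, kel_smul, kel, eval_X, confMap_apply hs.ne', hD1]
  simp only [pole_castSucc]
  field_simp
  ring

theorem HasGrad.congr_fun {u v : Rn d → ℝ} {G : Rn d → Rn d} (h : HasGrad u G)
    (huv : u =ᵐ[halfVol d] v) : HasGrad v G := by
  obtain ⟨φ, hφ⟩ := h
  exact ⟨φ, hφ.congr huv EventuallyEq.rfl⟩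

theorem h1Inner_of_ae_eq_kel (hd : 2 ≤ d) {ρ v : Rn d → ℝ} {P : MvPolynomial (Fin (d + 1)) ℝ}
    (hv : ∀ X : Rn d, 0 < vert X → v X = kel P X) :
    h1Inner ρ v = ∫ X, inner ℝ (grad ρ X) (gradKel P X) ∂(halfVol d) := by
  have hae : kel P =ᵐ[halfVol d] v := by
    filter_upwards [ae_halfVol_vert] with X hX
    exact (hv X hX).symm
  have := ((hasGrad_kel hd P).congr_fun hae).grad_ae_eq hd
  refine integral_congr_ae ?_
  filter_upwards [this] with X hX
  rw [hX]

end Tangent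

/-! ### Equality almost everywhere on the ball and on the half-space -/

section Transplant

open MvPolynomial

variable {d : ℕ}

theorem differentiableAt_confMap {y : Rn d} (h : poleSq y ≠ 0) : DifferentiableAt ℝ confMap y := by
  have h1 : DifferentiableAt ℝ (fun X : Rn d => pole d + (2 / poleSq X) • (X - pole d)) y := by
    have hq : DifferentiableAt ℝ (fun X : Rn d => 2 / poleSq X) y :=
      (contDiffAt_const.div (contDiff_poleSq (n := 1)).contDiffAt h).differentiableAt one_ne_zero
    exact (differentiableAt_const _).add (hq.smul
      (differentiableAt_id.sub (differentiableAt_const _)))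
  refine h1.congr_of_eventuallyEq ?_
  filter_upwards [eventually_poleSq_ne h] with Y hY
  rw [confMap_eq hY]

/-- Differentiable maps send null sets to null sets. Because F is an involution, the preimage of the
exceptional set within S lies in its image. -/
theorem ae_confMap_of_ae {S T : Set (Rn d)} (hS : MeasurableSet S) (hT : MeasurableSet T)
    (hT0 : ∀ y ∈ T, poleSq y ≠ 0) (hS0 : ∀ X ∈ S, poleSq X ≠ 0) (hST : ∀ X ∈ S, confMap X ∈ T)
    {p : Rn d → Prop} (h : ∀ᵐ y ∂(volume.restrict T), p y) :
    ∀ᵐ X ∂(volume.restrict S), p (confMap X) := by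
  rw [ae_restrict_iff' hT, ae_iff] at h
  have hnull : volume (confMap '' {y | ¬(y ∈ T → p y)}) = 0 := by
    refine addHaar_image_eq_zero_of_differentiableOn_of_addHaar_eq_zero volume ?_ h
    intro y hy
    have hyT : y ∈ T := by
      by_contra hn
      exact hy fun h => absurd h hn
    exact (differentiableAt_confMap (hT0 y hyT)).differentiableWithinAt
  rw [ae_restrict_iff' hS]
  filter_upwards [compl_mem_ae_iff.2 hnull] with X hX hXS
  by_contra hp
  refine hX ⟨confMap X, fun himp => hp (himp (hST X hXS)), confMap_confMap (hS0 X hXS)⟩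

theorem memR_iff (hd : 2 ≤ d) {k : ℕ} {ρ : Rn d → ℝ} :
    MemR k ρ ↔ ∃ P ∈ homHarm (Fin (d + 1)) k, ρ =ᵐ[halfVol d] kel P := by
  have hb : ∀ y ∈ Metric.ball (0 : Rn d) 1, ‖y‖ < 1 := fun y hy => by simpa using hy
  have hs : ∀ X ∈ halfSpace d, poleSq X ≠ 0 := fun X hX =>
    (poleSq_pos_of_vert (lt_trans (by norm_num) hX)).ne'
  constructor
  · rintro ⟨P, hP, h⟩
    refine ⟨P, isHomHarmonic_iff.1 hP, ?_⟩
    have h' := ae_confMap_of_ae (S := halfSpace d) measurableSet_halfSpace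
      Metric.isOpen_ball.measurableSet (fun y hy => poleSq_ne_zero_of_norm_lt (hb y hy)) hs
      (fun X hX => by simpa using norm_confMap_lt hX) h
    have hmem := ae_restrict_mem (μ := volume) (measurableSet_halfSpace (d := d))
    filter_upwards [h', hmem] with X hX hXS
    have hU := stdBubble_pos hd (hs X hXS)
    rw [transplant, confMap_confMap (hs X hXS)] at hX
    rw [kel, ← hX]
    field_simp
  · rintro ⟨P, hP, h⟩
    refine ⟨P, isHomHarmonic_iff.2 hP, ?_⟩
    have h' := ae_confMap_of_ae (S := Metric.ball (0 : Rn d) 1) Metric.isOpen_ball.measurableSet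
      measurableSet_halfSpace hs (fun y hy => poleSq_ne_zero_of_norm_lt (hb y hy))
      (fun y hy => confMap_mem_halfSpace (hb y hy)) h
    have hmem := ae_restrict_mem (μ := volume)
      (Metric.isOpen_ball (x := (0 : Rn d)) (ε := 1)).measurableSet
    filter_upwards [h', hmem] with y hy hyb
    have hy0 := poleSq_ne_zero_of_norm_lt (hb y hyb)
    have hU := stdBubble_pos hd (poleSq_confMap_ne hy0)
    rw [transplant, hy, kel, confMap_confMap hy0]
    field_simp

end Transplant

/-! ### The L² operators to which the abstract gap is applied -/

section Main

open MvPolynomial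

variable {d : ℕ}

theorem gradKel_add (P Q : MvPolynomial (Fin (d + 1)) ℝ) (X : Rn d) :
    gradKel (P + Q) X = gradKel P X + gradKel Q X := by
  ext i; simp [kel_add]

theorem gradKel_smul (c : ℝ) (P : MvPolynomial (Fin (d + 1)) ℝ) (X : Rn d) :
    gradKel (c • P) X = c • gradKel P X := by
  ext i; simp [kel_smul]

/-- The gradients of Kelvin transforms as elements of `L²`. -/
def gradLp (hd : 2 ≤ d) : MvPolynomial (Fin (d + 1)) ℝ →ₗ[ℝ] Lp (Rn d) 2 (halfVol d) where
  toFun P := (memLp_gradKel hd P).toLp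
  map_add' P Q := by
    rw [← MemLp.toLp_add]
    exact MemLp.toLp_congr _ _ (Eventually.of_forall fun X => gradKel_add P Q X)
  map_smul' c P := by
    rw [RingHom.id_apply, ← MemLp.toLp_const_smul]
    exact MemLp.toLp_congr _ _ (Eventually.of_forall fun X => gradKel_smul c P X)

/-- The weighted boundary values of Kelvin transforms as elements of `L²`. -/
def bdLp (hd : 2 ≤ d) : MvPolynomial (Fin (d + 1)) ℝ →ₗ[ℝ] Lp ℝ 2 (volume : Measure (Bd d)) where
  toFun P := (memLp_bdKel hd P).toLp
  map_add' P Q := by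
    rw [← MemLp.toLp_add]
    exact MemLp.toLp_congr _ _ (Eventually.of_forall fun x => by simp [bdKel, kel_add, mul_add])
  map_smul' c P := by
    rw [RingHom.id_apply, ← MemLp.toLp_const_smul]
    refine MemLp.toLp_congr _ _ (Eventually.of_forall fun x => ?_)
    simp only [bdKel, kel_smul, Pi.smul_apply, smul_eq_mul]
    ring

theorem inner_toLp {α F : Type*} [MeasurableSpace α] {μ : Measure α} [NormedAddCommGroup F]
    [InnerProductSpace ℝ F] {f g : α → F} (hf : MemLp f 2 μ) (hg : MemLp g 2 μ) :
    inner ℝ hf.toLp hg.toLp = ∫ x, inner ℝ (f x) (g x) ∂μ := by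
  rw [L2.inner_def]
  refine integral_congr_ae ?_
  filter_upwards [hf.coeFn_toLp, hg.coeFn_toLp] with x h1 h2
  rw [h1, h2]

theorem eig_strictMono (hd : 2 ≤ d) : StrictMono (eig d) := by
  intro a b hab
  have h3 : 0 < dim d - 2 := by linarith [three_le_dim hd]
  have : (a : ℝ) < b := by exact_mod_cast hab
  unfold eig
  gcongr

theorem eig_zero_pos (hd : 2 ≤ d) : 0 < eig d 0 := by
  have h3 : 0 < dim d - 2 := by linarith [three_le_dim hd]
  unfold eig
  exact div_pos (by simpa using h3) h3

theorem bdLp_dense (hd : 2 ≤ d) (x : Lp ℝ 2 (volume : Measure (Bd d))) {ε : ℝ} (hε : 0 < ε) :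
    ∃ P ∈ ⨆ k, homHarm (Fin (d + 1)) k, ‖x - bdLp hd P‖ < ε := by
  obtain ⟨P, hP, h⟩ := exists_bdKel_near hd (Lp.memLp x) hε
  refine ⟨P, hP, ?_⟩
  rw [Lp.norm_def]
  refine (ENNReal.toReal_lt_of_lt_ofReal ?_)
  refine lt_of_le_of_lt (le_of_eq (eLpNorm_congr_ae ?_)) h
  filter_upwards [Lp.coeFn_sub x (bdLp hd P), (memLp_bdKel hd P).coeFn_toLp] with y h1 h2
  rw [h1, Pi.sub_apply]
  congr 1

instance finiteDimensional_homHarm (k : ℕ) :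
    FiniteDimensional ℝ (homHarm (Fin (d + 1)) k) := by
  have : FiniteDimensional ℝ (homogeneousSubmodule (Fin (d + 1)) ℝ k) :=
    Module.Finite.iff_fg.2 (homogeneousSubmodule_fg _ _ k)
  exact Submodule.finiteDimensional_of_le (inf_le_left : homHarm (Fin (d + 1)) k ≤ _)

end Main

end EscobarGap

end

/-! ### The gap inequality and its equality case -/

open EscobarGap in
theorem theorem7p1 (d : ℕ) (hd : 2 ≤ d) (ρ : Rn d → ℝ) (hρ : MemH1 ρ)
    (hperp : ∀ v ∈ tangentSpace d, h1Inner ρ v = 0) :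
    HasTrace ρ (trace ρ) ∧
    Integrable (fun x : Bd d => stdBubble d (pt x 0) ^ (pExp d - 1) * trace ρ x ^ 2) ∧
    (h1NormSq ρ ≥ (dim d + 2) / (dim d - 2) *
        (∫ x : Bd d, stdBubble d (pt x 0) ^ (pExp d - 1) * trace ρ x ^ 2)) ∧
    (h1NormSq ρ = (dim d + 2) / (dim d - 2) *
        (∫ x : Bd d, stdBubble d (pt x 0) ^ (pExp d - 1) * trace ρ x ^ 2) ↔ MemR 2 ρ) := by
  have htr := hρ.hasTrace_trace hd
  have hgr := hρ.hasGrad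
  have hGm : MemLp (grad ρ) 2 (halfVol d) := hgr.choose_spec.memLp_grad
  have hTm := memLp_bdWeight_mul hd htr.1
  have hsq : ∀ x : Bd d, stdBubble d (pt x 0) ^ (pExp d - 1) * trace ρ x ^ 2 =
      (bdWeight d x * trace ρ x) * (bdWeight d x * trace ρ x) := by
    intro x
    rw [← bdWeight_mul_self hd]
    ring
  set G := hGm.toLp with hG
  set T := hTm.toLp with hT
  have hGn : h1NormSq ρ = ‖G‖ ^ 2 := by
    rw [← real_inner_self_eq_norm_sq, hG, inner_toLp, h1NormSq]
    simp only [real_inner_self_eq_norm_sq]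
  have hTn : ∫ x : Bd d, stdBubble d (pt x 0) ^ (pExp d - 1) * trace ρ x ^ 2 = ‖T‖ ^ 2 := by
    rw [← real_inner_self_eq_norm_sq, hT, inner_toLp]
    simp only [hsq]
    rfl
  have hlam : (dim d + 2) / (dim d - 2) = eig d 2 := by
    unfold eig; push_cast; congr 1; ring
  have hgt : ∀ k l, ∀ P ∈ homHarm (Fin (d + 1)) k, ∀ Q ∈ homHarm (Fin (d + 1)) l,
      inner ℝ (gradLp hd P) (gradLp hd Q) = eig d l * inner ℝ (bdLp hd P) (bdLp hd Q) := by
    intro k l P _ Q hQ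
    have h := green_kel hd P hQ
    rw [gradLp, bdLp]
    simp only [LinearMap.coe_mk, AddHom.coe_mk]
    rw [inner_toLp, inner_toLp, h]
    congr 1
    refine integral_congr_ae (Eventually.of_forall fun x => ?_)
    simp [mul_comm]
  have hinner : ∀ P, inner ℝ G (gradLp hd P) =
      ∫ X, inner ℝ (grad ρ X) (gradKel P X) ∂(halfVol d) := fun P =>
    inner_toLp hGm (memLp_gradKel hd P)
  have hGT : ∀ k, ∀ P ∈ homHarm (Fin (d + 1)) k,
      inner ℝ G (gradLp hd P) = eig d k * inner ℝ T (bdLp hd P) := by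
    intro k P hP
    rw [hinner, green_trace hd htr hgr hP]
    congr 1
    refine Eq.trans ?_ (inner_toLp hTm (memLp_bdKel hd P)).symm
    refine integral_congr_ae (Eventually.of_forall fun x => ?_)
    simp [mul_comm]
  -- Agreement on the open half-space is all that is needed, because the H¹ inner product does not
  -- see the rest; `dScale` and `dShift` are identified with transforms only for t > -1.
  have hker : ∀ {v : Rn d → ℝ} {P : MvPolynomial (Fin (d + 1)) ℝ}, v ∈ tangentSpace d →
      (∀ X : Rn d, 0 < vert X → v X = kel P X) → inner ℝ G (gradLp hd P) = 0 := by
    intro v P hv hvP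
    rw [hinner, ← h1Inner_of_ae_eq_kel hd hvP]
    exact hperp v hv
  have h0 : ∀ P ∈ homHarm (Fin (d + 1)) 0, inner ℝ G (gradLp hd P) = 0 := by
    intro P hP
    obtain ⟨hhom, -⟩ := mem_homHarm.1 hP
    have hC : P = MvPolynomial.coeff 0 P • 1 := by
      conv_lhs => rw [MvPolynomial.totalDegree_eq_zero_iff_eq_C.1
        ((MvPolynomial.totalDegree_zero_iff_isHomogeneous _).2 hhom)]
      rw [← MvPolynomial.C_mul', mul_one]
    rw [hC, map_smul, inner_smul_right, hker (v := stdBubble d)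
      (Submodule.subset_span (Or.inl (Or.inl rfl))) (fun X _ => by rw [stdBubble_eq_kel]), mul_zero]
  have hm := (kelExp_pos hd).ne'
  have hX : ∀ i, inner ℝ G (gradLp hd (MvPolynomial.X i)) = 0 := by
    intro i
    have h : inner ℝ G (gradLp hd (kelExp d • MvPolynomial.X i)) = 0 := by
      refine Fin.lastCases ?_ (fun i => ?_) i
      · exact hker (v := dScale d) (Submodule.subset_span (Or.inl (Or.inr rfl)))
          fun X hX => dScale_eq (by linarith)
      · exact hker (v := dShift i) (Submodule.subset_span (Or.inr ⟨i, rfl⟩))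
          fun X hX => dShift_eq i (by linarith)
    rw [map_smul, inner_smul_right] at h
    exact (mul_eq_zero.1 h).resolve_left hm
  have h1 : ∀ P ∈ homHarm (Fin (d + 1)) 1, inner ℝ G (gradLp hd P) = 0 := by
    intro P hP
    have hspan : P ∈ Submodule.span ℝ (Set.range MvPolynomial.X) := by
      rw [← MvPolynomial.homogeneousSubmodule_one_eq_span_X]
      exact (Submodule.mem_inf.1 hP).1
    clear hP
    induction hspan using Submodule.span_induction with
    | mem x hx => obtain ⟨i, rfl⟩ := hx; exact hX i
    | zero => simp
    | add x y _ _ hx hy => rw [map_add, inner_add_right, hx, hy, add_zero]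
    | smul a x _ hx => rw [map_smul, inner_smul_right, hx, mul_zero]
  refine ⟨htr, ?_, ?_, ?_⟩
  · simp only [hsq]
    exact hTm.integrable_mul hTm
  · rw [hTn, hGn, hlam]
    exact spectral_gap (eig_strictMono hd) (eig_zero_pos hd) hgt
      (fun x ε hε => bdLp_dense hd x hε) hGT h0 h1
  · rw [hTn, hGn, hlam, spectral_gap_eq_iff (eig_strictMono hd) (eig_zero_pos hd) hgt
      (fun x ε hε => bdLp_dense hd x hε) hGT h0 h1, memR_iff hd]
    -- A gradient determines its function (`HasGrad.ae_eq`) and conversely (`HasGrad.ae_unique`), so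
    -- equality of gradients in L² is equality of ρ with the transform.
    refine exists_congr fun P => and_congr_right fun _ => ?_
    constructor
    · intro h
      have hae : grad ρ =ᵐ[halfVol d] gradKel P :=
        (MemLp.toLp_eq_toLp_iff hGm (memLp_gradKel hd P)).1 h
      exact hgr.ae_eq hd (hasGrad_kel hd P) hae
    · intro h
      exact (MemLp.toLp_eq_toLp_iff hGm (memLp_gradKel hd P)).2
        (hgr.ae_unique hd (hasGrad_kel hd P) h)
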